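/- Let $L\ge 1$, $p\in(0,1)$ and let $\alpha\in\mathcal M_L(\mathbb C)$ have spectral norm $<1$. Put $\rho=(1-\alpha\alpha^*)^{1/2}$, $\tilde\rho=(1-\alpha^*\alpha)^{1/2}$. Let $(\widetilde V^{(n)},d^{(n)},\theta^{(n)},\widetilde U^{(n)},D^{(n)},\Theta^{(n)})_{n\in\mathbb Z}$ be independent random variables, where $\widetilde U^{(n)},\widetilde V^{(n)}$ are Haar distributed on the unitary group $U(L)$, $d^{(n)},D^{(n)}$ are diagonal matrices whose $L$ diagonal entries are i.i.d. with values $1$ and $-1$ taken with probability $p$ and $1-p$, and $\theta^{(n)},\Theta^{(n)}$ are diagonal matrices whose $L$ diagonal entries are i.i.d. uniform on $[0,2\pi]$. Set $$U^{(n)}_\omega=e^{i\Theta^{(n)}}\widetilde U^{(n)}D^{(n)}(\widetilde U^{(n)})^*,\qquad V^{(n)}_\omega=\widetilde V^{(n)}d^{(n)}(\widetilde V^{(n)})^*e^{i\theta^{(n)}},\qquad S^{(n)}_\omega=\begin{pmatrix}\alpha&\rho U^{(n)}_\omega\\ V^{(n)}_\omega\tilde\rho&-V^{(n)}_\omega\alpha^*U^{(n)}_\omega\end{pmatrix}.$$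 Let $\mathbb U_\omega=\mathbb V_\omega\mathbb W_\omega$ on $\ell^2(\mathbb Z,\mathbb C^L)$, where $\mathbb V_\omega$ (resp. $\mathbb W_\omega$) is the direct sum of the $S^{(n)}_\omega$ with $n$ even (resp. odd), $S^{(n)}_\omega$ acting on the sites $n,n+1$. For $a<b$ in $\mathbb Z\cup\{\pm\infty\}$ and boundary conditions $U,V\in U(L)$, let $\mathbb U_\omega^{[a,b]}=\mathbb V_\omega^{[a,b]}\mathbb W_\omega^{[a,b]}$ on $\ell^2([a,b]\cap\mathbb Z,\mathbb C^L)$ be defined in the same way, except that $S^{(a-1)}_\omega$ is replaced by $U$ acting on the site $a$ (if $a>-\infty$) and $S^{(b)}_\omega$ by $V$ acting on the site $b$ (if $b<+\infty$); thus $\mathbb U_\omega^{[-\infty,+\infty]}=\mathbb U_\omega$. For $|z|\ne1$ let $G^{[a,b]}_\omega(z,k,l)\in\mathcal M_L(\mathbb C)$ be the $(k,l)$ block of $(\mathbb U_\omega^{[a,b]}-z)^{-1}$, and $G_\omega=G_\omega^{[-\infty,+\infty]}$. Let $\|\cdot\|$ be the matrix norm on $\mathcal M_L(\mathbb C)$ subordinate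 to some norm on $\mathbb C^L$, and for $\epsilon>0$ let $\mathbb S_\epsilon=\{z\in\mathbb C:1-\epsilon<|z|<1+\epsilon\}$. For every $s\in(0,\frac12)$ there is a constant $C(s)>0$ such that for every $\epsilon>0$, every $z\in\mathbb S_\epsilon$ with $|z|\neq1$, all $U,V\in U(L)$, all $a<b$ in $\mathbb Z\cup\{\pm\infty\}$ and all integers $k,l$ with $a<k,l<b$ and $|k-l|>4$, the two expectations below are finite and $$\Big(\mathbb E\,\big\|G^{[a,b]}_\omega(z,k,l)\big\|^s\Big)^2\le C(s)\;\mathbb E\,\big\|G^{[k,l]}_\omega(z,k,l)\big\|^{2s},$$ where $[k,l]$ stands for $[l,k]$ if $l<k$. In particular, for $a=-\infty$, $b=+\infty$, $\big(\mathbb E\|G_\omega(z,k,l)\|^s\big)^2\le C(s)\,\mathbb E\|G^{[k,l]}_\omega(z,k,l)\|^{2s}$. The constant depends only on $s$ and on the fixed data $L,p,\alpha,\|\cdot\|$. -/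

import Mathlib

namespace ScatteringZipper

open MeasureTheory Matrix

open scoped MatrixOrder

noncomputable section

/-! ### The probability space -/

/-- The unitary group `U(L)`. -/
abbrev UL (L : ℕ) : Type := Matrix.unitaryGroup (Fin L) ℂ

instance instMeasurableSpaceUL (L : ℕ) : MeasurableSpace (UL L) := borel (UL L)

instance instBorelSpaceUL (L : ℕ) : BorelSpace (UL L) := ⟨rfl⟩

instance instCompactSpaceUL (L : ℕ) : CompactSpace (UL L) := by
  have hc : IsCompact (Set.univ.pi fun _ : Fin L => Set.univ.pi fun _ : Fin L =>
      Metric.closedBall (0 : ℂ) 1) :=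
    isCompact_univ_pi fun _ => isCompact_univ_pi fun _ => isCompact_closedBall _ _
  have hcl : IsClosed ((Matrix.unitaryGroup (Fin L) ℂ : Set (Matrix (Fin L) (Fin L) ℂ))) :=
    isClosed_unitary
  refine isCompact_iff_compactSpace.mp (hc.of_isClosed_subset hcl ?_)
  intro A hA i _ j _
  simpa using entry_norm_bound_of_unitary hA i j

/-- The angles, i.e. the interval `[0, 2π]`. -/
abbrev Angle : Type := Set.Icc (0 : ℝ) (2 * Real.pi)

/-- `U(L) × {-1,1}^L × [0,2π]^L`. -/
abbrev PhaseData (L : ℕ) : Type := UL L × (Fin L → ℤˣ) × (Fin L → Angle)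

/-- The one-site sample space `(U(L) × {-1,1}^L × [0,2π]^L)^2`. The first factor carries
`(Ṽ, d, θ)`, the second one `(Ũ, D, Θ)`. -/
abbrev SiteData (L : ℕ) : Type := PhaseData L × PhaseData L

/-- The sample space: one `SiteData` for every integer. -/
abbrev Sample (L : ℕ) : Type := ℤ → SiteData L

/-- The normalized Haar measure on `U(L)`. -/
def haarUL (L : ℕ) : Measure (UL L) := Measure.haarMeasure ⊤

instance (L : ℕ) : IsProbabilityMeasure (haarUL L) := by
  constructor
  have h := Measure.haarMeasure_self (G := UL L) (K₀ := ⊤)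
  simpa [haarUL] using h

/-- The uniform law on `[0, 2π]`. -/
def uniformAngle : Measure Angle :=
  (ENNReal.ofReal (2 * Real.pi))⁻¹ • Measure.comap Subtype.val (volume : Measure ℝ)

instance : IsProbabilityMeasure uniformAngle := by
  constructor
  have h : (Measure.comap (Subtype.val : Angle → ℝ) (volume : Measure ℝ)) Set.univ
      = ENNReal.ofReal (2 * Real.pi) := by
    rw [(MeasurableEmbedding.subtype_coe measurableSet_Icc).comap_apply, Set.image_univ,
      Subtype.range_coe, Real.volume_Icc, sub_zero]
  rw [uniformAngle, Measure.smul_apply, h, smul_eq_mul]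
  exact ENNReal.inv_mul_cancel (by simpa using Real.pi_pos) ENNReal.ofReal_ne_top

/-- Haar ⊗ Bernoulli(p)^L ⊗ uniform^L. -/
def phaseLaw (L : ℕ) (p : unitInterval) : Measure (PhaseData L) :=
  (haarUL L).prod
    ((Measure.pi fun _ : Fin L => ProbabilityTheory.bernoulliMeasure (1 : ℤˣ) (-1) p).prod
      (Measure.pi fun _ : Fin L => uniformAngle))

instance (L : ℕ) (p : unitInterval) : IsProbabilityMeasure (phaseLaw L p) := by
  unfold phaseLaw; infer_instance

/-- The law of one site. -/
def siteLaw (L : ℕ) (p : unitInterval) : Measure (SiteData L) :=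
  (phaseLaw L p).prod (phaseLaw L p)

instance (L : ℕ) (p : unitInterval) : IsProbabilityMeasure (siteLaw L p) := by
  unfold siteLaw; infer_instance

/-- The product probability measure on the sample space. -/
def law (L : ℕ) (p : unitInterval) : Measure (Sample L) :=
  Measure.infinitePi fun _ : ℤ => siteLaw L p

instance (L : ℕ) (p : unitInterval) : IsProbabilityMeasure (law L p) := by
  unfold law; infer_instance

/-! ### The random phases and the scattering matrices -/

/-- The diagonal matrix with entries `exp (i θ_j)`. -/
def expDiag {L : ℕ} (θ : Fin L → Angle) : UL L :=
  ⟨diagonal fun j => Complex.exp (Complex.I * ((θ j : ℝ) : ℂ)), by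
    rw [mem_unitaryGroup_iff, star_eq_conjTranspose, diagonal_conjTranspose,
      diagonal_mul_diagonal, ← diagonal_one]
    congr 1
    funext j
    rw [Pi.star_apply, Complex.star_def, ← Complex.exp_conj, ← Complex.exp_add]
    simp⟩

/-- The diagonal matrix with entries `d_j ∈ {-1, 1}`. -/
def signDiag {L : ℕ} (d : Fin L → ℤˣ) : UL L :=
  ⟨diagonal fun j => (((d j : ℤˣ) : ℤ) : ℂ), by
    rw [mem_unitaryGroup_iff, star_eq_conjTranspose, diagonal_conjTranspose,
      diagonal_mul_diagonal, ← diagonal_one]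
    congr 1
    funext j
    rcases Int.units_eq_one_or (d j) with h | h <;> simp [h]⟩

/-- `V = Ṽ d Ṽ* exp(iθ)`. -/
def phaseV {L : ℕ} (x : SiteData L) : UL L :=
  x.1.1 * signDiag x.1.2.1 * star x.1.1 * expDiag x.1.2.2

/-- `U = exp(iΘ) Ũ D Ũ*`. -/
def phaseU {L : ℕ} (x : SiteData L) : UL L :=
  expDiag x.2.2.2 * (x.2.1 * signDiag x.2.2.1 * star x.2.1)

/-- `ρ(α) = (1 - α α*)^{1/2}`. -/
def rho {L : ℕ} (α : Matrix (Fin L) (Fin L) ℂ) : Matrix (Fin L) (Fin L) ℂ :=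
  CFC.sqrt (1 - α * αᴴ)

/-- `ρ̃(α) = (1 - α* α)^{1/2}`. -/
def rhoTilde {L : ℕ} (α : Matrix (Fin L) (Fin L) ℂ) : Matrix (Fin L) (Fin L) ℂ :=
  CFC.sqrt (1 - αᴴ * α)

/-- The scattering matrix `S(α, U, V)`. -/
def scat {L : ℕ} (α : Matrix (Fin L) (Fin L) ℂ) (U V : UL L) :
    Matrix (Fin L ⊕ Fin L) (Fin L ⊕ Fin L) ℂ :=
  fromBlocks α (rho α * U.1) (V.1 * rhoTilde α) (-(V.1 * αᴴ * U.1))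

/-! ### Zipper operators on intervals -/

/-- The spectral norm of a square matrix, i.e. the norm subordinate to the Euclidean norm. -/
def specNorm {L : ℕ} (A : Matrix (Fin L) (Fin L) ℂ) : ℝ :=
  ‖toEuclideanCLM (n := Fin L) (𝕜 := ℂ) A‖

/-- The Hilbert space `ℓ²(J, ℂ^L)`, for a set `J` of integers. -/
abbrev Ell2 (J : Set ℤ) (L : ℕ) : Type :=
  lp (fun _ : J => EuclideanSpace ℂ (Fin L)) 2

/-- Boundedness of the blocks of a family of scattering matrices. -/
def BddBlocks {L : ℕ} (S : ℤ → Matrix (Fin L ⊕ Fin L) (Fin L ⊕ Fin L) ℂ) : Prop :=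
  ∃ C : ℝ, ∀ n, specNorm (S n).toBlocks₁₁ ≤ C ∧ specNorm (S n).toBlocks₁₂ ≤ C ∧
    specNorm (S n).toBlocks₂₁ ≤ C ∧ specNorm (S n).toBlocks₂₂ ≤ C

/-- The direct sum over all `n` with `n ≡ e (mod 2)` of the matrices `S n`, where `S n` acts on
the two neighbouring sites `n` and `n + 1`, restricted to `J` as follows: if only the right site
`n + 1` of such a pair lies in `J`, then `S n` is replaced there by the boundary condition `Ub`;
if only the left site `n` lies in `J`, then `S n` is replaced there by `Vb`.
This is the action on an arbitrary family of vectors. -/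
def layerFun {L : ℕ} (S : ℤ → Matrix (Fin L ⊕ Fin L) (Fin L ⊕ Fin L) ℂ) (Ub Vb : UL L)
    (J : Set ℤ) (e : ℤ) (v : J → EuclideanSpace ℂ (Fin L)) (i : J) :
    EuclideanSpace ℂ (Fin L) :=
  open scoped Classical in
  if Even ((i : ℤ) - e) then
    if h : (i : ℤ) + 1 ∈ J then
      toEuclideanCLM (𝕜 := ℂ) (S i).toBlocks₁₁ (v i)
        + toEuclideanCLM (𝕜 := ℂ) (S i).toBlocks₁₂ (v ⟨(i : ℤ) + 1, h⟩)
    else toEuclideanCLM (𝕜 := ℂ) Vb.1 (v i)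
  else
    if h : (i : ℤ) - 1 ∈ J then
      toEuclideanCLM (𝕜 := ℂ) (S ((i : ℤ) - 1)).toBlocks₂₁ (v ⟨(i : ℤ) - 1, h⟩)
        + toEuclideanCLM (𝕜 := ℂ) (S ((i : ℤ) - 1)).toBlocks₂₂ (v i)
    else toEuclideanCLM (𝕜 := ℂ) Ub.1 (v i)

/-- The site that is paired with `i` in a layer (`i` itself if there is none in `J`). -/
def partner (J : Set ℤ) (e : ℤ) (i : J) : J :=
  open scoped Classical in
  if Even ((i : ℤ) - e) then
    if h : (i : ℤ) + 1 ∈ J then ⟨(i : ℤ) + 1, h⟩ else i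
  else
    if h : (i : ℤ) - 1 ∈ J then ⟨(i : ℤ) - 1, h⟩ else i

theorem partner_involutive (J : Set ℤ) (e : ℤ) : Function.Involutive (partner J e) := by
  intro i
  have h1 : Even ((i : ℤ) + 1 - e) ↔ ¬ Even ((i : ℤ) - e) := by
    rw [show (i : ℤ) + 1 - e = ((i : ℤ) - e) + 1 by ring, Int.even_add_one]
  have h2 : Even ((i : ℤ) - 1 - e) ↔ ¬ Even ((i : ℤ) - e) := by
    rw [show (i : ℤ) - 1 - e = ((i : ℤ) - e) - 1 by ring, Int.even_sub_one]
  by_cases he : Even ((i : ℤ) - e)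
  · by_cases h : (i : ℤ) + 1 ∈ J
    · simp [partner, he, h, h1]
    · simp [partner, he, h]
  · by_cases h : (i : ℤ) - 1 ∈ J
    · simp [partner, he, h, h2]
    · simp [partner, he, h]

theorem toEuclideanCLM_le {L : ℕ} {A : Matrix (Fin L) (Fin L) ℂ} {C : ℝ} (h : specNorm A ≤ C)
    (x : EuclideanSpace ℂ (Fin L)) : ‖toEuclideanCLM (𝕜 := ℂ) A x‖ ≤ C * ‖x‖ :=
  (ContinuousLinearMap.le_opNorm _ x).trans (mul_le_mul_of_nonneg_right h (norm_nonneg x))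

theorem specNorm_unitary_le {L : ℕ} (U : UL L) : specNorm U.1 ≤ 1 := by
  have h : toEuclideanCLM (n := Fin L) (𝕜 := ℂ) U.1 ∈ unitary _ :=
    Unitary.map_mem (toEuclideanCLM (n := Fin L) (𝕜 := ℂ)) U.2
  refine ContinuousLinearMap.opNorm_le_bound _ zero_le_one fun x => ?_
  rw [one_mul]
  exact (ContinuousLinearMap.norm_map_of_mem_unitary h x).le

theorem layerFun_bound {L : ℕ} {S : ℤ → Matrix (Fin L ⊕ Fin L) (Fin L ⊕ Fin L) ℂ}
    (hS : BddBlocks S) (Ub Vb : UL L) (J : Set ℤ) (e : ℤ) :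
    ∃ C : ℝ, 0 ≤ C ∧ ∀ (v : J → EuclideanSpace ℂ (Fin L)) (i : J),
      ‖layerFun S Ub Vb J e v i‖ ≤ C * (‖v i‖ + ‖v (partner J e i)‖) := by
  obtain ⟨C, hC⟩ := hS
  refine ⟨max C 1, le_trans zero_le_one (le_max_right _ _), fun v i => ?_⟩
  have hm : ∀ (U : UL L) (x : EuclideanSpace ℂ (Fin L)),
      ‖toEuclideanCLM (𝕜 := ℂ) U.1 x‖ ≤ max C 1 * ‖x‖ := fun U x =>
    toEuclideanCLM_le ((specNorm_unitary_le U).trans (le_max_right _ _)) x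
  have h0 : (0 : ℝ) ≤ max C 1 := le_trans zero_le_one (le_max_right _ _)
  unfold layerFun partner
  split_ifs with he h h
  · obtain ⟨a, b, -, -⟩ := hC i
    have ha := toEuclideanCLM_le (a.trans (le_max_left C 1)) (v i)
    have hb := toEuclideanCLM_le (b.trans (le_max_left C 1)) (v ⟨(i : ℤ) + 1, h⟩)
    refine (norm_add_le _ _).trans ?_
    rw [mul_add]
    exact add_le_add ha hb
  · refine (hm Vb (v i)).trans ?_
    nlinarith [norm_nonneg (v i)]
  · obtain ⟨-, -, a, b⟩ := hC ((i : ℤ) - 1)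
    have ha := toEuclideanCLM_le (a.trans (le_max_left C 1)) (v ⟨(i : ℤ) - 1, h⟩)
    have hb := toEuclideanCLM_le (b.trans (le_max_left C 1)) (v i)
    refine (norm_add_le _ _).trans ?_
    rw [mul_add, add_comm (max C 1 * ‖v i‖)]
    exact add_le_add ha hb
  · refine (hm Ub (v i)).trans ?_
    nlinarith [norm_nonneg (v i)]

theorem ell2_of_sq_le {L : ℕ} {J : Set ℤ} {C : ℝ} (h0 : 0 ≤ C) (σ : J ≃ J) (v : Ell2 J L)
    (w : J → EuclideanSpace ℂ (Fin L)) (hw : ∀ i, ‖w i‖ ≤ C * (‖v i‖ + ‖v (σ i)‖)) :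
    ∃ hv : Memℓp w 2, ‖(⟨w, hv⟩ : Ell2 J L)‖ ≤ 2 * C * ‖v‖ := by
  have hp : (0 : ℝ) < (2 : ENNReal).toReal := by norm_num
  have hv2 : Summable fun i => ‖v i‖ ^ 2 := by
    simpa using (lp.memℓp v).summable hp
  have hvs : Summable fun i => ‖v (σ i)‖ ^ 2 :=
    (σ.summable_iff (f := fun i => ‖v i‖ ^ 2)).mpr hv2
  have hts : ∑' i, ‖v (σ i)‖ ^ 2 = ∑' i, ‖v i‖ ^ 2 :=
    σ.tsum_eq (fun i => ‖v i‖ ^ 2)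
  have hle : ∀ i, ‖w i‖ ^ 2 ≤ 2 * C ^ 2 * (‖v i‖ ^ 2 + ‖v (σ i)‖ ^ 2) := fun i => by
    have h1 := pow_le_pow_left₀ (norm_nonneg _) (hw i) 2
    refine h1.trans ?_
    nlinarith [mul_nonneg (sq_nonneg C) (sq_nonneg (‖v i‖ - ‖v (σ i)‖))]
  have hsum : Summable fun i => 2 * C ^ 2 * (‖v i‖ ^ 2 + ‖v (σ i)‖ ^ 2) :=
    (hv2.add hvs).mul_left _
  have hs : Summable fun i => ‖w i‖ ^ 2 :=
    Summable.of_nonneg_of_le (fun i => by positivity) hle hsum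
  have hmem : Memℓp w 2 := memℓp_gen (by simpa using hs)
  refine ⟨hmem, ?_⟩
  have hnv : ‖v‖ ^ 2 = ∑' i, ‖v i‖ ^ 2 := by
    simpa using lp.norm_rpow_eq_tsum hp v
  have hnw : ‖(⟨w, hmem⟩ : Ell2 J L)‖ ^ 2 = ∑' i, ‖w i‖ ^ 2 := by
    simpa using lp.norm_rpow_eq_tsum hp (⟨w, hmem⟩ : Ell2 J L)
  refine le_of_sq_le_sq ?_ (by positivity)
  rw [hnw, mul_pow, hnv]
  calc ∑' i, ‖w i‖ ^ 2
      ≤ ∑' i, 2 * C ^ 2 * (‖v i‖ ^ 2 + ‖v (σ i)‖ ^ 2) := hs.tsum_le_tsum hle hsum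
    _ = (2 * C) ^ 2 * ∑' i, ‖v i‖ ^ 2 := by
      rw [tsum_mul_left, hv2.tsum_add hvs, hts]; ring

theorem layerFun_sq_bound {L : ℕ} {S : ℤ → Matrix (Fin L ⊕ Fin L) (Fin L ⊕ Fin L) ℂ}
    (hS : BddBlocks S) (Ub Vb : UL L) (J : Set ℤ) (e : ℤ) :
    ∃ C : ℝ, ∀ v : Ell2 J L, ∃ hv : Memℓp (layerFun S Ub Vb J e v) 2,
      ‖(⟨layerFun S Ub Vb J e v, hv⟩ : Ell2 J L)‖ ≤ C * ‖v‖ := by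
  obtain ⟨C, h0, hC⟩ := layerFun_bound hS Ub Vb J e
  exact ⟨2 * C, fun v => ell2_of_sq_le h0 (partner_involutive J e).toPerm v _ (hC v)⟩

/-- `layerFun` as a linear map on `ℓ²(J, ℂ^L)`. -/
def layerLin {L : ℕ} (S : ℤ → Matrix (Fin L ⊕ Fin L) (Fin L ⊕ Fin L) ℂ) (hS : BddBlocks S)
    (Ub Vb : UL L) (J : Set ℤ) (e : ℤ) : Ell2 J L →ₗ[ℂ] Ell2 J L where
  toFun v := ⟨layerFun S Ub Vb J e v, by
    obtain ⟨C, h⟩ := layerFun_sq_bound hS Ub Vb J e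
    exact (h v).1⟩
  map_add' v w := by
    ext1
    funext i
    simp only [lp.coeFn_add, Pi.add_apply, layerFun, map_add]
    split_ifs <;> abel
  map_smul' c v := by
    ext1
    funext i
    simp only [lp.coeFn_smul, Pi.smul_apply, layerFun, map_smul, RingHom.id_apply]
    split_ifs <;> simp

/-- `layerFun` as a bounded operator on `ℓ²(J, ℂ^L)`. -/
def layer {L : ℕ} (S : ℤ → Matrix (Fin L ⊕ Fin L) (Fin L ⊕ Fin L) ℂ) (hS : BddBlocks S)
    (Ub Vb : UL L) (J : Set ℤ) (e : ℤ) : Ell2 J L →L[ℂ] Ell2 J L :=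
  (layerLin S hS Ub Vb J e).mkContinuousOfExistsBound (by
    obtain ⟨C, h⟩ := layerFun_sq_bound hS Ub Vb J e
    exact ⟨C, fun v => (h v).2⟩)

/-- The scattering matrix `S^{(n)}_ω`. -/
def randomScat {L : ℕ} (α : Matrix (Fin L) (Fin L) ℂ) (ω : Sample L) (n : ℤ) :
    Matrix (Fin L ⊕ Fin L) (Fin L ⊕ Fin L) ℂ :=
  scat α (phaseU (ω n)) (phaseV (ω n))

theorem specNorm_mul_le {L : ℕ} (A B : Matrix (Fin L) (Fin L) ℂ) :
    specNorm (A * B) ≤ specNorm A * specNorm B := by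
  unfold specNorm
  rw [map_mul]
  exact norm_mul_le _ _

theorem bddBlocks_randomScat {L : ℕ} (α : Matrix (Fin L) (Fin L) ℂ) (ω : Sample L) :
    BddBlocks (randomScat α ω) := by
  have hnn : ∀ A : Matrix (Fin L) (Fin L) ℂ, 0 ≤ specNorm A := fun A => norm_nonneg _
  have hR : ∀ (A : Matrix (Fin L) (Fin L) ℂ) (U : UL L), specNorm (A * U.1) ≤ specNorm A :=
    fun A U => (specNorm_mul_le A U.1).trans
      (mul_le_of_le_one_right (hnn A) (specNorm_unitary_le U))
  have hL : ∀ (A : Matrix (Fin L) (Fin L) ℂ) (U : UL L), specNorm (U.1 * A) ≤ specNorm A :=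
    fun A U => (specNorm_mul_le U.1 A).trans
      (mul_le_of_le_one_left (hnn A) (specNorm_unitary_le U))
  have hneg : ∀ A : Matrix (Fin L) (Fin L) ℂ, specNorm (-A) = specNorm A := fun A => by
    unfold specNorm; rw [map_neg, norm_neg]
  refine ⟨specNorm α + specNorm (rho α) + specNorm (rhoTilde α) + specNorm αᴴ, fun n => ?_⟩
  simp only [randomScat, scat, toBlocks_fromBlocks₁₁, toBlocks_fromBlocks₁₂,
    toBlocks_fromBlocks₂₁, toBlocks_fromBlocks₂₂, hneg]
  have h2 := hR (rho α) (phaseU (ω n))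
  have h3 := hL (rhoTilde α) (phaseV (ω n))
  have h4 := (hR ((phaseV (ω n)).1 * αᴴ) (phaseU (ω n))).trans (hL αᴴ (phaseV (ω n)))
  have := hnn α
  have := hnn (rho α)
  have := hnn (rhoTilde α)
  have := hnn αᴴ
  refine ⟨?_, ?_, ?_, ?_⟩ <;> linarith

/-- The random scattering zipper `𝕌_ω^J = 𝕍_ω^J 𝕎_ω^J` on `ℓ²(J, ℂ^L)`, where `𝕍` is the layer
of the matrices `S^{(n)}_ω` with `n` even and `𝕎` the layer of those with `n` odd. For `J = ℤ`
there is no boundary and this is the operator `𝕌_ω`. -/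
def zipper {L : ℕ} (α : Matrix (Fin L) (Fin L) ℂ) (Ub Vb : UL L) (ω : Sample L) (J : Set ℤ) :
    Ell2 J L →L[ℂ] Ell2 J L :=
  (layer (randomScat α ω) (bddBlocks_randomScat α ω) Ub Vb J 0).comp
    (layer (randomScat α ω) (bddBlocks_randomScat α ω) Ub Vb J 1)

/-- The block `G_ω^J(z, k, l)` of the resolvent `(𝕌_ω^J - z)⁻¹`: its `(p, q)` entry is the
`(k, p)` coordinate of the image of the canonical basis vector `e_{l,q}`. -/
def green {L : ℕ} (α : Matrix (Fin L) (Fin L) ℂ) (Ub Vb : UL L) (ω : Sample L) (J : Set ℤ)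
    (z : ℂ) (k l : J) : Matrix (Fin L) (Fin L) ℂ :=
  Matrix.of fun p q =>
    open scoped Classical in
    (Ring.inverse (zipper α Ub Vb ω J - z • (1 : Ell2 J L →L[ℂ] Ell2 J L))
      (lp.single 2 l (EuclideanSpace.single q (1 : ℂ)))) k p

/-- The set of integers of the interval `[a, b]`, where `a` may be `-∞` and `b` may be `+∞`. -/
def interval (a : WithBot ℤ) (b : WithTop ℤ) : Set ℤ :=
  {n | a ≤ (n : WithBot ℤ) ∧ (n : WithTop ℤ) ≤ b}

/-- The whole lattice: the operator on `interval ⊥ ⊤` is the infinite-volume operator. -/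
theorem interval_bot_top : interval ⊥ ⊤ = Set.univ := by
  ext n
  simp [interval]

/-- The matrix norm subordinate to the norm `N` on `ℂ^L`. -/
def subordinateNorm {L : ℕ} (N : Seminorm ℂ (Fin L → ℂ)) (A : Matrix (Fin L) (Fin L) ℂ) : ℝ :=
  sSup {t : ℝ | ∃ v : Fin L → ℂ, N v ≤ 1 ∧ t = N (A *ᵥ v)}

/-- The annulus `𝕊_ε = {z : 1 - ε < |z| < 1 + ε}`. -/
def annulus (ε : ℝ) : Set ℂ := {z | 1 - ε < ‖z‖ ∧ ‖z‖ < 1 + ε}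

end

end ScatteringZipper

open MeasureTheory Matrix
open scoped MatrixOrder

namespace ScatteringZipper

open scoped InnerProduct InnerProductSpace ENNReal

set_option linter.unusedSectionVars false

/-! Cutting the bond to the left of the smaller of `k`, `l` and the bond to the right of the larger
one isolates the box. Each cut costs a random factor whose fractional moment, averaged over a single
phase, is bounded uniformly in everything else. This gives E‖G^{[a,b]}‖^s ≤ C E‖G^{[k,l]}‖^s for
every s < 1 (`integral_subordinateNorm_green_le`), and Jensen's inequality E[X^s]² ≤ E[X^{2s}] then
gives the theorem.

Deterministic part. When the bond (n, n+1) is cut, the zipper becomes a unitary T that splits over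
the two sides, and the original operator is DT or TD with D unitary and acting only on the sites n,
n+1. The resolvent identity bounds a block with one index next to the cut by (1 + 2P) times the same
block of the cut system (`IsSplit.norm_gblk_le`). Here P = `pairSum` is the sum of the norms of the
four blocks of z(U - z)⁻¹ on these two sites. The factor z keeps the bounds uniform in z, including
near z = 0.

Reduction to one block. On each side of the cut T conserves energy, so the energy flux through the
end site has a definite sign for |z| < 1 and for |z| > 1. As ‖α‖ < 1, the diagonal block of D at
site n is a strict contraction, and the amplitude at n is controlled by the one at n+1. With the
reflection z ↦ 1/z̄ this bounds all four blocks by the diagonal block at n+1 (`pairSum_mul_le`).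

Averaging. Adding η to all angles θ of site n preserves the law and multiplies the lower row of
S^{(n)} by w = e^{iη}. The block at n+1 is then governed by ⟨v, (1 - R(w)K)⁻¹v⟩, where ‖K‖ < 1 and
R(w) multiplies the site n+1 by w. Twice this function minus ‖v‖² is holomorphic in the disc, has
positive real part, and equals ‖v‖² at w = 0. Kolmogorov's argument bounds the mean of its s-th
power independently of K (`lintegral_inner_inverse_le`). The cut system does not contain S^{(n)}, so
its block is constant in η and leaves the average. One cut acts on the row index, the other on the
column index. -/

/-! ### Fractional means of holomorphic functions with positive real part -/

theorem norm_rpow_le_re_cpow {h : ℂ} (hh : 0 < h.re) {s : ℝ} (hs0 : 0 < s) (hs1 : s < 1) :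
    ‖h‖ ^ s ≤ (Real.cos (Real.pi * s / 2))⁻¹ * (h ^ (s : ℂ)).re := by
  have hne : h ≠ 0 := by rintro rfl; simp at hh
  have hcos : 0 < Real.cos (Real.pi * s / 2) :=
    Real.cos_pos_of_mem_Ioo ⟨by nlinarith [Real.pi_pos], by nlinarith [Real.pi_pos]⟩
  have hre : (h ^ (s : ℂ)).re = ‖h‖ ^ s * Real.cos (h.arg * s) := by
    have h1 := Complex.cpow_ofReal_re h s
    simpa using h1
  rw [hre, inv_mul_eq_div, le_div_iff₀ hcos]
  refine mul_le_mul_of_nonneg_left ?_ (by positivity)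
  have harg : |h.arg| ≤ Real.pi / 2 := (Complex.abs_arg_lt_pi_div_two_iff.mpr (Or.inl hh)).le
  rw [← Real.cos_abs (h.arg * s), abs_mul, abs_of_pos hs0]
  refine Real.cos_le_cos_of_nonneg_of_le_pi (by positivity) ?_ ?_
  · nlinarith [Real.pi_pos]
  · nlinarith [Real.pi_pos]

/-- Kolmogorov's argument: h^s is holomorphic with values in the sector |arg| ≤ πs/2, where modulus
and real part are comparable. The mean of the real part over the circle is its value at the centre.
-/
theorem lintegral_circle_norm_rpow_le {h : ℂ → ℂ}
    (hd : ∀ w ∈ Metric.closedBall (0 : ℂ) 1, DifferentiableAt ℂ h w)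
    (hre : ∀ w ∈ Metric.closedBall (0 : ℂ) 1, 0 < (h w).re)
    {s : ℝ} (hs0 : 0 < s) (hs1 : s < 1) :
    ∫⁻ η in Set.Ioc 0 (2 * Real.pi), ENNReal.ofReal (‖h (circleMap 0 1 η)‖ ^ s) ≤
      ENNReal.ofReal (2 * Real.pi * ((Real.cos (Real.pi * s / 2))⁻¹ * ‖h 0‖ ^ s)) := by
  have hcos : 0 < Real.cos (Real.pi * s / 2) :=
    Real.cos_pos_of_mem_Ioo ⟨by nlinarith [Real.pi_pos], by nlinarith [Real.pi_pos]⟩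
  have hmem : ∀ η, circleMap 0 1 η ∈ Metric.closedBall (0 : ℂ) 1 := fun η =>
    circleMap_mem_closedBall 0 zero_le_one η
  have hsd : ∀ w ∈ Metric.closedBall (0 : ℂ) 1,
      DifferentiableAt ℂ (fun w => h w ^ (s : ℂ)) w := fun w hw =>
    (hd w hw).cpow_const (Or.inl (hre w hw))
  have hcl : DiffContOnCl ℂ (fun w => h w ^ (s : ℂ)) (Metric.ball 0 |(1 : ℝ)|) := by
    rw [abs_one]
    refine DifferentiableOn.diffContOnCl fun w hw => ?_
    rw [closure_ball _ one_ne_zero] at hw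
    exact (hsd w hw).differentiableWithinAt
  have havg := hcl.circleAverage
  have hcont : Continuous fun η => h (circleMap 0 1 η) := continuous_iff_continuousAt.mpr fun η =>
    ContinuousAt.comp (f := fun η => circleMap 0 1 η) (hd _ (hmem η)).continuousAt
      (continuous_circleMap 0 1).continuousAt
  have hcont2 : Continuous fun η => h (circleMap 0 1 η) ^ (s : ℂ) :=
    continuous_iff_continuousAt.mpr fun η =>
    ContinuousAt.comp (f := fun η => circleMap 0 1 η) (hsd _ (hmem η)).continuousAt
      (continuous_circleMap 0 1).continuousAt
  have hcn : Continuous fun η => ‖h (circleMap 0 1 η)‖ ^ s :=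
    hcont.norm.rpow_const fun _ => Or.inr hs0.le
  have h2pi : (0 : ℝ) ≤ 2 * Real.pi := by positivity
  rw [← ofReal_integral_eq_lintegral_ofReal
    ((intervalIntegrable_iff_integrableOn_Ioc_of_le h2pi).mp (hcn.intervalIntegrable _ _))
    (Filter.Eventually.of_forall fun η => by positivity)]
  refine ENNReal.ofReal_le_ofReal ?_
  rw [← intervalIntegral.integral_of_le h2pi]
  have hI : ∫ η in (0 : ℝ)..2 * Real.pi, (h (circleMap 0 1 η) ^ (s : ℂ)).re
      = 2 * Real.pi * (h 0 ^ (s : ℂ)).re := by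
    have h1 := congrArg Complex.re havg
    rw [Real.circleAverage_def] at h1
    have h3 : ∫ η in (0 : ℝ)..2 * Real.pi, (h (circleMap 0 1 η) ^ (s : ℂ)).re
        = (∫ η in (0 : ℝ)..2 * Real.pi, h (circleMap 0 1 η) ^ (s : ℂ)).re :=
      intervalIntegral.intervalIntegral_re (hcont2.intervalIntegrable _ _)
    rw [h3]
    rw [Complex.smul_re, smul_eq_mul, inv_mul_eq_iff_eq_mul₀ (by positivity)] at h1
    exact h1
  calc ∫ η in (0 : ℝ)..2 * Real.pi, ‖h (circleMap 0 1 η)‖ ^ s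
      ≤ ∫ η in (0 : ℝ)..2 * Real.pi,
          (Real.cos (Real.pi * s / 2))⁻¹ * (h (circleMap 0 1 η) ^ (s : ℂ)).re := by
        refine intervalIntegral.integral_mono h2pi (hcn.intervalIntegrable _ _)
          (((Complex.continuous_re.comp hcont2).const_mul _).intervalIntegrable _ _) fun η => ?_
        exact norm_rpow_le_re_cpow (hre _ (hmem η)) hs0 hs1
    _ = (Real.cos (Real.pi * s / 2))⁻¹ * (2 * Real.pi * (h 0 ^ (s : ℂ)).re) := by
        rw [intervalIntegral.integral_const_mul, hI]
    _ ≤ (Real.cos (Real.pi * s / 2))⁻¹ * (2 * Real.pi * ‖h 0‖ ^ s) := by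
        gcongr
        refine (Complex.re_le_norm _).trans (le_of_eq ?_)
        exact Complex.norm_cpow_real _ _
    _ = _ := by ring

/-! ### Rotating the phase of one site, and the Herglotz function of a contraction -/

section Rotation

variable {H E : Type*} [NormedAddCommGroup H] [InnerProductSpace ℂ H] [CompleteSpace H]
  [NormedAddCommGroup E] [InnerProductSpace ℂ E] [CompleteSpace E]

/-- The operator that multiplies the range of the isometry `ι` by `w` and fixes its orthogonal
complement. -/
noncomputable def rot (ι : E →L[ℂ] H) (w : ℂ) : H →L[ℂ] H := 1 + (w - 1) • (ι ∘L ι†)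

theorem rot_apply (ι : E →L[ℂ] H) (w : ℂ) (x : H) :
    rot ι w x = x + (w - 1) • ι ((ι†) x) := by
  simp [rot]

theorem adjoint_apply_self {ι : E →L[ℂ] H} (hι : ι† ∘L ι = 1) (a : E) : (ι†) (ι a) = a := by
  simpa using DFunLike.congr_fun hι a

theorem adjoint_rot_apply {ι : E →L[ℂ] H} (hι : ι† ∘L ι = 1) (w : ℂ) (x : H) :
    (ι†) (rot ι w x) = w • (ι†) x := by
  rw [rot_apply, map_add, map_smul, adjoint_apply_self hι, sub_smul, one_smul]
  abel

theorem norm_isometry_apply {ι : E →L[ℂ] H} (hι : ι† ∘L ι = 1) (a : E) : ‖ι a‖ = ‖a‖ := by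
  have h : ⟪ι a, ι a⟫_ℂ = ⟪a, a⟫_ℂ := by
    rw [← ContinuousLinearMap.adjoint_inner_right, adjoint_apply_self hι]
  rw [inner_self_eq_norm_sq_to_K, inner_self_eq_norm_sq_to_K] at h
  have h' : ‖ι a‖ ^ 2 = ‖a‖ ^ 2 := by exact_mod_cast h
  exact (sq_eq_sq₀ (norm_nonneg _) (norm_nonneg _)).mp h'

theorem norm_rot_sq {ι : E →L[ℂ] H} (hι : ι† ∘L ι = 1) (w : ℂ) (x : H) :
    ‖rot ι w x‖ ^ 2 = ‖x - ι ((ι†) x)‖ ^ 2 + ‖w‖ ^ 2 * ‖(ι†) x‖ ^ 2 := by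
  have hx : rot ι w x = (x - ι ((ι†) x)) + w • ι ((ι†) x) := by
    rw [rot_apply, sub_smul, one_smul]; abel
  have horth : ⟪x - ι ((ι†) x), w • ι ((ι†) x)⟫_ℂ = 0 := by
    rw [inner_smul_right, ← ContinuousLinearMap.adjoint_inner_left, map_sub,
      adjoint_apply_self hι]
    simp
  rw [hx, sq, norm_add_sq_eq_norm_sq_add_norm_sq_of_inner_eq_zero _ _ horth, norm_smul,
    norm_isometry_apply hι]
  ring

/-- This contractivity is what permits extending the phase w from the unit circle to the whole disc.
-/
theorem norm_rot_apply_le {ι : E →L[ℂ] H} (hι : ι† ∘L ι = 1) {w : ℂ} (hw : ‖w‖ ≤ 1) (x : H) :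
    ‖rot ι w x‖ ≤ ‖x‖ := by
  have h1 := norm_rot_sq hι w x
  have h2 := norm_rot_sq hι 1 x
  have h3 : rot ι 1 x = x := by simp [rot_apply]
  rw [h3, norm_one] at h2
  refine le_of_sq_le_sq ?_ (norm_nonneg _)
  have : ‖w‖ ^ 2 ≤ 1 ^ 2 := by gcongr
  nlinarith [sq_nonneg ‖(ι†) x‖]

theorem rot_mul_rot {ι : E →L[ℂ] H} (hι : ι† ∘L ι = 1) (w w' : ℂ) :
    rot ι w * rot ι w' = rot ι (w * w') := by
  ext x
  rw [mul_apply_eq_comp, rot_apply, adjoint_rot_apply hι, rot_apply, rot_apply,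
    map_smul]
  module

theorem star_rot (ι : E →L[ℂ] H) (w : ℂ) : star (rot ι w) = rot ι (star w) := by
  rw [rot, rot, star_add, star_one, star_smul, star_sub, star_one]
  congr 2
  rw [ContinuousLinearMap.star_eq_adjoint, ContinuousLinearMap.adjoint_comp,
    ContinuousLinearMap.adjoint_adjoint]

theorem rot_mem_unitary {ι : E →L[ℂ] H} (hι : ι† ∘L ι = 1) {w : ℂ} (hw : ‖w‖ = 1) :
    rot ι w ∈ unitary (H →L[ℂ] H) := by
  have h1 : rot ι 1 = 1 := by simp [rot]
  have hw' : w * star w = 1 := by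
    rw [Complex.star_def, Complex.mul_conj, Complex.normSq_eq_norm_sq, hw]; simp
  rw [Unitary.mem_iff, star_rot, rot_mul_rot hι, rot_mul_rot hι, mul_comm (star w), hw', h1]
  exact ⟨rfl, rfl⟩

theorem isUnit_one_sub_rot_mul {ι : E →L[ℂ] H} (hι : ι† ∘L ι = 1) {K : H →L[ℂ] H}
    (hK : ‖K‖ < 1) {w : ℂ} (hw : ‖w‖ ≤ 1) : IsUnit (1 - rot ι w * K) := by
  refine isUnit_one_sub_of_norm_lt_one (lt_of_le_of_lt ?_ hK)
  refine ContinuousLinearMap.opNorm_le_bound _ (norm_nonneg _) fun x => ?_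
  exact (norm_rot_apply_le hι hw _).trans (K.le_opNorm x)

theorem inverse_one_sub_apply {A : H →L[ℂ] H} (hA : IsUnit (1 - A)) (v : H) :
    Ring.inverse (1 - A) v - A (Ring.inverse (1 - A) v) = v := by
  have h := DFunLike.congr_fun (Ring.mul_inverse_cancel _ hA) v
  simpa using h

/-- With x = (1 - A)⁻¹v one has v = x - Ax and 2x - v = x + Ax, so the quantity is Re⟨x - Ax, x +
Ax⟩ = ‖x‖² - ‖Ax‖². -/
theorem re_inner_inverse_pos {A : H →L[ℂ] H} (hA : ∀ x, x ≠ 0 → ‖A x‖ < ‖x‖)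
    (hu : IsUnit (1 - A)) {v : H} (hv : v ≠ 0) :
    0 < (2 * ⟪v, Ring.inverse (1 - A) v⟫_ℂ - ⟪v, v⟫_ℂ).re := by
  set x := Ring.inverse (1 - A) v with hx
  have hxv : x - A x = v := inverse_one_sub_apply hu v
  have hx0 : x ≠ 0 := by
    rintro h0; rw [h0] at hxv; simp at hxv; exact hv hxv.symm
  have h1 : 2 * ⟪v, x⟫_ℂ - ⟪v, v⟫_ℂ = ⟪x - A x, x + A x⟫_ℂ := by
    rw [← hxv]
    simp only [inner_sub_left, inner_sub_right, inner_add_right]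
    ring
  rw [h1]
  have h2 : (⟪x - A x, x + A x⟫_ℂ).re = ‖x‖ ^ 2 - ‖A x‖ ^ 2 := by
    simp only [inner_sub_left, inner_add_right]
    have h3 : (⟪A x, x⟫_ℂ).re = (⟪x, A x⟫_ℂ).re := by
      rw [← inner_conj_symm, Complex.conj_re]
    have h4 : (⟪x, x⟫_ℂ).re = ‖x‖ ^ 2 := inner_self_eq_norm_sq (𝕜 := ℂ) x
    have h5 : (⟪A x, A x⟫_ℂ).re = ‖A x‖ ^ 2 := inner_self_eq_norm_sq (𝕜 := ℂ) (A x)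
    rw [Complex.add_re, Complex.sub_re, Complex.sub_re, h3, h4, h5]
    ring
  rw [h2]
  have := hA x hx0
  nlinarith [norm_nonneg (A x)]

/-- The bound does not involve K: at the centre w = 0 the Herglotz function takes the value ‖a‖²
whatever K is. Hence nothing deteriorates as ‖K‖ → 1, that is, as |z| → 1. -/
theorem lintegral_inner_inverse_le {ι : E →L[ℂ] H} (hι : ι† ∘L ι = 1) {K : H →L[ℂ] H}
    (hK : ‖K‖ < 1) {s : ℝ} (hs0 : 0 < s) (hs1 : s < 1) (a : E) :
    ∫⁻ η in Set.Ioc 0 (2 * Real.pi),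
      ‖⟪ι a, Ring.inverse (1 - rot ι (circleMap 0 1 η) * K) (ι a)⟫_ℂ‖ₑ ^ s ≤
      ENNReal.ofReal (2 * Real.pi * (((Real.cos (Real.pi * s / 2))⁻¹ + 1) * (‖a‖ ^ 2) ^ s)) := by
  have h2pi : (0 : ℝ) ≤ 2 * Real.pi := by positivity
  rcases eq_or_ne a 0 with rfl | ha
  · simp [hs0]
  have hcos : 0 < Real.cos (Real.pi * s / 2) :=
    Real.cos_pos_of_mem_Ioo ⟨by nlinarith [Real.pi_pos], by nlinarith [Real.pi_pos]⟩
  have hv : ι a ≠ 0 := by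
    rw [← norm_ne_zero_iff, norm_isometry_apply hι]; exact norm_ne_zero_iff.mpr ha
  set F : ℂ → ℂ := fun w => ⟪ι a, Ring.inverse (1 - rot ι w * K) (ι a)⟫_ℂ with hF
  set h : ℂ → ℂ := fun w => 2 * F w - ⟪ι a, ι a⟫_ℂ with hh
  have hrot : Differentiable ℂ fun w : ℂ => (1 - rot ι w * K) := by
    unfold rot
    fun_prop
  have hFd : ∀ w ∈ Metric.closedBall (0 : ℂ) 1, DifferentiableAt ℂ F w := fun w hw => by
    have hw' : ‖w‖ ≤ 1 := by simpa using hw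
    have h1 : DifferentiableAt ℂ (fun w => Ring.inverse (1 - rot ι w * K)) w :=
      (hrot w).inverse (isUnit_one_sub_rot_mul hι hK hw')
    exact (innerSL ℂ (ι a)).differentiableAt.comp w
      (h1.clm_apply (differentiableAt_const (ι a)))
  have hd : ∀ w ∈ Metric.closedBall (0 : ℂ) 1, DifferentiableAt ℂ h w := fun w hw =>
    ((hFd w hw).const_mul 2).sub_const _
  have hre : ∀ w ∈ Metric.closedBall (0 : ℂ) 1, 0 < (h w).re := fun w hw => by
    have hw' : ‖w‖ ≤ 1 := by simpa using hw
    refine re_inner_inverse_pos (fun x hx => ?_) (isUnit_one_sub_rot_mul hι hK hw') hv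
    calc ‖rot ι w (K x)‖ ≤ ‖K x‖ := norm_rot_apply_le hι hw' _
      _ ≤ ‖K‖ * ‖x‖ := K.le_opNorm x
      _ < 1 * ‖x‖ := by gcongr
      _ = ‖x‖ := one_mul _
  have hself : ⟪ι a, ι a⟫_ℂ = ((‖a‖ ^ 2 : ℝ) : ℂ) := by
    rw [inner_self_eq_norm_sq_to_K, norm_isometry_apply hι]; norm_cast
  -- At w = 0 the rotation annihilates the range of ι, so the ι-component of the solution x of x -
  -- `rot ι 0` K x = ι a is exactly a.
  have h0 : ‖h 0‖ = ‖a‖ ^ 2 := by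
    have h1 := inverse_one_sub_apply (isUnit_one_sub_rot_mul hι hK (w := 0) (by simp)) (ι a)
    have h2 := congrArg (ι†) h1
    rw [map_sub, mul_apply_eq_comp, adjoint_rot_apply hι, zero_smul, sub_zero,
      adjoint_apply_self hι] at h2
    have h3 : F 0 = ⟪ι a, ι a⟫_ℂ := by
      simp only [hF]
      rw [← ContinuousLinearMap.adjoint_inner_right, h2, ← ContinuousLinearMap.adjoint_inner_right,
        adjoint_apply_self hι]
    simp only [hh, h3, hself]
    rw [show (2 : ℂ) * ((‖a‖ ^ 2 : ℝ) : ℂ) - ((‖a‖ ^ 2 : ℝ) : ℂ) = ((‖a‖ ^ 2 : ℝ) : ℂ) by ring,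
      Complex.norm_real, Real.norm_of_nonneg (by positivity)]
  -- From 2F = h + ‖a‖²; the constant summand is the origin of the `+ 1` next to the inverse cosine
  -- in the bound.
  have hpt : ∀ η : ℝ, ‖F (circleMap 0 1 η)‖ₑ ^ s ≤
      ENNReal.ofReal (‖h (circleMap 0 1 η)‖ ^ s) + ENNReal.ofReal ((‖a‖ ^ 2) ^ s) := fun η => by
    have h1 : ‖F (circleMap 0 1 η)‖ₑ ≤
        ENNReal.ofReal ‖h (circleMap 0 1 η)‖ + ENNReal.ofReal (‖a‖ ^ 2) := by
      rw [← ofReal_norm, ← ENNReal.ofReal_add (norm_nonneg _) (by positivity)]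
      refine ENNReal.ofReal_le_ofReal ?_
      have h2 : (2 : ℂ) * F (circleMap 0 1 η) =
          h (circleMap 0 1 η) + ((‖a‖ ^ 2 : ℝ) : ℂ) := by simp only [hh, hself]; ring
      have h3 := norm_add_le (h (circleMap 0 1 η)) (((‖a‖ ^ 2 : ℝ) : ℂ))
      rw [← h2, norm_mul, Complex.norm_real, Real.norm_of_nonneg (by positivity : 0 ≤ ‖a‖ ^ 2)] at h3
      simp only [Complex.norm_ofNat] at h3
      linarith [norm_nonneg (F (circleMap 0 1 η))]
    calc ‖F (circleMap 0 1 η)‖ₑ ^ s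
        ≤ (ENNReal.ofReal ‖h (circleMap 0 1 η)‖ + ENNReal.ofReal (‖a‖ ^ 2)) ^ s :=
          ENNReal.rpow_le_rpow h1 hs0.le
      _ ≤ _ := (ENNReal.rpow_add_le_add_rpow _ _ hs0.le hs1.le).trans (by
          rw [ENNReal.ofReal_rpow_of_nonneg (norm_nonneg _) hs0.le,
            ENNReal.ofReal_rpow_of_nonneg (by positivity) hs0.le])
  calc _ ≤ ∫⁻ η in Set.Ioc 0 (2 * Real.pi), (ENNReal.ofReal (‖h (circleMap 0 1 η)‖ ^ s)
        + ENNReal.ofReal ((‖a‖ ^ 2) ^ s)) := lintegral_mono hpt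
    _ = (∫⁻ η in Set.Ioc 0 (2 * Real.pi), ENNReal.ofReal (‖h (circleMap 0 1 η)‖ ^ s))
        + ENNReal.ofReal (2 * Real.pi * (‖a‖ ^ 2) ^ s) := by
        rw [lintegral_add_right _ measurable_const, setLIntegral_const, Real.volume_Ioc, sub_zero,
          ← ENNReal.ofReal_mul (by positivity), mul_comm ((‖a‖ ^ 2) ^ s)]
    _ ≤ ENNReal.ofReal (2 * Real.pi * ((Real.cos (Real.pi * s / 2))⁻¹ * (‖a‖ ^ 2) ^ s))
        + ENNReal.ofReal (2 * Real.pi * (‖a‖ ^ 2) ^ s) := by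
        gcongr
        have := lintegral_circle_norm_rpow_le hd hre hs0 hs1
        rwa [h0] at this
    _ = _ := by
        rw [← ENNReal.ofReal_add (by positivity) (by positivity)]
        congr 1; ring

end Rotation

/-! ### Resolvents of unitary operators off the unit circle -/

section Resolvent

variable {H : Type*} [NormedAddCommGroup H] [InnerProductSpace ℂ H] [CompleteSpace H]

/-- The resolvent `(U - z)⁻¹`. -/
noncomputable def res (U : H →L[ℂ] H) (z : ℂ) : H →L[ℂ] H := Ring.inverse (U - z • 1)

theorem norm_apply_of_mem_unitary {U : H →L[ℂ] H} (hU : U ∈ unitary (H →L[ℂ] H)) (x : H) :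
    ‖U x‖ = ‖x‖ := ContinuousLinearMap.norm_map_of_mem_unitary hU x

theorem isUnit_sub_smul {U : H →L[ℂ] H} (hU : U ∈ unitary (H →L[ℂ] H)) {z : ℂ} (hz : ‖z‖ ≠ 1) :
    IsUnit (U - z • 1) := by
  have h1 : z ∉ spectrum ℂ U := fun h => hz (by
    simpa using spectrum.subset_circle_of_unitary hU h)
  have h2 := spectrum.notMem_iff.mp h1
  rw [Algebra.algebraMap_eq_smul_one] at h2
  simpa using h2.neg

theorem res_mul {U : H →L[ℂ] H} (hU : U ∈ unitary (H →L[ℂ] H)) {z : ℂ} (hz : ‖z‖ ≠ 1) :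
    res U z * (U - z • 1) = 1 := Ring.inverse_mul_cancel _ (isUnit_sub_smul hU hz)

theorem mul_res {U : H →L[ℂ] H} (hU : U ∈ unitary (H →L[ℂ] H)) {z : ℂ} (hz : ‖z‖ ≠ 1) :
    (U - z • 1) * res U z = 1 := Ring.mul_inverse_cancel _ (isUnit_sub_smul hU hz)

theorem eq_res_of_mul {U R : H →L[ℂ] H} (hU : U ∈ unitary (H →L[ℂ] H)) {z : ℂ} (hz : ‖z‖ ≠ 1)
    (h : (U - z • 1) * R = 1) : R = res U z := by
  rw [← one_mul R, ← res_mul hU hz, mul_assoc, h, mul_one]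

theorem map_res_apply {U : H →L[ℂ] H} (hU : U ∈ unitary (H →L[ℂ] H)) {z : ℂ} (hz : ‖z‖ ≠ 1)
    (x : H) : U (res U z x) = z • res U z x + x := by
  have h := DFunLike.congr_fun (mul_res hU hz) x
  simp only [mul_apply_eq_comp, _root_.sub_apply, _root_.smul_apply,
    one_apply_eq_self] at h
  exact sub_eq_iff_eq_add'.mp h

theorem res_map_apply {U : H →L[ℂ] H} (hU : U ∈ unitary (H →L[ℂ] H)) {z : ℂ} (hz : ‖z‖ ≠ 1)
    (x : H) : res U z (U x) = z • res U z x + x := by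
  have h := DFunLike.congr_fun (res_mul hU hz) x
  simp only [mul_apply_eq_comp, _root_.sub_apply, _root_.smul_apply,
    one_apply_eq_self, map_sub, map_smul] at h
  exact sub_eq_iff_eq_add'.mp h

/-- Since U is isometric, ‖(U - z)y‖ ≥ |‖z‖ - 1| ‖y‖. The bound blows up at the circle; it serves
only for integrability and continuity, never for the constant of the theorem. -/
theorem norm_res_apply_le {U : H →L[ℂ] H} (hU : U ∈ unitary (H →L[ℂ] H)) {z : ℂ} (hz : ‖z‖ ≠ 1)
    (x : H) : ‖res U z x‖ ≤ |‖z‖ - 1|⁻¹ * ‖x‖ := by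
  have h := map_res_apply hU hz x
  have hx : x = U (res U z x) - z • res U z x := by rw [h]; abel
  have h1 : |‖z‖ - 1| * ‖res U z x‖ ≤ ‖x‖ := by
    have h2 := abs_norm_sub_norm_le (U (res U z x)) (z • res U z x)
    rw [← hx, norm_apply_of_mem_unitary hU, norm_smul] at h2
    calc _ = |‖res U z x‖ - ‖z‖ * ‖res U z x‖| := by
          rw [show ‖res U z x‖ - ‖z‖ * ‖res U z x‖ = -((‖z‖ - 1) * ‖res U z x‖) by ring, abs_neg,
            abs_mul, abs_of_nonneg (norm_nonneg (res U z x))]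
      _ ≤ _ := h2
  have h0 : 0 < |‖z‖ - 1| := abs_pos.mpr (sub_ne_zero.mpr hz)
  rwa [inv_mul_eq_div, le_div_iff₀ h0, mul_comm]

/-- Reflecting the spectral parameter at the unit circle. -/
theorem one_add_smul_res {U : H →L[ℂ] H} (hU : U ∈ unitary (H →L[ℂ] H)) {z : ℂ} (hz : ‖z‖ ≠ 1)
    (hz0 : z ≠ 0) : 1 + z • res U z = -star ((star z)⁻¹ • res U (star z)⁻¹) := by
  set ζ := (star z)⁻¹ with hζ
  have hζ1 : ‖ζ‖ ≠ 1 := by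
    rw [hζ, norm_inv, norm_star]
    intro h; exact hz (inv_eq_one.mp h)
  have hstar : star ζ = z⁻¹ := by rw [hζ, star_inv₀, star_star]
  have hUs := (Unitary.mem_iff.mp hU).2
  -- `star (U - ζ) * star (res U ζ) = 1`
  have h1 : star (res U ζ) * (star U - z⁻¹ • 1) = 1 := by
    have := congrArg star (mul_res hU hζ1)
    rw [star_mul, star_sub, star_smul, star_one, hstar] at this
    exact this
  have h2 : (star U - z⁻¹ • 1) = -(z⁻¹ • (star U * (U - z • 1))) := by
    rw [mul_sub, (Unitary.mem_iff.mp hU).1, mul_smul_comm, mul_one, smul_sub, smul_smul,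
      inv_mul_cancel₀ hz0, one_smul]
    abel
  have h3 : 1 + z • res U z = U * res U z := by
    have := mul_res hU hz
    rw [sub_mul, smul_mul_assoc, one_mul, sub_eq_iff_eq_add] at this
    exact this.symm
  -- Both sides are now forms of U(U - z)⁻¹ = (1 - zU*)⁻¹.
  rw [h3, star_smul, hstar]
  have h4 : star (res U ζ) * -(z⁻¹ • (star U * (U - z • 1))) * (U * res U z) =
      -(z⁻¹ • star (res U ζ)) := by
    have : (U - z • 1) * (U * res U z) = U := by
      rw [← mul_assoc, sub_mul, smul_mul_assoc, one_mul]
      have h5 : U * U - z • U = U * (U - z • 1) := by rw [mul_sub, mul_smul_comm, mul_one]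
      rw [h5, mul_assoc, mul_res hU hz, mul_one]
    rw [mul_assoc, neg_mul, smul_mul_assoc, mul_assoc, this, (Unitary.mem_iff.mp hU).1, mul_neg,
      mul_smul_comm, mul_one]
  rw [← h4, ← h2, h1, one_mul]

/-- Outside the disc z⁻¹U is a strict contraction, which puts the resolvent in the form treated by
`lintegral_inner_inverse_le`. -/
theorem smul_res_eq {U : H →L[ℂ] H} (hU : U ∈ unitary (H →L[ℂ] H)) {z : ℂ} (hz : 1 < ‖z‖) :
    z • res U z = -Ring.inverse (1 - z⁻¹ • U) := by
  have hz0 : z ≠ 0 := by rintro rfl; simp at hz; linarith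
  have h1 : 1 - z⁻¹ • U = -(z⁻¹ • (U - z • 1)) := by
    rw [smul_sub, smul_smul, inv_mul_cancel₀ hz0, one_smul]; abel
  have h2 : IsUnit (1 - z⁻¹ • U) := by
    rw [h1]
    exact (((isUnit_sub_smul hU hz.ne').smul (Units.mk0 z⁻¹ (inv_ne_zero hz0)))).neg
  have h3 : (1 - z⁻¹ • U) * -(z • res U z) = 1 := by
    rw [h1, neg_mul_neg, smul_mul_smul_comm, mul_res hU hz.ne', inv_mul_cancel₀ hz0, one_smul]
  calc z • res U z
      = -(Ring.inverse (1 - z⁻¹ • U) * (1 - z⁻¹ • U) * -(z • res U z)) := by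
        rw [Ring.inverse_mul_cancel _ h2, one_mul, neg_neg]
    _ = _ := by rw [mul_assoc, h3, mul_one]

end Resolvent

/-! ### Averaged fractional moments of a diagonal block -/

section FractionalMoment

variable {H : Type*} [NormedAddCommGroup H] [InnerProductSpace ℂ H] [CompleteSpace H] {L : ℕ}

local notation "𝔼" => EuclideanSpace ℂ (Fin L)

/-- The vectors `e_i + I ^ k e_j` used to recover a matrix from its quadratic form. -/
noncomputable def polVec (t : Fin L × Fin L × Fin 4) : EuclideanSpace ℂ (Fin L) :=
  EuclideanSpace.single t.1 1 + Complex.I ^ (t.2.2 : ℕ) • EuclideanSpace.single t.2.1 1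

theorem norm_polVec_le (t : Fin L × Fin L × Fin 4) : ‖polVec t‖ ≤ 2 := by
  refine (norm_add_le _ _).trans ?_
  rw [norm_smul]
  simp; norm_num

/-- The Herglotz estimate only sees quadratic forms ⟨v, Mv⟩; complex polarization recovers the
matrix entries, hence the norm. -/
theorem enorm_le_sum_polVec (M : 𝔼 →L[ℂ] 𝔼) :
    ‖M‖ₑ ≤ ∑ t : Fin L × Fin L × Fin 4, ‖⟪polVec t, M (polVec t)⟫_ℂ‖ₑ := by
  have hkey : ‖M‖ ≤ ∑ t : Fin L × Fin L × Fin 4, ‖⟪polVec t, M (polVec t)⟫_ℂ‖ := by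
    set e : Fin L → 𝔼 := fun i => EuclideanSpace.single i 1 with he
    have hpol : ∀ i j, ‖⟪e i, M (e j)⟫_ℂ‖ ≤
        ∑ k : Fin 4, ‖⟪polVec (i, j, k), M (polVec (i, j, k))⟫_ℂ‖ := fun i j => by
      have h4 : 4 * ⟪e i, M (e j)⟫_ℂ =
          ∑ k : Fin 4, (-Complex.I) ^ (k : ℕ) * ⟪polVec (i, j, k), M (polVec (i, j, k))⟫_ℂ := by
        simp only [polVec, Fin.sum_univ_four]
        simp [inner_add_left, inner_smul_left, inner_smul_right, pow_succ]
        ring_nf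
        simp
        ring
      have h5 : ‖(4 : ℂ) * ⟪e i, M (e j)⟫_ℂ‖ ≤
          ∑ k : Fin 4, ‖⟪polVec (i, j, k), M (polVec (i, j, k))⟫_ℂ‖ := by
        rw [h4]
        refine (norm_sum_le _ _).trans (Finset.sum_le_sum fun k _ => ?_)
        simp
      rw [norm_mul] at h5
      simp only [Complex.norm_ofNat] at h5
      linarith [norm_nonneg ⟪e i, M (e j)⟫_ℂ]
    have hcoord : ∀ x : 𝔼, ‖x‖ ≤ ∑ i, ‖⟪e i, x⟫_ℂ‖ := fun x => by
      conv_lhs => rw [← (EuclideanSpace.basisFun (Fin L) ℂ).sum_repr' x]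
      refine (norm_sum_le _ _).trans (Finset.sum_le_sum fun i _ => ?_)
      rw [norm_smul]
      simp [he]
    refine ContinuousLinearMap.opNorm_le_bound _ (Finset.sum_nonneg fun _ _ => norm_nonneg _)
      fun x => ?_
    have hx : M x = ∑ j, ⟪e j, x⟫_ℂ • M (e j) := by
      conv_lhs => rw [← (EuclideanSpace.basisFun (Fin L) ℂ).sum_repr' x]
      simp [he, map_sum]
    rw [hx, Finset.sum_mul]
    have hej : ∀ j, ‖⟪e j, x⟫_ℂ‖ ≤ ‖x‖ := fun j =>
      (norm_inner_le_norm _ _).trans (by simp [he])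
    calc _ ≤ ∑ j, ‖⟪e j, x⟫_ℂ • M (e j)‖ := norm_sum_le _ _
      _ ≤ ∑ j, ∑ i, ∑ k : Fin 4, ‖⟪polVec (i, j, k), M (polVec (i, j, k))⟫_ℂ‖ * ‖x‖ := by
        refine Finset.sum_le_sum fun j _ => ?_
        rw [norm_smul, mul_comm]
        simp_rw [← Finset.sum_mul]
        exact mul_le_mul ((hcoord _).trans (Finset.sum_le_sum fun i _ => hpol i j)) (hej j)
          (norm_nonneg _) (by positivity)
      _ = _ := by
        rw [Finset.sum_comm, Fintype.sum_prod_type]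
        refine Finset.sum_congr rfl fun i _ => ?_
        rw [Fintype.sum_prod_type]
  rw [← ofReal_norm]
  refine (ENNReal.ofReal_le_ofReal hkey).trans ?_
  rw [ENNReal.ofReal_sum_of_nonneg fun _ _ => norm_nonneg _]
  simp

/-- The bound for the averaged fractional moments of a diagonal block of the resolvent. -/
noncomputable def fracConst (L : ℕ) (s : ℝ) : ℝ≥0∞ :=
  ∑ _t : Fin L × Fin L × Fin 4,
    ENNReal.ofReal (2 * Real.pi * (((Real.cos (Real.pi * s / 2))⁻¹ + 1) * (2 ^ 2) ^ s))
    + ENNReal.ofReal (2 * Real.pi)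

theorem fracConst_ne_top (L : ℕ) (s : ℝ) : fracConst L s ≠ ∞ := by
  unfold fracConst
  refine ENNReal.add_ne_top.mpr ⟨?_, ENNReal.ofReal_ne_top⟩
  exact (ENNReal.sum_lt_top.mpr fun _ _ => ENNReal.ofReal_lt_top).ne

theorem ennreal_sum_rpow_le {α : Type*} (t : Finset α) (f : α → ℝ≥0∞) {s : ℝ} (hs0 : 0 < s)
    (hs1 : s ≤ 1) : (∑ i ∈ t, f i) ^ s ≤ ∑ i ∈ t, f i ^ s := by
  classical
  induction t using Finset.induction_on with
  | empty => simp [hs0]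
  | insert a t ha ih =>
    rw [Finset.sum_insert ha, Finset.sum_insert ha]
    exact (ENNReal.rpow_add_le_add_rpow _ _ hs0.le hs1).trans (by gcongr)

/-- The resolvent is rewritten through (1 - R(w)K)⁻¹ with K = z⁻¹U for |z| > 1 and K = z̄U for |z| <
1. Polarization and subadditivity of t ↦ t^s then reduce the claim to finitely many quadratic forms.
-/
theorem lintegral_res_rot_le {ι : 𝔼 →L[ℂ] H} (hι : ι† ∘L ι = 1) {U : H →L[ℂ] H}
    (hU : U ∈ unitary (H →L[ℂ] H)) {z : ℂ} (hz : ‖z‖ ≠ 1) {s : ℝ} (hs0 : 0 < s) (hs1 : s < 1) :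
    ∫⁻ η in Set.Ioc 0 (2 * Real.pi),
      ‖z • (ι† ∘L res (rot ι (circleMap 0 1 η) * U) z ∘L ι)‖ₑ ^ s ≤ fracConst L s := by
  have hw1 : ∀ η : ℝ, ‖circleMap 0 1 η‖ = 1 := fun η => by simp
  have hcos : 0 < Real.cos (Real.pi * s / 2) :=
    Real.cos_pos_of_mem_Ioo ⟨by nlinarith [Real.pi_pos], by nlinarith [Real.pi_pos]⟩
  have hUn : ‖U‖ ≤ 1 := ContinuousLinearMap.opNorm_le_bound _ zero_le_one fun x => by
    rw [norm_apply_of_mem_unitary hU, one_mul]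
  -- reduction to a strict contraction
  obtain ⟨K, hK, hKle⟩ : ∃ K : H →L[ℂ] H, ‖K‖ < 1 ∧ ∀ η : ℝ,
      ‖z • (ι† ∘L res (rot ι (circleMap 0 1 η) * U) z ∘L ι)‖ₑ ≤
      ‖ι† ∘L Ring.inverse (1 - rot ι (circleMap 0 1 η) * K) ∘L ι‖ₑ + 1 := by
    have hV : ∀ η : ℝ, rot ι (circleMap 0 1 η) * U ∈ unitary (H →L[ℂ] H) := fun η =>
      mul_mem (rot_mem_unitary hι (hw1 η)) hU
    rcases lt_or_gt_of_ne hz with h | h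
    · rcases eq_or_ne z 0 with rfl | hz0
      · exact ⟨0, by simp, fun η => by 
          rw [zero_smul, ← ofReal_norm, norm_zero, ENNReal.ofReal_zero]; exact zero_le⟩
      refine ⟨star z • U, ?_, fun η => ?_⟩
      · rw [norm_smul, norm_star]
        exact (mul_le_of_le_one_right (norm_nonneg _) hUn).trans_lt h
      -- Inside the disc the spectral parameter is reflected to ζ = 1/z̄. The identity in
      -- `one_add_smul_res` compresses to ι†ι = 1, which accounts for the additional summand 1.
      · have hζ : 1 < ‖(star z)⁻¹‖ := by
          rw [norm_inv, norm_star]; exact (one_lt_inv₀ (norm_pos_iff.mpr hz0)).mpr h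
        have h1 := one_add_smul_res (hV η) hz hz0
        rw [smul_res_eq (hV η) hζ, inv_inv, star_neg, neg_neg] at h1
        set F := Ring.inverse (1 - star z • (rot ι (circleMap 0 1 η) * U)) with hF
        have h2 : z • (ι† ∘L res (rot ι (circleMap 0 1 η) * U) z ∘L ι) = (ι† ∘L F ∘L ι)† - 1 := by
          have h3 : z • res (rot ι (circleMap 0 1 η) * U) z = star F - 1 := by rw [← h1]; abel
          calc _ = ι† ∘L (z • res (rot ι (circleMap 0 1 η) * U) z) ∘L ι := by
                ext x; simp
            _ = ι† ∘L F† ∘L ι - ι† ∘L ι := by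
                rw [h3, ContinuousLinearMap.star_eq_adjoint]; ext x; simp
            _ = _ := by
                rw [hι, ContinuousLinearMap.adjoint_comp, ContinuousLinearMap.adjoint_comp,
                  ContinuousLinearMap.adjoint_adjoint]
                rfl
        rw [h2, mul_smul_comm, ← hF]
        have hone : ‖(1 : 𝔼 →L[ℂ] 𝔼)‖ₑ ≤ 1 := by
          rw [← ofReal_norm, ENNReal.ofReal_le_one]
          exact ContinuousLinearMap.norm_id_le
        refine enorm_sub_le.trans (add_le_add (le_of_eq ?_) hone)
        rw [← ofReal_norm, ← ofReal_norm, LinearIsometryEquiv.norm_map]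
    · refine ⟨z⁻¹ • U, ?_, fun η => ?_⟩
      · rw [norm_smul, norm_inv]
        refine (mul_le_of_le_one_right (by positivity) hUn).trans_lt (inv_lt_one_of_one_lt₀ h)
      · have h1 := smul_res_eq (hV η) h
        have h2 : z • (ι† ∘L res (rot ι (circleMap 0 1 η) * U) z ∘L ι) =
            -(ι† ∘L Ring.inverse (1 - rot ι (circleMap 0 1 η) * z⁻¹ • U) ∘L ι) := by
          rw [mul_smul_comm]
          calc _ = ι† ∘L (z • res (rot ι (circleMap 0 1 η) * U) z) ∘L ι := by
                ext x; simp
            _ = _ := by rw [h1]; ext x; simp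
        rw [h2, enorm_neg]
        exact le_self_add
  have hcont : ∀ a : 𝔼, Continuous fun η : ℝ =>
      ⟪ι a, Ring.inverse (1 - rot ι (circleMap 0 1 η) * K) (ι a)⟫_ℂ := fun a => by
    refine continuous_const.inner (Continuous.clm_apply ?_ continuous_const)
    refine continuous_iff_continuousAt.mpr fun η => ?_
    have h1 : Continuous fun η : ℝ => 1 - rot ι (circleMap 0 1 η) * K := by
      unfold rot; fun_prop
    exact ContinuousAt.comp (f := fun η : ℝ => 1 - rot ι (circleMap 0 1 η) * K)
      (differentiableAt_inverse (𝕜 := ℂ)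
        (isUnit_one_sub_rot_mul hι hK (hw1 η).le)).continuousAt h1.continuousAt
  have hpt : ∀ η : ℝ, ‖z • (ι† ∘L res (rot ι (circleMap 0 1 η) * U) z ∘L ι)‖ₑ ^ s ≤
      ∑ t : Fin L × Fin L × Fin 4, ‖⟪ι (polVec t),
        Ring.inverse (1 - rot ι (circleMap 0 1 η) * K) (ι (polVec t))⟫_ℂ‖ₑ ^ s + 1 := fun η => by
    calc _ ≤ (‖ι† ∘L Ring.inverse (1 - rot ι (circleMap 0 1 η) * K) ∘L ι‖ₑ + 1) ^ s :=
          ENNReal.rpow_le_rpow (hKle η) hs0.le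
      _ ≤ ‖ι† ∘L Ring.inverse (1 - rot ι (circleMap 0 1 η) * K) ∘L ι‖ₑ ^ s + 1 ^ s :=
          ENNReal.rpow_add_le_add_rpow _ _ hs0.le hs1.le
      _ ≤ _ := by
          rw [ENNReal.one_rpow]
          gcongr
          refine (ENNReal.rpow_le_rpow (enorm_le_sum_polVec _) hs0.le).trans ?_
          refine (ennreal_sum_rpow_le _ _ hs0 hs1.le).trans (le_of_eq ?_)
          refine Finset.sum_congr rfl fun t _ => ?_
          simp [ContinuousLinearMap.adjoint_inner_right]
  refine (lintegral_mono hpt).trans ?_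
  rw [lintegral_add_right _ measurable_const, lintegral_finsetSum _ fun t _ =>
    ((hcont _).measurable.enorm.pow_const _), setLIntegral_const, Real.volume_Ioc, sub_zero, one_mul]
  unfold fracConst
  gcongr with t
  refine (lintegral_inner_inverse_le hι hK hs0 hs1 (polVec t)).trans ?_
  gcongr
  exact norm_polVec_le t

end FractionalMoment

/-! ### Flux estimate: all blocks on a bond from one diagonal block -/

section Pair

variable {H E F : Type*} [NormedAddCommGroup H] [InnerProductSpace ℂ H] [CompleteSpace H]
  [NormedAddCommGroup E] [InnerProductSpace ℂ E] [CompleteSpace E]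
  [NormedAddCommGroup F] [InnerProductSpace ℂ F]

/-- Two isometries with orthogonal ranges. -/
structure IsPair (ι κ : E →L[ℂ] H) : Prop where
  left : ι† ∘L ι = 1
  right : κ† ∘L κ = 1
  orth : ι† ∘L κ = 0

namespace IsPair

variable {ι κ : E →L[ℂ] H}

theorem symm (h : IsPair ι κ) : IsPair κ ι :=
  ⟨h.right, h.left, by
    have := congrArg (fun A : E →L[ℂ] E => A†) h.orth
    simpa [ContinuousLinearMap.adjoint_comp] using this⟩

theorem left_left (h : IsPair ι κ) (a : E) : (ι†) (ι a) = a := adjoint_apply_self h.left a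

theorem left_right (h : IsPair ι κ) (a : E) : (ι†) (κ a) = 0 := by
  simpa using DFunLike.congr_fun h.orth a

theorem norm_adjoint_le (h : IsPair ι κ) (x : H) : ‖(ι†) x‖ ≤ ‖x‖ := by
  have h1 := norm_rot_sq h.left 1 x
  have h3 : rot ι 1 x = x := by simp [rot_apply]
  rw [h3, norm_one] at h1
  refine le_of_sq_le_sq ?_ (norm_nonneg _)
  nlinarith [sq_nonneg ‖x - ι ((ι†) x)‖]

end IsPair

/-- `D` differs from the identity only on the sum of the ranges of `ι` and `κ`. -/
structure IsLocal (ι κ : E →L[ℂ] H) (D : H →L[ℂ] H) : Prop where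
  range : ∀ x, D x - x = ι ((ι†) (D x - x)) + κ ((κ†) (D x - x))
  ker : ∀ x, (ι†) x = 0 → (κ†) x = 0 → D x = x

namespace IsLocal

variable {ι κ : E →L[ℂ] H} {D : H →L[ℂ] H}

theorem symm (h : IsLocal ι κ D) : IsLocal κ ι D :=
  ⟨fun x => by rw [add_comm]; exact h.range x, fun x h1 h2 => h.ker x h2 h1⟩

theorem inv (h : IsLocal ι κ D) (hD : D ∈ unitary (H →L[ℂ] H)) : IsLocal ι κ (star D) := by
  have h1 : ∀ x, star D (D x) = x := fun x => by
    simpa using DFunLike.congr_fun (Unitary.mem_iff.mp hD).1 x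
  have h2 : ∀ x, D (star D x) = x := fun x => by
    simpa using DFunLike.congr_fun (Unitary.mem_iff.mp hD).2 x
  refine ⟨fun x => ?_, fun x hx hx' => ?_⟩
  · have h3 := h.range (star D x)
    rw [h2] at h3
    rw [← neg_sub x, map_neg, map_neg, map_neg, map_neg, ← neg_add, ← h3]
  · conv_lhs => rw [← h.ker x hx hx', h1]

theorem adjoint_apply (h : IsLocal ι κ D) (hp : IsPair ι κ) (x : H) :
    (ι†) (D x) = (ι†) (D (ι ((ι†) x))) + (ι†) (D (κ ((κ†) x))) := by
  have h1 := h.ker (x - ι ((ι†) x) - κ ((κ†) x))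
    (by rw [map_sub, map_sub, hp.left_left, hp.left_right]; simp)
    (by rw [map_sub, map_sub, hp.symm.left_left, hp.symm.left_right]; simp)
  have h2 := congrArg (ι†) h1
  simp only [map_sub, hp.left_left, hp.left_right, sub_self] at h2
  rw [sub_sub, sub_eq_zero] at h2
  exact h2

theorem norm_block_le (hp : IsPair ι κ) (hD : D ∈ unitary (H →L[ℂ] H)) (a : E) :
    ‖(ι†) (D (κ a))‖ ≤ ‖a‖ := by
  refine (hp.norm_adjoint_le _).trans ?_
  rw [norm_apply_of_mem_unitary hD, norm_isometry_apply hp.right]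

theorem norm_block_self_le (hp : IsPair ι κ) (hD : D ∈ unitary (H →L[ℂ] H)) (a : E) :
    ‖(ι†) (D (ι a))‖ ≤ ‖a‖ := by
  refine (hp.norm_adjoint_le _).trans ?_
  rw [norm_apply_of_mem_unitary hD, norm_isometry_apply hp.left]

theorem sub_self_apply (h : IsLocal ι κ D) (hp : IsPair ι κ) {x : H} (hx : (κ†) x = 0) :
    D x - x = D (ι ((ι†) x)) - ι ((ι†) x) := by
  have h1 := h.ker (x - ι ((ι†) x)) (by rw [map_sub, hp.left_left, sub_self])
    (by rw [map_sub, hx, hp.symm.left_right, sub_self])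
  rw [map_sub] at h1
  rw [sub_eq_sub_iff_sub_eq_sub]
  exact h1

end IsLocal

/-- `q` is the energy of the part of a vector on the side of the site `ι`, the site itself
excluded; `T` does not transport energy across the pair. -/
structure IsSideEnergy (ι κ : E →L[ℂ] H) (T : H →L[ℂ] H) (q : H → ℝ) : Prop where
  nonneg : ∀ v, 0 ≤ q v
  add_left : ∀ v a, q (v + ι a) = q v
  add_right : ∀ v a, q (v + κ a) = q v
  smul : ∀ (c : ℂ) v, q (c • v) = ‖c‖ ^ 2 * q v
  energy : ∀ v, q (T v) + ‖(ι†) (T v)‖ ^ 2 = q v + ‖(ι†) v‖ ^ 2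

variable {ι κ : E →L[ℂ] H} {D T : H →L[ℂ] H} {q q' : H → ℝ}

/-- D changes a vector only on the pair, which q does not see, so q(Tψ) = q(DTψ) = |z|² q(ψ).
Subtracting the energy balance of T on this side leaves the flux through its end site. -/
theorem IsSideEnergy.flux (hq : IsSideEnergy ι κ T q) (hD : IsLocal ι κ D) {z : ℂ}
    {ψ : H} {a b : E} (hψ : D (T ψ) = z • ψ + ι a + κ b) :
    (‖z‖ ^ 2 - 1) * q ψ = ‖(ι†) ψ‖ ^ 2 - ‖(ι†) (T ψ)‖ ^ 2 := by
  have h1 : q (D (T ψ)) = q (T ψ) := by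
    have h2 : D (T ψ) = T ψ + ι ((ι†) (D (T ψ) - T ψ)) + κ ((κ†) (D (T ψ) - T ψ)) := by
      rw [add_assoc, ← hD.range]; abel
    rw [h2, hq.add_right, hq.add_left]
  rw [hψ, hq.add_right, hq.add_left, hq.smul] at h1
  have h3 := hq.energy ψ
  rw [← h1] at h3
  linarith

/-- The amplitude on one site of the pair is controlled by the amplitude on the other one. -/
theorem norm_left_le (hp : IsPair ι κ) (hD : IsLocal ι κ D) (hDu : D ∈ unitary (H →L[ℂ] H))
    (hq : IsSideEnergy ι κ T q) (hq' : IsSideEnergy κ ι T q') {c : ℝ} (hc0 : 0 ≤ c) (hc1 : c < 1)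
    (hc : ‖ι† ∘L D ∘L ι‖ ≤ c) {z : ℂ} (hz : ‖z‖ ≠ 1)
    {ψ : H} {a b : E} (hψ : D (T ψ) = z • ψ + ι a + κ b) :
    ‖z • (ι†) ψ‖ ≤ (1 - c)⁻¹ * (‖z • (κ†) ψ‖ + (‖a‖ + ‖b‖)) := by
  have h1 := hq.flux hD hψ
  have h2 := hq'.flux hD.symm (a := b) (b := a) (by rw [hψ]; abel)
  have hb : ∀ x, ‖(ι†) (D (ι x))‖ ≤ c * ‖x‖ := fun x =>
    ((ι† ∘L D ∘L ι).le_opNorm x).trans (by gcongr)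
  have hc' : 0 < 1 - c := by linarith
  rw [inv_mul_eq_div, le_div_iff₀ hc']
  have hzn := norm_nonneg z
  rcases lt_or_gt_of_ne hz with h | h
  -- For |z| < 1 the flux gives ‖ι†ψ‖ ≤ ‖ι†Tψ‖. Reading the equation as Tψ = D*(zψ + ιa + κb), the
  -- ι-block of D* contracts by c and the term c‖zι†ψ‖ is absorbed on the left.
  · have hz2 : ‖z‖ ^ 2 - 1 ≤ 0 := by nlinarith
    have hl : ‖(ι†) ψ‖ ≤ ‖(ι†) (T ψ)‖ := le_of_sq_le_sq (by
      nlinarith [mul_nonneg_of_nonpos_of_nonpos hz2 (neg_nonpos.mpr (hq.nonneg ψ))])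
      (norm_nonneg _)
    have hstar : T ψ = star D (z • ψ + ι a + κ b) := by
      rw [← hψ]
      simpa using (DFunLike.congr_fun (Unitary.mem_iff.mp hDu).1 (T ψ)).symm
    have hbs : ∀ x, ‖(ι†) (star D (ι x))‖ ≤ c * ‖x‖ := fun x => by
      have h3 : ‖ι† ∘L star D ∘L ι‖ ≤ c := by
        have h4 : ι† ∘L star D ∘L ι = (ι† ∘L D ∘L ι)† := by
          rw [ContinuousLinearMap.adjoint_comp, ContinuousLinearMap.adjoint_comp,
            ContinuousLinearMap.adjoint_adjoint, ContinuousLinearMap.star_eq_adjoint]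
          rfl
        rw [h4, LinearIsometryEquiv.norm_map]
        exact hc
      exact ((ι† ∘L star D ∘L ι).le_opNorm x).trans (by gcongr)
    have h5 := (hD.inv hDu).adjoint_apply hp (z • ψ + ι a + κ b)
    rw [← hstar] at h5
    simp only [map_add, hp.left_left, hp.left_right, hp.symm.left_left, hp.symm.left_right,
      map_smul, add_zero] at h5
    have h6 : ‖(ι†) (T ψ)‖ ≤ c * (‖z • (ι†) ψ‖ + ‖a‖) + (‖z • (κ†) ψ‖ + ‖b‖) := by
      have h7 := hbs (z • (ι†) ψ + a)
      have h8 := IsLocal.norm_block_le hp (Unitary.star_mem hDu) (z • (κ†) ψ + b)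
      simp only [map_add, map_smul] at h7 h8
      rw [h5]
      refine (norm_add_le _ _).trans (add_le_add (h7.trans ?_) (h8.trans (norm_add_le _ _)))
      gcongr
      exact norm_add_le _ _
    have h9 : ‖z • (ι†) ψ‖ ≤ ‖(ι†) (T ψ)‖ := by
      rw [norm_smul]
      exact (mul_le_of_le_one_left (norm_nonneg _) h.le).trans hl
    nlinarith [norm_nonneg a, norm_nonneg (z • (ι†) ψ)]
  -- For |z| > 1 the flux has the opposite sign: Tψ is at most zψ in norm at both sites, and the
  -- equation is used as zψ = DTψ - ιa - κb. This is the only place where the energy of the second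
  -- side is needed.
  · have hz2 : 0 ≤ ‖z‖ ^ 2 - 1 := by nlinarith
    have key : ∀ x y : E, ‖x‖ ^ 2 - ‖y‖ ^ 2 ≥ 0 → ‖y‖ ≤ ‖z • x‖ := fun x y hxy => by
      have : ‖y‖ ≤ ‖x‖ := le_of_sq_le_sq (by linarith) (norm_nonneg _)
      rw [norm_smul]
      exact this.trans (le_mul_of_one_le_left (norm_nonneg _) h.le)
    have hl := key _ _ (h1 ▸ mul_nonneg hz2 (hq.nonneg ψ))
    have hr := key _ _ (h2 ▸ mul_nonneg hz2 (hq'.nonneg ψ))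
    have h5 := hD.adjoint_apply hp (T ψ)
    rw [hψ] at h5
    simp only [map_add, hp.left_left, hp.left_right, map_smul, add_zero] at h5
    have h6 : z • (ι†) ψ = (ι†) (D (ι ((ι†) (T ψ)))) + (ι†) (D (κ ((κ†) (T ψ)))) - a := by
      rw [← h5]; abel
    have h7 : ‖z • (ι†) ψ‖ ≤ c * ‖(ι†) (T ψ)‖ + ‖(κ†) (T ψ)‖ + ‖a‖ := by
      conv_lhs => rw [h6]
      exact (norm_sub_le _ _).trans (add_le_add ((norm_add_le _ _).trans
        (add_le_add (hb _) (IsLocal.norm_block_le hp hDu _))) le_rfl)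
    nlinarith [norm_nonneg b, norm_nonneg (z • (ι†) ψ)]

/-- The block `z (U - z)⁻¹` between two sites. -/
noncomputable def zblock (U : H →L[ℂ] H) (z : ℂ) (ι κ : E →L[ℂ] H) : E →L[ℂ] E :=
  z • (ι† ∘L res U z ∘L κ)

theorem zblock_apply (U : H →L[ℂ] H) (z : ℂ) (ι κ : E →L[ℂ] H) (a : E) :
    zblock U z ι κ a = z • (ι†) (res U z (κ a)) := by simp [zblock]

/-- The sum of the norms of the four blocks of `z (U - z)⁻¹` on a pair of sites. -/
noncomputable def pairSum (U : H →L[ℂ] H) (z : ℂ) (ι κ : E →L[ℂ] H) : ℝ :=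
  ‖zblock U z ι ι‖ + ‖zblock U z ι κ‖ + ‖zblock U z κ ι‖ + ‖zblock U z κ κ‖

theorem pairSum_comm (U : H →L[ℂ] H) (z : ℂ) (ι κ : E →L[ℂ] H) :
    pairSum U z ι κ = pairSum U z κ ι := by unfold pairSum; ring

theorem pairSum_nonneg (U : H →L[ℂ] H) (z : ℂ) (ι κ : E →L[ℂ] H) : 0 ≤ pairSum U z ι κ := by
  unfold pairSum; positivity

theorem norm_zblock_left_le (hp : IsPair ι κ) (hD : IsLocal ι κ D)
    (hDu : D ∈ unitary (H →L[ℂ] H)) (hTu : T ∈ unitary (H →L[ℂ] H))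
    (hq : IsSideEnergy ι κ T q) (hq' : IsSideEnergy κ ι T q') {c : ℝ} (hc0 : 0 ≤ c) (hc1 : c < 1)
    (hc : ‖ι† ∘L D ∘L ι‖ ≤ c) {z : ℂ} (hz : ‖z‖ ≠ 1) :
    ‖zblock (D * T) z ι ι‖ ≤ (1 - c)⁻¹ * (‖zblock (D * T) z κ ι‖ + 1) ∧
    ‖zblock (D * T) z ι κ‖ ≤ (1 - c)⁻¹ * (‖zblock (D * T) z κ κ‖ + 1) := by
  have hU : D * T ∈ unitary (H →L[ℂ] H) := mul_mem hDu hTu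
  have hc' : 0 < 1 - c := by linarith
  constructor
  · refine ContinuousLinearMap.opNorm_le_bound _ (by positivity) fun a => ?_
    have h1 := map_res_apply hU hz (ι a)
    have h2 := norm_left_le hp hD hDu hq hq' hc0 hc1 hc hz (ψ := res (D * T) z (ι a)) (a := a)
      (b := 0) (by simpa using h1)
    rw [zblock_apply, mul_assoc, add_mul]
    refine h2.trans ?_
    gcongr
    · rw [← zblock_apply]; exact ContinuousLinearMap.le_opNorm _ _
    · simp
  · refine ContinuousLinearMap.opNorm_le_bound _ (by positivity) fun a => ?_
    have h1 := map_res_apply hU hz (κ a)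
    have h2 := norm_left_le hp hD hDu hq hq' hc0 hc1 hc hz (ψ := res (D * T) z (κ a)) (a := 0)
      (b := a) (by simpa using h1)
    rw [zblock_apply, mul_assoc, add_mul]
    refine h2.trans ?_
    gcongr
    · rw [← zblock_apply]; exact ContinuousLinearMap.le_opNorm _ _
    · simp

/-- Reflection at the circle exchanges the roles of row and column. It gives access to the block (κ,
ι), which the comparison of the two rows in `norm_zblock_left_le` leaves free. -/
theorem zblock_reflect {U : H →L[ℂ] H} (hU : U ∈ unitary (H →L[ℂ] H)) {z : ℂ} (hz : ‖z‖ ≠ 1)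
    (hz0 : z ≠ 0) (ι κ : E →L[ℂ] H) :
    ι† ∘L κ + zblock U z ι κ = -(zblock U (star z)⁻¹ κ ι)† := by
  have h := one_add_smul_res hU hz hz0
  calc ι† ∘L κ + zblock U z ι κ = ι† ∘L (1 + z • res U z) ∘L κ := by
        ext x; simp [zblock]
    _ = -(zblock U (star z)⁻¹ κ ι)† := by
        rw [h, ContinuousLinearMap.star_eq_adjoint]
        have h2 : zblock U (star z)⁻¹ κ ι = κ† ∘L ((star z)⁻¹ • res U (star z)⁻¹) ∘L ι := by
          ext x; simp [zblock]
        rw [h2, ContinuousLinearMap.adjoint_comp, ContinuousLinearMap.adjoint_comp,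
          ContinuousLinearMap.adjoint_adjoint]
        ext x; simp

/-- All blocks of the resolvent on the pair are controlled by one diagonal block. -/
theorem pairSum_mul_le (hp : IsPair ι κ) (hD : IsLocal ι κ D)
    (hDu : D ∈ unitary (H →L[ℂ] H)) (hTu : T ∈ unitary (H →L[ℂ] H))
    (hq : IsSideEnergy ι κ T q) (hq' : IsSideEnergy κ ι T q') {c : ℝ} (hc0 : 0 ≤ c) (hc1 : c < 1)
    (hc : ‖ι† ∘L D ∘L ι‖ ≤ c) {z : ℂ} (hz : ‖z‖ ≠ 1) :
    pairSum (D * T) z ι κ ≤ 10 * (1 - c)⁻¹ ^ 2 * (‖zblock (D * T) z κ κ‖ + 1) := by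
  have hU : D * T ∈ unitary (H →L[ℂ] H) := mul_mem hDu hTu
  rcases eq_or_ne z 0 with rfl | hz0
  · simp only [pairSum, zblock, zero_smul, norm_zero, add_zero, zero_add]; positivity
  obtain ⟨h1, h2⟩ := norm_zblock_left_le hp hD hDu hTu hq hq' hc0 hc1 hc hz
  have hζ1 : ‖(star z)⁻¹‖ ≠ 1 := by
    rw [norm_inv, norm_star]
    intro h; exact hz (inv_eq_one.mp h)
  -- The block (ι, κ) at the reflected parameter has the same norm as the block (κ, ι) at z, because
  -- ι†κ = 0.
  obtain ⟨-, h3⟩ := norm_zblock_left_le hp hD hDu hTu hq hq' hc0 hc1 hc hζ1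
  have h4 := congrArg norm (zblock_reflect hU hz hz0 κ ι)
  rw [hp.symm.orth, zero_add, norm_neg, LinearIsometryEquiv.norm_map] at h4
  have h5 := congrArg norm (zblock_reflect hU hz hz0 κ κ)
  rw [hp.right, norm_neg, LinearIsometryEquiv.norm_map] at h5
  have h6 : ‖zblock (D * T) (star z)⁻¹ κ κ‖ ≤ ‖zblock (D * T) z κ κ‖ + 1 := by
    rw [← h5, add_comm]
    exact (norm_add_le _ _).trans (add_le_add le_rfl ContinuousLinearMap.norm_id_le)
  rw [← h4] at h3
  set k := (1 - c)⁻¹ with hk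
  have hk1 : 1 ≤ k := (one_le_inv₀ (by linarith)).mpr (by linarith)
  set X := ‖zblock (D * T) z κ κ‖
  have hX : 0 ≤ X := norm_nonneg _
  -- Of the 2, one unit is the source term in the flux estimate and one comes from κ†κ = 1 when the
  -- diagonal block is reflected.
  have h7 : ‖zblock (D * T) z κ ι‖ ≤ k * (X + 2) := h3.trans
    (mul_le_mul_of_nonneg_left (by linarith) (by linarith))
  have h8 : ‖zblock (D * T) z ι ι‖ ≤ k * (k * (X + 2) + 1) := h1.trans
    (mul_le_mul_of_nonneg_left (by linarith) (by linarith))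
  unfold pairSum
  have hk2 : k ≤ k ^ 2 := by nlinarith
  have hk3 : k * X ≤ k ^ 2 * X := by gcongr
  have hk4 : X ≤ k ^ 2 * X := by nlinarith
  nlinarith

end Pair

/-! ### Exchanging DT with TD, and decoupling rows and columns -/

section Pair

variable {H E F : Type*} [NormedAddCommGroup H] [InnerProductSpace ℂ H] [CompleteSpace H]
  [NormedAddCommGroup E] [InnerProductSpace ℂ E] [CompleteSpace E]
  [NormedAddCommGroup F] [InnerProductSpace ℂ F]
  {ι κ : E →L[ℂ] H} {D T : H →L[ℂ] H}

theorem star_mul_apply (hDu : D ∈ unitary (H →L[ℂ] H)) (x : H) : star D (D x) = x := by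
  simpa using DFunLike.congr_fun (Unitary.mem_iff.mp hDu).1 x

theorem mul_star_apply (hDu : D ∈ unitary (H →L[ℂ] H)) (x : H) : D (star D x) = x := by
  simpa using DFunLike.congr_fun (Unitary.mem_iff.mp hDu).2 x

theorem res_conj (hDu : D ∈ unitary (H →L[ℂ] H)) (hTu : T ∈ unitary (H →L[ℂ] H)) {z : ℂ}
    (hz : ‖z‖ ≠ 1) : res (T * D) z = star D * res (D * T) z * D := by
  have hs := (Unitary.mem_iff.mp hDu).1
  refine (eq_res_of_mul (mul_mem hTu hDu) hz ?_).symm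
  have h1 : (T * D - z • 1) = star D * (D * T - z • 1) * D := by
    rw [mul_sub, sub_mul, ← mul_assoc, hs, one_mul, mul_smul_comm, mul_one, smul_mul_assoc, hs]
  calc _ = star D * (D * T - z • 1) * (D * star D) * res (D * T) z * D := by
        rw [h1]; simp only [mul_assoc]
    _ = 1 := by
        rw [(Unitary.mem_iff.mp hDu).2, mul_one, mul_assoc (star D), mul_res (mul_mem hDu hTu) hz,
          mul_one, hs]

theorem IsLocal.smul_adjoint_apply (hD : IsLocal ι κ D) (hp : IsPair ι κ) (z : ℂ) (x : H) :
    z • (ι†) (D x) = (ι†) (D (ι (z • (ι†) x))) + (ι†) (D (κ (z • (κ†) x))) := by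
  rw [hD.adjoint_apply hp x, smul_add]
  simp only [map_smul]

theorem IsLocal.apply_left (hD : IsLocal ι κ D) (hp : IsPair ι κ) (a : E) :
    D (ι a) = ι ((ι†) (D (ι a))) + κ ((κ†) (D (ι a))) := by
  have h := hD.range (ι a)
  simp only [map_sub, hp.left_left, hp.symm.left_right, sub_zero] at h
  rw [eq_comm, ← sub_eq_zero, ← sub_eq_zero.mpr h.symm]; abel

/-- TD = D*(DT)D, and both D and D* map the pair into itself with contractive blocks. Each block for
TD is therefore at most the sum of the four blocks for DT. -/
theorem norm_zblock_conj_le (hp : IsPair ι κ) (hD : IsLocal ι κ D)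
    (hDu : D ∈ unitary (H →L[ℂ] H)) (hTu : T ∈ unitary (H →L[ℂ] H)) {z : ℂ} (hz : ‖z‖ ≠ 1) :
    ‖zblock (T * D) z ι ι‖ ≤ pairSum (D * T) z ι κ ∧
    ‖zblock (T * D) z ι κ‖ ≤ pairSum (D * T) z ι κ := by
  have hDs := Unitary.star_mem hDu
  have key : ∀ (b b' a : E), ‖b‖ ≤ ‖a‖ → ‖b'‖ ≤ ‖a‖ →
      ‖z • (ι†) (star D (res (D * T) z (ι b + κ b')))‖ ≤ pairSum (D * T) z ι κ * ‖a‖ := by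
    intro b b' a hb hb'
    have h1 : ∀ (x y : E →L[ℂ] H) (c : E), ‖c‖ ≤ ‖a‖ →
        ‖z • (x†) (res (D * T) z (y c))‖ ≤ ‖zblock (D * T) z x y‖ * ‖a‖ := fun x y c hc => by
      rw [← zblock_apply]
      exact (ContinuousLinearMap.le_opNorm _ _).trans (by gcongr)
    rw [(hD.inv hDu).smul_adjoint_apply hp]
    refine (norm_add_le _ _).trans ((add_le_add (IsLocal.norm_block_self_le hp hDs _)
      (IsLocal.norm_block_le hp hDs _)).trans ?_)
    rw [map_add, map_add, map_add, smul_add, smul_add]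
    have := h1 ι ι b hb
    have := h1 ι κ b' hb'
    have := h1 κ ι b hb
    have := h1 κ κ b' hb'
    have := norm_add_le (z • (ι†) (res (D * T) z (ι b))) (z • (ι†) (res (D * T) z (κ b')))
    have := norm_add_le (z • (κ†) (res (D * T) z (ι b))) (z • (κ†) (res (D * T) z (κ b')))
    unfold pairSum
    linarith
  constructor
  · refine ContinuousLinearMap.opNorm_le_bound _ (pairSum_nonneg _ _ _ _) fun a => ?_
    rw [zblock_apply, res_conj hDu hTu hz, mul_apply_eq_comp, mul_apply_eq_comp,
      hD.apply_left hp]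
    exact key _ _ _ (IsLocal.norm_block_self_le hp hDu _) (IsLocal.norm_block_le hp.symm hDu _)
  · refine ContinuousLinearMap.opNorm_le_bound _ (pairSum_nonneg _ _ _ _) fun a => ?_
    rw [zblock_apply, res_conj hDu hTu hz, mul_apply_eq_comp, mul_apply_eq_comp,
      hD.symm.apply_left hp.symm, add_comm]
    exact key _ _ _ (IsLocal.norm_block_le hp hDu _) (IsLocal.norm_block_self_le hp.symm hDu _)

theorem pairSum_conj_le (hp : IsPair ι κ) (hD : IsLocal ι κ D)
    (hDu : D ∈ unitary (H →L[ℂ] H)) (hTu : T ∈ unitary (H →L[ℂ] H)) {z : ℂ} (hz : ‖z‖ ≠ 1) :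
    pairSum (T * D) z ι κ ≤ 4 * pairSum (D * T) z ι κ := by
  obtain ⟨h1, h2⟩ := norm_zblock_conj_le hp hD hDu hTu hz
  obtain ⟨h3, h4⟩ := norm_zblock_conj_le hp.symm hD.symm hDu hTu hz
  rw [pairSum_comm] at h3 h4
  rw [pairSum]
  linarith

theorem norm_zblock_add_le (U : H →L[ℂ] H) (z : ℂ) (ι κ : E →L[ℂ] H) {b b' : E} {t : ℝ}
    (hb : ‖b‖ ≤ 2 * t) (hb' : ‖b'‖ ≤ 2 * t) :
    ‖z • (ι†) (res U z (ι b + κ b'))‖ ≤ 2 * pairSum U z ι κ * t := by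
  have h1 : ∀ (y : E →L[ℂ] H) (c : E), ‖c‖ ≤ 2 * t →
      ‖z • (ι†) (res U z (y c))‖ ≤ ‖zblock U z ι y‖ * (2 * t) := fun y c hc => by
    rw [← zblock_apply]
    exact (ContinuousLinearMap.le_opNorm _ _).trans (by gcongr)
  have ht : 0 ≤ t := by linarith [norm_nonneg b]
  rw [map_add, map_add, smul_add]
  refine (norm_add_le _ _).trans ((add_le_add (h1 ι b hb) (h1 κ b' hb')).trans ?_)
  unfold pairSum
  nlinarith [mul_nonneg (norm_nonneg (zblock U z κ ι)) ht,
    mul_nonneg (norm_nonneg (zblock U z κ κ)) ht]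

theorem norm_sub_block_le (hp : IsPair ι κ) (hDu : D ∈ unitary (H →L[ℂ] H)) (b : E) :
    ‖(ι†) (D (ι b) - ι b)‖ ≤ 2 * ‖b‖ ∧ ‖(κ†) (D (ι b) - ι b)‖ ≤ 2 * ‖b‖ := by
  rw [map_sub, map_sub, hp.left_left, hp.symm.left_right, sub_zero]
  have h1 := IsLocal.norm_block_self_le hp hDu b
  have h2 := IsLocal.norm_block_le hp.symm hDu b
  exact ⟨(norm_sub_le _ _).trans (by linarith), by linarith [norm_nonneg b]⟩

/-- Decoupling at the end of a row. -/
theorem norm_row_mul_left_le (hp : IsPair ι κ) (hD : IsLocal ι κ D)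
    (hDu : D ∈ unitary (H →L[ℂ] H)) (hTu : T ∈ unitary (H →L[ℂ] H)) {z : ℂ} (hz : ‖z‖ ≠ 1)
    {h : H} (hι : (ι†) h = 0) (hκ : (κ†) h = 0) (hg : (κ†) (res T z h) = 0) :
    ‖(ι†) (res (D * T) z h)‖ ≤ (1 + 2 * pairSum (D * T) z ι κ) * ‖(ι†) (res T z h)‖ := by
  set y := res T z h with hy
  have hU := mul_mem hDu hTu
  have h1 : (D * T) y = z • D y + h := by
    rw [mul_apply_eq_comp, hy, map_res_apply hTu hz, map_add, map_smul, hD.ker h hι hκ]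
  have h2 := res_map_apply hU hz y
  rw [h1, map_add, map_smul] at h2
  -- The defect Dy - y is supported on the pair and has blocks of norm at most 2‖ι†y‖, since y
  -- vanishes at κ. Only the pair blocks of the full resolvent therefore enter.
  have h3 : res (D * T) z h = y - z • res (D * T) z (D y - y) := by
    rw [map_sub, smul_sub, ← sub_eq_zero, ← sub_eq_zero.mpr h2]; abel
  rw [h3, map_sub, map_smul, hD.sub_self_apply hp hg, hD.range]
  refine (norm_sub_le _ _).trans ?_
  obtain ⟨h4, h5⟩ := norm_sub_block_le hp hDu ((ι†) y)
  have := norm_zblock_add_le (D * T) z ι κ h4 h5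
  linarith

/-- For TD the natural trial vector is D*y rather than y, with y the solution for T; the source h
may then be arbitrary. -/
theorem norm_row_mul_right_le (hp : IsPair ι κ) (hD : IsLocal ι κ D)
    (hDu : D ∈ unitary (H →L[ℂ] H)) (hTu : T ∈ unitary (H →L[ℂ] H)) {z : ℂ} (hz : ‖z‖ ≠ 1)
    {h : H} (hg : (κ†) (res T z h) = 0) :
    ‖(ι†) (res (T * D) z h)‖ ≤ (1 + 2 * pairSum (T * D) z ι κ) * ‖(ι†) (res T z h)‖ := by
  set y := res T z h with hy
  have hU := mul_mem hTu hDu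
  have hDs := Unitary.star_mem hDu
  have h1 : (T * D) (star D y) = z • y + h := by
    rw [mul_apply_eq_comp, mul_star_apply hDu, hy, map_res_apply hTu hz]
  have h2 := res_map_apply hU hz (star D y)
  rw [h1, map_add, map_smul] at h2
  have h3 : res (T * D) z h = star D y + z • res (T * D) z (star D y - y) := by
    rw [map_sub, smul_sub, ← sub_eq_zero, ← sub_eq_zero.mpr h2]; abel
  rw [h3, map_add, map_smul, (hD.inv hDu).sub_self_apply hp hg, (hD.inv hDu).range]
  refine (norm_add_le _ _).trans ?_
  obtain ⟨h4, h5⟩ := norm_sub_block_le hp hDs ((ι†) y)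
  have h6 := norm_zblock_add_le (T * D) z ι κ h4 h5
  have h7 : ‖(ι†) (star D y)‖ ≤ ‖(ι†) y‖ := by
    rw [(hD.inv hDu).adjoint_apply hp, hg, map_zero, map_zero, map_zero, add_zero]
    exact IsLocal.norm_block_self_le hp hDs _
  linarith

theorem norm_smul_adjoint_sub_le (hp : IsPair ι κ) (hD : IsLocal ι κ D)
    (hDu : D ∈ unitary (H →L[ℂ] H)) (U : H →L[ℂ] H) (z : ℂ) (a : E) :
    ‖z • (ι†) (D (res U z (ι a)) - res U z (ι a))‖ ≤ 2 * pairSum U z ι κ * ‖a‖ := by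
  have h1 : ∀ x : E →L[ℂ] H, ‖z • (x†) (res U z (ι a))‖ ≤ ‖zblock U z x ι‖ * ‖a‖ := fun x => by
    rw [← zblock_apply]
    exact ContinuousLinearMap.le_opNorm _ _
  rw [map_sub, smul_sub, hD.smul_adjoint_apply hp]
  have h2 := IsLocal.norm_block_self_le hp hDu (z • (ι†) (res U z (ι a)))
  have h3 := IsLocal.norm_block_le hp hDu (z • (κ†) (res U z (ι a)))
  have h4 := h1 ι
  have h5 := h1 κ
  refine (norm_sub_le _ _).trans ((add_le_add (norm_add_le _ _) le_rfl).trans ?_)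
  unfold pairSum
  nlinarith [mul_nonneg (norm_nonneg (zblock U z ι κ)) (norm_nonneg a),
    mul_nonneg (norm_nonneg (zblock U z κ ι)) (norm_nonneg a),
    mul_nonneg (norm_nonneg (zblock U z κ κ)) (norm_nonneg a)]

/-- Decoupling at the end of a column. -/
theorem norm_col_mul_left_le (hp : IsPair ι κ) (hD : IsLocal ι κ D)
    (hDu : D ∈ unitary (H →L[ℂ] H)) (hTu : T ∈ unitary (H →L[ℂ] H)) {z : ℂ} (hz : ‖z‖ ≠ 1)
    {r : H →L[ℂ] F} (hg : ∀ b, r (res T z (κ b)) = 0) (a : E) :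
    ‖r (res (D * T) z (ι a))‖ ≤
      ‖r ∘L res T z ∘L ι‖ * ((1 + 2 * pairSum (D * T) z ι κ) * ‖a‖) := by
  set ψ := res (D * T) z (ι a) with hψ
  have hU := mul_mem hDu hTu
  have hDs := Unitary.star_mem hDu
  have h1 : T ψ = z • star D ψ + star D (ι a) := by
    rw [← map_smul, ← map_add, ← map_res_apply hU hz, mul_apply_eq_comp, star_mul_apply hDu]
  have h2 := res_map_apply hTu hz ψ
  have hr := (hD.inv hDu).range
  have h3 : ψ = z • res T z (star D ψ - ψ) + res T z (star D (ι a)) := by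
    rw [h1, map_add, map_smul] at h2
    rw [map_sub, smul_sub, ← sub_eq_zero, ← sub_eq_zero.mpr h2.symm]; abel
  -- Everything fed to the resolvent of T is supported on the pair. Its κ-part contributes nothing
  -- to r, because T does not connect the two sides; the ι-part factors through the decoupled block.
  have h5 : r ψ = (r ∘L res T z ∘L ι) (z • (ι†) (star D ψ - ψ) + (ι†) (star D (ι a))) := by
    conv_lhs => rw [h3, hr ψ, (hD.inv hDu).apply_left hp a]
    simp only [map_add, map_smul, hg, add_zero, ContinuousLinearMap.comp_apply]
  rw [h5]
  refine (ContinuousLinearMap.le_opNorm _ _).trans ?_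
  gcongr
  have h6 := norm_smul_adjoint_sub_le hp (hD.inv hDu) hDs (D * T) z a
  have h7 := IsLocal.norm_block_self_le hp hDs a
  refine (norm_add_le _ _).trans ?_
  linarith

/-- Here the resolvent of T produces Dψ instead of ψ. Since r vanishes on the pair, it does not
distinguish the two. -/
theorem norm_col_mul_right_le (hp : IsPair ι κ) (hD : IsLocal ι κ D)
    (hDu : D ∈ unitary (H →L[ℂ] H)) (hTu : T ∈ unitary (H →L[ℂ] H)) {z : ℂ} (hz : ‖z‖ ≠ 1)
    {r : H →L[ℂ] F} (hι : ∀ b, r (ι b) = 0) (hκ : ∀ b, r (κ b) = 0)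
    (hg : ∀ b, r (res T z (κ b)) = 0) (a : E) :
    ‖r (res (T * D) z (ι a))‖ ≤
      ‖r ∘L res T z ∘L ι‖ * ((1 + 2 * pairSum (T * D) z ι κ) * ‖a‖) := by
  set ψ := res (T * D) z (ι a) with hψ
  have hU := mul_mem hTu hDu
  have h1 : T (D ψ) = z • ψ + ι a := by
    rw [← map_res_apply hU hz, mul_apply_eq_comp]
  have h2 := res_map_apply hTu hz (D ψ)
  have h3 : D ψ = -(z • res T z (D ψ - ψ)) + res T z (ι a) := by
    rw [h1, map_add, map_smul] at h2
    rw [map_sub, smul_sub, ← sub_eq_zero, ← sub_eq_zero.mpr h2.symm]; abel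
  have h4 : r (D ψ) = r ψ := by
    have h6 := congrArg r (hD.range ψ)
    rw [map_add, hι, hκ, add_zero, map_sub, sub_eq_zero] at h6
    exact h6
  have h5 : r ψ = (r ∘L res T z ∘L ι) (-(z • (ι†) (D ψ - ψ)) + a) := by
    rw [← h4]
    conv_lhs => rw [h3, hD.range ψ]
    simp only [map_add, map_neg, map_smul, hg, add_zero, ContinuousLinearMap.comp_apply]
  rw [h5]
  refine (ContinuousLinearMap.le_opNorm _ _).trans ?_
  gcongr
  have h6 := norm_smul_adjoint_sub_le hp hD hDu (T * D) z a
  refine (norm_add_le _ _).trans ?_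
  rw [norm_neg]
  linarith

end Pair

/-! ### Averaged fractional moment of the decoupling factor -/

section Average

variable {H : Type*} [NormedAddCommGroup H] [InnerProductSpace ℂ H] [CompleteSpace H]

theorem IsLocal.mul {E : Type*} [NormedAddCommGroup E] [InnerProductSpace ℂ E] [CompleteSpace E]
    {ι κ : E →L[ℂ] H} {D D' : H →L[ℂ] H} (h : IsLocal ι κ D) (h' : IsLocal ι κ D') :
    IsLocal ι κ (D * D') := by
  refine ⟨fun x => ?_, fun x hx hx' => ?_⟩
  · have h1 : (D * D') x - x = (D (D' x) - D' x) + (D' x - x) := by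
      rw [mul_apply_eq_comp]; abel
    rw [h1]
    conv_lhs => rw [h.range, h'.range x]
    simp only [map_add]
    abel
  · rw [mul_apply_eq_comp, h'.ker x hx hx', h.ker x hx hx']

theorem isLocal_rot {E : Type*} [NormedAddCommGroup E] [InnerProductSpace ℂ E] [CompleteSpace E]
    {ι κ : E →L[ℂ] H} (hp : IsPair ι κ) (w : ℂ) : IsLocal ι κ (rot κ w) := by
  refine ⟨fun x => ?_, fun x hx hx' => ?_⟩
  · have h1 : rot κ w x - x = (w - 1) • κ ((κ†) x) := by rw [rot_apply]; abel
    rw [h1]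
    simp only [map_smul, hp.left_right, hp.symm.left_left, map_zero, smul_zero, zero_add]
  · rw [rot_apply, hx']; simp

/-- The bound for the averaged fractional moments of all blocks of the resolvent on a pair. -/
noncomputable def avgConst (L : ℕ) (s c : ℝ) : ℝ≥0∞ :=
  ENNReal.ofReal (81 * (1 - c)⁻¹ ^ 2) ^ s * (fracConst L s + ENNReal.ofReal (2 * Real.pi))

theorem avgConst_ne_top (L : ℕ) {s : ℝ} (hs : 0 < s) (c : ℝ) : avgConst L s c ≠ ∞ :=
  ENNReal.mul_ne_top (ENNReal.rpow_ne_top_of_nonneg hs.le ENNReal.ofReal_ne_top)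
    (ENNReal.add_ne_top.mpr ⟨fracConst_ne_top L s, ENNReal.ofReal_ne_top⟩)

/-- Rotating the phase at κ changes neither T and its side energies nor the ι-block of D. So
`pairSum_mul_le` applies with the same c for every phase, and the remaining diagonal block at κ is
averaged by `lintegral_res_rot_le`. -/
theorem lintegral_pairSum_le {L : ℕ} {ι κ : EuclideanSpace ℂ (Fin L) →L[ℂ] H}
    {D T : H →L[ℂ] H} {q q' : H → ℝ} (hp : IsPair ι κ)
    (hD : IsLocal ι κ D) (hDu : D ∈ unitary (H →L[ℂ] H)) (hTu : T ∈ unitary (H →L[ℂ] H))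
    (hq : IsSideEnergy ι κ T q) (hq' : IsSideEnergy κ ι T q') {c : ℝ} (hc0 : 0 ≤ c) (hc1 : c < 1)
    (hc : ‖ι† ∘L D ∘L ι‖ ≤ c) {z : ℂ} (hz : ‖z‖ ≠ 1) {s : ℝ} (hs0 : 0 < s) (hs1 : s < 1)
    {U : ℝ → H →L[ℂ] H} (hU : (∀ η, U η = rot κ (circleMap 0 1 η) * D * T) ∨
      (∀ η, U η = T * (rot κ (circleMap 0 1 η) * D))) :
    ∫⁻ η in Set.Ioc 0 (2 * Real.pi), ENNReal.ofReal (1 + 2 * pairSum (U η) z ι κ) ^ s ≤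
      avgConst L s c := by
  have hk1 : 1 ≤ (1 - c)⁻¹ := (one_le_inv₀ (by linarith)).mpr (by linarith)
  have hpt : ∀ η, ENNReal.ofReal (1 + 2 * pairSum (U η) z ι κ) ^ s ≤
      ENNReal.ofReal (81 * (1 - c)⁻¹ ^ 2) ^ s *
        (‖z • (κ† ∘L res (rot κ (circleMap 0 1 η) * (D * T)) z ∘L κ)‖ₑ ^ s + 1) := fun η => by
    set R := rot κ (circleMap 0 1 η)
    have hRu : R ∈ unitary (H →L[ℂ] H) := rot_mem_unitary hp.right (by simp)
    have hRD := (isLocal_rot hp (circleMap 0 1 η)).mul hD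
    have hRDu : R * D ∈ unitary (H →L[ℂ] H) := mul_mem hRu hDu
    have hcR : ‖ι† ∘L (R * D) ∘L ι‖ ≤ c := by
      have : ι† ∘L (R * D) ∘L ι = ι† ∘L D ∘L ι := by
        ext1 x
        simp only [ContinuousLinearMap.comp_apply, mul_apply_eq_comp, R]
        rw [rot_apply, map_add, map_smul, hp.left_right, smul_zero, add_zero]
      rw [this]; exact hc
    have h1 := pairSum_mul_le hp hRD hRDu hTu hq hq' hc0 hc1 hcR hz
    have h2 := pairSum_conj_le hp hRD hRDu hTu hz
    set X := ‖zblock (R * D * T) z κ κ‖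
    have hX : 0 ≤ X := norm_nonneg _
    -- 81 = 1 + 2·4·10: the 10 is from `pairSum_mul_le`, the 4 from conjugating DT into TD.
    have h3 : 1 + 2 * pairSum (U η) z ι κ ≤ 81 * (1 - c)⁻¹ ^ 2 * (X + 1) := by
      have h4 : 1 ≤ (1 - c)⁻¹ ^ 2 * (X + 1) := by nlinarith
      have h5 := pairSum_nonneg (R * D * T) z ι κ
      rcases hU with h | h <;> rw [h η] <;> nlinarith
    have hX' : ENNReal.ofReal X = ‖z • (κ† ∘L res (R * (D * T)) z ∘L κ)‖ₑ := by
      rw [← ofReal_norm, ← mul_assoc]; rfl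
    calc _ ≤ ENNReal.ofReal (81 * (1 - c)⁻¹ ^ 2 * (X + 1)) ^ s :=
          ENNReal.rpow_le_rpow (ENNReal.ofReal_le_ofReal h3) hs0.le
      _ = ENNReal.ofReal (81 * (1 - c)⁻¹ ^ 2) ^ s * (ENNReal.ofReal X + 1) ^ s := by
          rw [ENNReal.ofReal_mul (by positivity), ENNReal.mul_rpow_of_nonneg _ _ hs0.le,
            ENNReal.ofReal_add hX zero_le_one, ENNReal.ofReal_one]
      _ ≤ _ := by
          rw [hX']
          gcongr
          have := ENNReal.rpow_add_le_add_rpow (‖z • (κ† ∘L res (R * (D * T)) z ∘L κ)‖ₑ) 1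
            hs0.le hs1.le
          rwa [ENNReal.one_rpow] at this
  refine (lintegral_mono hpt).trans ?_
  rw [lintegral_const_mul' _ _ (ENNReal.rpow_ne_top_of_nonneg hs0.le ENNReal.ofReal_ne_top),
    lintegral_add_right _ measurable_const, setLIntegral_const, Real.volume_Ioc, sub_zero, one_mul]
  unfold avgConst
  gcongr
  exact lintegral_res_rot_le hp.right (mul_mem hDu hTu) hz hs0 hs1

end Average

/-! ### Layers of unitary scattering matrices -/

section Layers

variable {L : ℕ}

local notation "𝔼" => EuclideanSpace ℂ (Fin L)

/-- The unitary group `U(2L)`, with `L × L` blocks. -/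
abbrev U2 (L : ℕ) : Type := Matrix.unitaryGroup (Fin L ⊕ Fin L) ℂ

theorem norm_sq_blocks (S : U2 L) (x y : 𝔼) :
    ‖toEuclideanCLM (𝕜 := ℂ) S.1.toBlocks₁₁ x + toEuclideanCLM (𝕜 := ℂ) S.1.toBlocks₁₂ y‖ ^ 2 +
    ‖toEuclideanCLM (𝕜 := ℂ) S.1.toBlocks₂₁ x + toEuclideanCLM (𝕜 := ℂ) S.1.toBlocks₂₂ y‖ ^ 2 =
    ‖x‖ ^ 2 + ‖y‖ ^ 2 := by
  have hu : toEuclideanCLM (n := Fin L ⊕ Fin L) (𝕜 := ℂ) S.1 ∈ unitary _ :=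
    Unitary.map_mem (toEuclideanCLM (n := Fin L ⊕ Fin L) (𝕜 := ℂ)) S.2
  have h := ContinuousLinearMap.norm_map_of_mem_unitary hu
    (WithLp.toLp 2 (Sum.elim x.ofLp y.ofLp))
  have h2 := congrArg (fun t => t ^ 2) h
  simp only [EuclideanSpace.norm_sq_eq, Fintype.sum_sum_type] at h2 ⊢
  rw [toEuclideanCLM_toLp] at h2
  conv at h2 =>
    lhs
    rw [← fromBlocks_toBlocks S.1, fromBlocks_mulVec]
  simpa using h2

theorem bddBlocks_unitary (S : ℤ → U2 L) : BddBlocks fun n => (S n).1 := by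
  have key : ∀ (a b : 𝔼) (x : 𝔼), ‖a‖ ^ 2 + ‖b‖ ^ 2 = ‖x‖ ^ 2 → ‖a‖ ≤ 1 * ‖x‖ ∧ ‖b‖ ≤ 1 * ‖x‖ :=
    fun a b x h => by
      rw [one_mul]
      exact ⟨le_of_sq_le_sq (by nlinarith [sq_nonneg ‖b‖]) (norm_nonneg _),
        le_of_sq_le_sq (by nlinarith [sq_nonneg ‖a‖]) (norm_nonneg _)⟩
  refine ⟨1, fun n => ⟨?_, ?_, ?_, ?_⟩⟩ <;>
    refine ContinuousLinearMap.opNorm_le_bound _ zero_le_one fun x => ?_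
  · exact (key _ _ x (by simpa using norm_sq_blocks (S n) x 0)).1
  · exact (key _ _ x (by simpa using norm_sq_blocks (S n) 0 x)).1
  · exact (key _ _ x (by simpa using norm_sq_blocks (S n) x 0)).2
  · exact (key _ _ x (by simpa using norm_sq_blocks (S n) 0 x)).2

/-- A layer of unitary scattering matrices. -/
noncomputable def layerU (S : ℤ → U2 L) (Ub Vb : UL L) (J : Set ℤ) (e : ℤ) :
    Ell2 J L →L[ℂ] Ell2 J L :=
  layer (fun n => (S n).1) (bddBlocks_unitary S) Ub Vb J e

theorem layerU_apply (S : ℤ → U2 L) (Ub Vb : UL L) (J : Set ℤ) (e : ℤ) (v : Ell2 J L) (i : J) :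
    layerU S Ub Vb J e v i = layerFun (fun n => (S n).1) Ub Vb J e v i := rfl

theorem even_add_one_sub (i e : ℤ) : Even (i + 1 - e) ↔ ¬ Even (i - e) := by
  rw [show i + 1 - e = (i - e) + 1 by ring, Int.even_add_one]

theorem even_sub_one_sub (i e : ℤ) : Even (i - 1 - e) ↔ ¬ Even (i - e) := by
  rw [show i - 1 - e = (i - e) - 1 by ring, Int.even_sub_one]

theorem toBlocks_mul (A B : Matrix (Fin L ⊕ Fin L) (Fin L ⊕ Fin L) ℂ) :
    (A * B).toBlocks₁₁ = A.toBlocks₁₁ * B.toBlocks₁₁ + A.toBlocks₁₂ * B.toBlocks₂₁ ∧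
    (A * B).toBlocks₁₂ = A.toBlocks₁₁ * B.toBlocks₁₂ + A.toBlocks₁₂ * B.toBlocks₂₂ ∧
    (A * B).toBlocks₂₁ = A.toBlocks₂₁ * B.toBlocks₁₁ + A.toBlocks₂₂ * B.toBlocks₂₁ ∧
    (A * B).toBlocks₂₂ = A.toBlocks₂₁ * B.toBlocks₁₂ + A.toBlocks₂₂ * B.toBlocks₂₂ := by
  have h := fromBlocks_multiply A.toBlocks₁₁ A.toBlocks₁₂ A.toBlocks₂₁ A.toBlocks₂₂
    B.toBlocks₁₁ B.toBlocks₁₂ B.toBlocks₂₁ B.toBlocks₂₂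
  rw [fromBlocks_toBlocks, fromBlocks_toBlocks] at h
  rw [h]
  simp

/-- Layers of the same parity are block diagonal for the same pairing of sites, so they multiply
block by block. Factorizations through a single bond and the inverse of a layer all come from this.
-/
theorem layerU_mul (S S' : ℤ → U2 L) (Ub Vb Ub' Vb' : UL L) (J : Set ℤ) (e : ℤ) :
    layerU S Ub Vb J e * layerU S' Ub' Vb' J e = layerU (S * S') (Ub * Ub') (Vb * Vb') J e := by
  ext1 v
  refine lp.ext (funext fun i => ?_)
  rw [mul_apply_eq_comp, layerU_apply, layerU_apply]
  obtain ⟨h11, h12, h21, h22⟩ := toBlocks_mul (S i).1 (S' i).1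
  obtain ⟨k11, k12, k21, k22⟩ := toBlocks_mul (S (i - 1)).1 (S' (i - 1)).1
  by_cases he : Even ((i : ℤ) - e)
  · by_cases h : (i : ℤ) + 1 ∈ J
    · simp [layerFun, layerU_apply, he, h, even_add_one_sub, h11, h12]
      abel
    · simp [layerFun, layerU_apply, he, h]
  · by_cases h : (i : ℤ) - 1 ∈ J
    · simp [layerFun, layerU_apply, he, h, even_sub_one_sub, k21, k22]
      abel
    · simp [layerFun, layerU_apply, he, h]

theorem toBlocks_one : (1 : Matrix (Fin L ⊕ Fin L) (Fin L ⊕ Fin L) ℂ).toBlocks₁₁ = 1 ∧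
    (1 : Matrix (Fin L ⊕ Fin L) (Fin L ⊕ Fin L) ℂ).toBlocks₁₂ = 0 ∧
    (1 : Matrix (Fin L ⊕ Fin L) (Fin L ⊕ Fin L) ℂ).toBlocks₂₁ = 0 ∧
    (1 : Matrix (Fin L ⊕ Fin L) (Fin L ⊕ Fin L) ℂ).toBlocks₂₂ = 1 := by
  rw [← fromBlocks_one]
  simp only [toBlocks_fromBlocks₁₁, toBlocks_fromBlocks₁₂, toBlocks_fromBlocks₂₁,
    toBlocks_fromBlocks₂₂, and_self]

theorem layerU_one (J : Set ℤ) (e : ℤ) : layerU (1 : ℤ → U2 L) 1 1 J e = 1 := by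
  ext1 v
  refine lp.ext (funext fun i => ?_)
  rw [layerU_apply]
  obtain ⟨h11, h12, h21, h22⟩ := toBlocks_one (L := L)
  by_cases he : Even ((i : ℤ) - e)
  · by_cases h : (i : ℤ) + 1 ∈ J
    · simp [layerFun, he, h, h11, h12]
    · simp [layerFun, he, h]
  · by_cases h : (i : ℤ) - 1 ∈ J
    · simp [layerFun, he, h, h21, h22]
    · simp [layerFun, he, h]

theorem layerU_congr {S S' : ℤ → U2 L} (Ub Vb : UL L) {J : Set ℤ} {e : ℤ}
    (h : ∀ i, Even (i - e) → i ∈ J → i + 1 ∈ J → S i = S' i) :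
    layerU S Ub Vb J e = layerU S' Ub Vb J e := by
  ext1 v
  refine lp.ext (funext fun i => ?_)
  rw [layerU_apply, layerU_apply]
  by_cases he : Even ((i : ℤ) - e)
  · by_cases h' : (i : ℤ) + 1 ∈ J
    · simp [layerFun, he, h', h i he i.2 h']
    · simp [layerFun, he, h']
  · by_cases h' : (i : ℤ) - 1 ∈ J
    · simp [layerFun, he, h', h (i - 1) ((even_sub_one_sub _ _).mpr he) h' (by simp)]
    · simp [layerFun, he, h']

theorem norm_sq_ell2 {J : Set ℤ} (v : Ell2 J L) :
    ‖v‖ ^ 2 = ∑' i, ‖v i‖ ^ 2 ∧ Summable fun i => ‖v i‖ ^ 2 := by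
  have hp : (0 : ℝ) < (2 : ENNReal).toReal := by norm_num
  exact ⟨by simpa using lp.norm_rpow_eq_tsum hp v, by simpa using (lp.memℓp v).summable hp⟩

/-- Energy is conserved only pair by pair; summing the pair identity over all sites counts every
term twice on both sides. -/
theorem tsum_eq_of_involutive {α : Type*} {σ : α → α} (hσ : Function.Involutive σ) {f g : α → ℝ}
    (hf : Summable f) (hg : Summable g) (h : ∀ i, f i + f (σ i) = g i + g (σ i)) :
    ∑' i, f i = ∑' i, g i := by
  have h1 : ∀ {f : α → ℝ}, Summable f → ∑' i, (f i + f (σ i)) = 2 * ∑' i, f i := fun {f} hf => by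
    have h2 : Summable fun i => f (σ i) := (hσ.toPerm.summable_iff (f := f)).mpr hf
    have h3 : ∑' i, f (σ i) = ∑' i, f i := hσ.toPerm.tsum_eq f
    rw [hf.tsum_add h2, h3]; ring
  have h4 := h1 hf
  rw [tsum_congr h, h1 hg] at h4
  linarith

theorem norm_sq_layerU_add_partner (S : ℤ → U2 L) (Ub Vb : UL L) (J : Set ℤ) (e : ℤ)
    (v : Ell2 J L) (i : J) :
    ‖layerU S Ub Vb J e v i‖ ^ 2 + ‖layerU S Ub Vb J e v (partner J e i)‖ ^ 2 =
      ‖v i‖ ^ 2 + ‖v (partner J e i)‖ ^ 2 := by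
  have hu : ∀ (U : UL L) (x : 𝔼), ‖toEuclideanCLM (𝕜 := ℂ) U.1 x‖ = ‖x‖ := fun U x =>
    ContinuousLinearMap.norm_map_of_mem_unitary
      (Unitary.map_mem (toEuclideanCLM (n := Fin L) (𝕜 := ℂ)) U.2) x
  simp only [layerU_apply]
  by_cases he : Even ((i : ℤ) - e)
  · by_cases h : (i : ℤ) + 1 ∈ J
    · have := norm_sq_blocks (S i) (v i) (v ⟨i + 1, h⟩)
      simpa [layerFun, partner, he, h, even_add_one_sub] using this
    · simp [layerFun, partner, he, h, hu]
  · by_cases h : (i : ℤ) - 1 ∈ J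
    · have := norm_sq_blocks (S (i - 1)) (v ⟨i - 1, h⟩) (v i)
      rw [add_comm, add_comm (‖v ⟨i - 1, h⟩‖ ^ 2)] at this
      simpa [layerFun, partner, he, h, even_sub_one_sub] using this
    · simp [layerFun, partner, he, h, hu]

theorem norm_layerU_apply (S : ℤ → U2 L) (Ub Vb : UL L) (J : Set ℤ) (e : ℤ) (v : Ell2 J L) :
    ‖layerU S Ub Vb J e v‖ = ‖v‖ := by
  rw [← sq_eq_sq₀ (norm_nonneg _) (norm_nonneg _), (norm_sq_ell2 _).1, (norm_sq_ell2 _).1]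
  exact tsum_eq_of_involutive (partner_involutive J e) (norm_sq_ell2 _).2 (norm_sq_ell2 _).2
    (norm_sq_layerU_add_partner S Ub Vb J e v)

/-- A layer is isometric, but J may be infinite, so surjectivity needs its own argument: the layer
of inverse matrices is a right inverse. -/
theorem layerU_mem_unitary (S : ℤ → U2 L) (Ub Vb : UL L) (J : Set ℤ) (e : ℤ) :
    layerU S Ub Vb J e ∈ unitary (Ell2 J L →L[ℂ] Ell2 J L) := by
  set A := layerU S Ub Vb J e
  have h1 : A† * A = 1 := by
    have := (ContinuousLinearMap.norm_map_iff_adjoint_comp_self A).mp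
      (norm_layerU_apply S Ub Vb J e)
    exact this
  have h2 : A * layerU S⁻¹ Ub⁻¹ Vb⁻¹ J e = 1 := by
    rw [layerU_mul, mul_inv_cancel, mul_inv_cancel, mul_inv_cancel, layerU_one]
  have h3 : A† = layerU S⁻¹ Ub⁻¹ Vb⁻¹ J e := by
    rw [← mul_one (A†), ← h2, ← mul_assoc, h1, one_mul]
  rw [Unitary.mem_iff, ContinuousLinearMap.star_eq_adjoint]
  exact ⟨h1, by rw [h3, h2]⟩

/-- The zipper of a family of unitary scattering matrices. -/
noncomputable def zipU (S : ℤ → U2 L) (Ub Vb : UL L) (J : Set ℤ) : Ell2 J L →L[ℂ] Ell2 J L :=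
  layerU S Ub Vb J 0 * layerU S Ub Vb J 1

theorem zipU_mem_unitary (S : ℤ → U2 L) (Ub Vb : UL L) (J : Set ℤ) :
    zipU S Ub Vb J ∈ unitary (Ell2 J L →L[ℂ] Ell2 J L) :=
  mul_mem (layerU_mem_unitary ..) (layerU_mem_unitary ..)

end Layers

/-! ### Sites, restriction to a subset, and cutting a bond -/

section Sites

variable {L : ℕ} {J J' : Set ℤ}

local notation "𝔼" => EuclideanSpace ℂ (Fin L)

/-- The inclusion of the site `j` into `ℓ²(J, ℂ^L)`. -/
noncomputable def site (j : J) : EuclideanSpace ℂ (Fin L) →L[ℂ] Ell2 J L :=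
  lp.singleContinuousLinearMap ℂ (fun _ : J => EuclideanSpace ℂ (Fin L)) 2 j

theorem site_apply (j : J) (a : 𝔼) : site j a = lp.single 2 j a := rfl

theorem site_apply_self (j : J) (a : 𝔼) : site j a j = a := by
  rw [site_apply]; exact lp.single_apply_self (E := fun _ : J => 𝔼) 2 j a

theorem site_apply_ne {i j : J} (h : i ≠ j) (a : 𝔼) : site j a i = 0 := by
  rw [site_apply]; exact lp.single_apply_ne (E := fun _ : J => 𝔼) 2 j a h

theorem adjoint_site_apply (j : J) (v : Ell2 J L) : ((site j)†) v = v j := by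
  refine ext_inner_left ℂ fun a => ?_
  rw [ContinuousLinearMap.adjoint_inner_right, site_apply]
  exact lp.inner_single_left (𝕜 := ℂ) (G := fun _ : J => 𝔼) j a v

theorem isPair_site {i j : J} (h : i ≠ j) : IsPair (site (L := L) i) (site j) := by
  refine ⟨?_, ?_, ?_⟩ <;> ext1 a <;>
    simp only [ContinuousLinearMap.comp_apply, adjoint_site_apply, site_apply_self,
      one_apply_eq_self, _root_.zero_apply, site_apply_ne h]

theorem eq_site_add_site {i j : J} (h : i ≠ j) {v : Ell2 J L}
    (hv : ∀ m, m ≠ i → m ≠ j → v m = 0) : v = site i (v i) + site j (v j) := by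
  refine lp.ext (funext fun m => ?_)
  rw [lp.coeFn_add, Pi.add_apply]
  by_cases h1 : m = i
  · subst h1; rw [site_apply_self, site_apply_ne h, add_zero]
  by_cases h2 : m = j
  · subst h2; rw [site_apply_self, site_apply_ne h1, zero_add]
  · rw [hv m h1 h2, site_apply_ne h1, site_apply_ne h2, add_zero]

/-- Restriction of a vector to a smaller set of sites. -/
noncomputable def restr (h : J' ⊆ J) : Ell2 J L →L[ℂ] Ell2 J' L :=
  LinearMap.mkContinuous
    { toFun := fun v => ⟨fun i => v (Set.inclusion h i), memℓp_gen (by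
        have := (norm_sq_ell2 v).2.comp_injective (Set.inclusion_injective h)
        simpa [Function.comp_def] using this)⟩
      map_add' := fun v w => by ext1; rfl
      map_smul' := fun c v => by ext1; rfl }
    1 (fun v => by
      rw [one_mul]
      refine le_of_sq_le_sq ?_ (norm_nonneg _)
      rw [(norm_sq_ell2 _).1, (norm_sq_ell2 _).1]
      exact tsum_comp_le_tsum_of_inj (norm_sq_ell2 v).2 (fun _ => by positivity)
        (Set.inclusion_injective h))

theorem restr_apply (h : J' ⊆ J) (v : Ell2 J L) (i : J') : restr h v i = v (Set.inclusion h i) :=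
  rfl

theorem restr_site (h : J' ⊆ J) (j : J') (a : 𝔼) :
    restr h (site (Set.inclusion h j) a) = site j a := by
  refine lp.ext (funext fun i => ?_)
  rw [restr_apply]
  by_cases hi : i = j
  · subst hi; rw [site_apply_self, site_apply_self]
  · rw [site_apply_ne hi, site_apply_ne fun h' => hi (Set.inclusion_injective h h')]

theorem restr_site_of_notMem (h : J' ⊆ J) {j : J} (hj : (j : ℤ) ∉ J') (a : 𝔼) :
    restr h (site j a) = 0 := by
  refine lp.ext (funext fun i => ?_)
  rw [restr_apply, site_apply_ne]
  · rfl
  · rintro rfl; exact hj i.2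

/-- The block-diagonal unitary matrix with blocks `A` and `B`. -/
def diagU (A B : UL L) : U2 L :=
  ⟨fromBlocks A.1 0 0 B.1, by
    have hA := mem_unitaryGroup_iff.mp A.2
    have hB := mem_unitaryGroup_iff.mp B.2
    rw [star_eq_conjTranspose] at hA hB
    rw [mem_unitaryGroup_iff, star_eq_conjTranspose, fromBlocks_conjTranspose,
      fromBlocks_multiply]
    simp [hA, hB]⟩

/-- The family of scattering matrices with the bond `(n, n + 1)` cut. -/
def cut (S : ℤ → U2 L) (Ub Vb : UL L) (n : ℤ) : ℤ → U2 L := Function.update S n (diagU Vb Ub)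

/-- The cut matrix is diag(Vb, Ub): n becomes the right end of the left part and n + 1 the left end
of the right part. Both parts thus carry exactly the boundary conditions of the restricted zipper.
The hypothesis `hn` says that n is the only bond that may leave J'. -/
theorem restr_layerU_cut (h : J' ⊆ J) (S : ℤ → U2 L) (Ub Vb : UL L) {n : ℤ}
    (hn : ∀ i ∈ J, i + 1 ∈ J → i ≠ n → (i ∈ J' ↔ i + 1 ∈ J')) (e : ℤ) (v : Ell2 J L) :
    restr h (layerU (cut S Ub Vb n) Ub Vb J e v) =
      layerU (cut S Ub Vb n) Ub Vb J' e (restr h v) := by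
  refine lp.ext (funext fun i => ?_)
  rw [restr_apply, layerU_apply, layerU_apply]
  have hiJ := h i.2
  by_cases he : Even ((i : ℤ) - e)
  · by_cases h1 : (i : ℤ) + 1 ∈ J'
    · have h2 := h h1
      simp [layerFun, he, h1, h2, restr_apply, Set.inclusion]
    · by_cases h2 : (i : ℤ) + 1 ∈ J
      · have h3 : (i : ℤ) = n := by
          by_contra h3
          exact h1 ((hn i hiJ h2 h3).mp i.2)
        have hcut : cut S Ub Vb n (i : ℤ) = diagU Vb Ub := by rw [h3]; simp [cut]
        simp [layerFun, he, h1, h2, restr_apply, Set.inclusion, hcut, diagU]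
      · simp [layerFun, he, h1, h2, restr_apply, Set.inclusion]
  · by_cases h1 : (i : ℤ) - 1 ∈ J'
    · have h2 := h h1
      simp [layerFun, he, h1, h2, restr_apply, Set.inclusion]
    · by_cases h2 : (i : ℤ) - 1 ∈ J
      · have h3 : (i : ℤ) - 1 = n := by
          by_contra h3
          exact h1 ((hn _ h2 (by simpa using hiJ) h3).mpr (by simp))
        have hcut : cut S Ub Vb n ((i : ℤ) - 1) = diagU Vb Ub := by rw [h3]; simp [cut]
        simp [layerFun, he, h1, h2, restr_apply, Set.inclusion, hcut, diagU]
      · simp [layerFun, he, h1, h2, restr_apply, Set.inclusion]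

theorem restr_zipU_cut (h : J' ⊆ J) (S : ℤ → U2 L) (Ub Vb : UL L) {n : ℤ}
    (hn : ∀ i ∈ J, i + 1 ∈ J → i ≠ n → (i ∈ J' ↔ i + 1 ∈ J')) (hn' : n ∉ J' ∨ n + 1 ∉ J')
    (v : Ell2 J L) :
    restr h (zipU (cut S Ub Vb n) Ub Vb J v) = zipU S Ub Vb J' (restr h v) := by
  have h1 : ∀ e, layerU (cut S Ub Vb n) Ub Vb J' e = layerU S Ub Vb J' e := fun e =>
    layerU_congr Ub Vb fun i _ hi hi' => by
      have : i ≠ n := by rintro rfl; tauto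
      simp [cut, this]
  rw [zipU, zipU, mul_apply_eq_comp, mul_apply_eq_comp, restr_layerU_cut h S Ub Vb hn,
    restr_layerU_cut h S Ub Vb hn, h1, h1]

/-- Restriction intertwines the two unitaries, hence also their resolvents. -/
theorem restr_res_cut (h : J' ⊆ J) (S : ℤ → U2 L) (Ub Vb : UL L) {n : ℤ}
    (hn : ∀ i ∈ J, i + 1 ∈ J → i ≠ n → (i ∈ J' ↔ i + 1 ∈ J')) (hn' : n ∉ J' ∨ n + 1 ∉ J')
    {z : ℂ} (hz : ‖z‖ ≠ 1) (v : Ell2 J L) :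
    restr h (res (zipU (cut S Ub Vb n) Ub Vb J) z v) = res (zipU S Ub Vb J') z (restr h v) := by
  have h1 := congrArg (restr h) (map_res_apply (zipU_mem_unitary (cut S Ub Vb n) Ub Vb J) hz v)
  rw [restr_zipU_cut h S Ub Vb hn hn', map_add, map_smul] at h1
  have h2 := res_map_apply (zipU_mem_unitary S Ub Vb J') hz
    (restr h (res (zipU (cut S Ub Vb n) Ub Vb J) z v))
  rw [h1, map_add, map_smul] at h2
  exact (add_left_cancel h2).symm

/-- The cut zipper restricts to a unitary on J', so the total energy on J', end site included, is
conserved. -/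
theorem isSideEnergy_cut (h : J' ⊆ J) (S : ℤ → U2 L) (Ub Vb : UL L) {n : ℤ}
    (hn : ∀ i ∈ J, i + 1 ∈ J → i ≠ n → (i ∈ J' ↔ i + 1 ∈ J')) (hn' : n ∉ J' ∨ n + 1 ∉ J')
    (i : J') {j : J} (hj : (j : ℤ) ∉ J') :
    IsSideEnergy (site (Set.inclusion h i)) (site j) (zipU (cut S Ub Vb n) Ub Vb J)
      fun v => ‖restr h v‖ ^ 2 - ‖restr h v i‖ ^ 2 := by
  refine ⟨fun v => ?_, fun v a => ?_, fun v a => ?_, fun c v => ?_, fun v => ?_⟩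
  · have := lp.norm_apply_le_norm (p := 2) (by norm_num) (restr h v) i
    have h2 := norm_nonneg (restr h v i)
    nlinarith
  · rw [map_add, restr_site, lp.coeFn_add, Pi.add_apply, site_apply_self,
      norm_add_sq (𝕜 := ℂ), norm_add_sq (𝕜 := ℂ), ← ContinuousLinearMap.adjoint_inner_left,
      adjoint_site_apply, norm_isometry_apply (E := 𝔼)]
    · ring
    · ext1 x; simp [adjoint_site_apply, site_apply_self]
  · rw [map_add, restr_site_of_notMem h hj, add_zero]
  · simp only [map_smul, lp.coeFn_smul, Pi.smul_apply, norm_smul]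
    ring
  · simp only [adjoint_site_apply, ← restr_apply]
    rw [restr_zipU_cut h S Ub Vb hn hn', norm_apply_of_mem_unitary (zipU_mem_unitary S Ub Vb J')]
    ring

end Sites

/-! ### The zipper as a local perturbation of the cut zipper -/

section Bond

variable {L : ℕ} {J J' J'' : Set ℤ}

local notation "𝔼" => EuclideanSpace ℂ (Fin L)

/-- The operator acting by `M` on the sites `n, n + 1` and trivially elsewhere. -/
noncomputable def bondOp (J : Set ℤ) (n : ℤ) (M : U2 L) (e : ℤ) : Ell2 J L →L[ℂ] Ell2 J L :=
  layerU (Function.update 1 n M) 1 1 J e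

theorem bondOp_mul (n : ℤ) (M M' : U2 L) (e : ℤ) :
    bondOp J n M e * bondOp J n M' e = bondOp J n (M * M') e := by
  rw [bondOp, bondOp, layerU_mul, one_mul, bondOp]
  congr 1
  funext i
  by_cases hi : i = n
  · subst hi; simp
  · simp [hi]

theorem bondOp_mem_unitary (n : ℤ) (M : U2 L) (e : ℤ) :
    bondOp J n M e ∈ unitary (Ell2 J L →L[ℂ] Ell2 J L) := layerU_mem_unitary ..

theorem bondOp_apply_left {n e : ℤ} (hn : n ∈ J) (hn' : n + 1 ∈ J) (he : Even (n - e)) (M : U2 L)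
    (v : Ell2 J L) : bondOp J n M e v ⟨n, hn⟩ =
      toEuclideanCLM (𝕜 := ℂ) M.1.toBlocks₁₁ (v ⟨n, hn⟩) +
      toEuclideanCLM (𝕜 := ℂ) M.1.toBlocks₁₂ (v ⟨n + 1, hn'⟩) := by
  rw [bondOp, layerU_apply]
  simp [layerFun, he, hn']

theorem bondOp_apply_right {n e : ℤ} (hn : n ∈ J) (hn' : n + 1 ∈ J) (he : Even (n - e)) (M : U2 L)
    (v : Ell2 J L) : bondOp J n M e v ⟨n + 1, hn'⟩ =
      toEuclideanCLM (𝕜 := ℂ) M.1.toBlocks₂₁ (v ⟨n, hn⟩) +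
      toEuclideanCLM (𝕜 := ℂ) M.1.toBlocks₂₂ (v ⟨n + 1, hn'⟩) := by
  rw [bondOp, layerU_apply]
  simp [layerFun, he, hn, even_add_one_sub]

theorem bondOp_apply_of_ne {n e : ℤ} (M : U2 L) (v : Ell2 J L) {i : J}
    (hi : (i : ℤ) ≠ n) (hi' : (i : ℤ) ≠ n + 1) : bondOp J n M e v i = v i := by
  have h1 : bondOp J n M e v i = layerU (1 : ℤ → U2 L) 1 1 J e v i := by
    rw [bondOp, layerU_apply, layerU_apply]
    have h2 : (i : ℤ) - 1 ≠ n := fun h => hi' (by linarith)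
    simp [layerFun, Function.update_of_ne hi, Function.update_of_ne h2]
  rw [h1, layerU_one, one_apply_eq_self]

theorem isLocal_bondOp {n e : ℤ} (hn : n ∈ J) (hn' : n + 1 ∈ J) (he : Even (n - e)) (M : U2 L) :
    IsLocal (site ⟨n, hn⟩) (site ⟨n + 1, hn'⟩) (bondOp J n M e) := by
  have hne : (⟨n, hn⟩ : J) ≠ ⟨n + 1, hn'⟩ := fun h => by simp at h
  refine ⟨fun x => ?_, fun x hx hx' => ?_⟩
  · simp only [adjoint_site_apply]
    refine eq_site_add_site hne fun m h1 h2 => ?_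
    rw [lp.coeFn_sub, Pi.sub_apply, bondOp_apply_of_ne, sub_self]
    · exact fun h => h1 (Subtype.ext h)
    · exact fun h => h2 (Subtype.ext h)
  · rw [adjoint_site_apply] at hx hx'
    refine lp.ext (funext fun i => ?_)
    by_cases h1 : (i : ℤ) = n
    · obtain rfl : i = ⟨n, hn⟩ := Subtype.ext h1
      rw [bondOp_apply_left hn hn' he, hx, hx', map_zero, map_zero, add_zero]
    by_cases h2 : (i : ℤ) = n + 1
    · obtain rfl : i = ⟨n + 1, hn'⟩ := Subtype.ext h2
      rw [bondOp_apply_right hn hn' he, hx, hx', map_zero, map_zero, add_zero]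
    · exact bondOp_apply_of_ne M x h1 h2

theorem bondOp_block {n e : ℤ} (hn : n ∈ J) (hn' : n + 1 ∈ J) (he : Even (n - e)) (M : U2 L) :
    (site ⟨n, hn⟩)† ∘L bondOp J n M e ∘L site ⟨n, hn⟩ =
      toEuclideanCLM (n := Fin L) (𝕜 := ℂ) M.1.toBlocks₁₁ := by
  ext1 a
  rw [ContinuousLinearMap.comp_apply, ContinuousLinearMap.comp_apply, adjoint_site_apply,
    bondOp_apply_left hn hn' he, site_apply_self, site_apply_ne, map_zero, add_zero]
  exact fun h => by simp at h

/-- The scalar unitary matrix `w`. -/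
def scalarU (L : ℕ) (w : Circle) : UL L :=
  ⟨(w : ℂ) • 1, by
    rw [mem_unitaryGroup_iff, star_smul, star_one, smul_mul_smul_comm, one_mul, Complex.star_def,
      Complex.mul_conj, Circle.normSq_coe, Complex.ofReal_one, one_smul]⟩

/-- This links the randomness to the abstract rotation: a phase on the lower row of S n is `rot` at
the site n + 1. -/
theorem bondOp_diagU_scalarU {n e : ℤ} (hn : n ∈ J) (hn' : n + 1 ∈ J) (he : Even (n - e))
    (w : Circle) : bondOp J n (diagU 1 (scalarU L w)) e = rot (site ⟨n + 1, hn'⟩) (w : ℂ) := by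
  ext1 v
  refine lp.ext (funext fun i => ?_)
  rw [rot_apply, adjoint_site_apply, lp.coeFn_add, Pi.add_apply, lp.coeFn_smul, Pi.smul_apply]
  by_cases h1 : (i : ℤ) = n
  · obtain rfl : i = ⟨n, hn⟩ := Subtype.ext h1
    rw [bondOp_apply_left hn hn' he, site_apply_ne]
    · simp [diagU]
    · exact fun h => by simp at h
  by_cases h2 : (i : ℤ) = n + 1
  · obtain rfl : i = ⟨n + 1, hn'⟩ := Subtype.ext h2
    rw [bondOp_apply_right hn hn' he, site_apply_self]
    simp [diagU, scalarU, sub_smul]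
  · rw [bondOp_apply_of_ne _ v h1 h2, site_apply_ne]
    · simp
    · rintro rfl; exact h2 rfl

theorem layerU_eq_bondOp_mul (S : ℤ → U2 L) (Ub Vb : UL L) (n e : ℤ) :
    layerU S Ub Vb J e =
      bondOp J n (S n * (diagU Vb Ub)⁻¹) e * layerU (cut S Ub Vb n) Ub Vb J e := by
  rw [bondOp, layerU_mul, one_mul, one_mul]
  congr 1
  funext i
  by_cases hi : i = n
  · subst hi; simp [cut]
  · simp [hi, cut]

theorem layerU_eq_mul_bondOp (S : ℤ → U2 L) (Ub Vb : UL L) (n e : ℤ) :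
    layerU S Ub Vb J e =
      layerU (cut S Ub Vb n) Ub Vb J e * bondOp J n ((diagU Vb Ub)⁻¹ * S n) e := by
  rw [bondOp, layerU_mul, mul_one, mul_one]
  congr 1
  funext i
  by_cases hi : i = n
  · subst hi; simp [cut]
  · simp [hi, cut]

theorem layerU_eq_cut (S : ℤ → U2 L) (Ub Vb : UL L) {n e : ℤ} (he : ¬ Even (n - e)) :
    layerU S Ub Vb J e = layerU (cut S Ub Vb n) Ub Vb J e :=
  layerU_congr Ub Vb fun i hi _ _ => by
    have : i ≠ n := by rintro rfl; exact he hi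
    simp [cut, this]

/-- An even bond belongs to the left factor 𝕍 and so perturbs from the left; an odd bond belongs to
𝕎 and perturbs from the right. This is the source of the two cases DT and TD. -/
theorem zipU_of_even (S : ℤ → U2 L) (Ub Vb : UL L) {n : ℤ} (hn : Even n) :
    zipU S Ub Vb J =
      bondOp J n (S n * (diagU Vb Ub)⁻¹) 0 * zipU (cut S Ub Vb n) Ub Vb J := by
  have h1 : ¬ Even (n - 1) := by rw [Int.even_sub_one]; simpa using hn
  rw [zipU, layerU_eq_bondOp_mul S Ub Vb n 0, layerU_eq_cut S Ub Vb h1, mul_assoc, zipU]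

theorem zipU_of_odd (S : ℤ → U2 L) (Ub Vb : UL L) {n : ℤ} (hn : ¬ Even n) :
    zipU S Ub Vb J =
      zipU (cut S Ub Vb n) Ub Vb J * bondOp J n ((diagU Vb Ub)⁻¹ * S n) 1 := by
  have h1 : ¬ Even (n - 0) := by simpa using hn
  rw [zipU, layerU_eq_mul_bondOp S Ub Vb n 1, layerU_eq_cut S Ub Vb h1, ← mul_assoc, zipU]

/-- The zipper is a local perturbation, from the left or from the right, of the cut zipper. -/
theorem zipU_eq_or (S : ℤ → U2 L) (Ub Vb : UL L) {n : ℤ} (hn : n ∈ J) (hn' : n + 1 ∈ J) :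
    ∃ D : Ell2 J L →L[ℂ] Ell2 J L, IsLocal (site ⟨n, hn⟩) (site ⟨n + 1, hn'⟩) D ∧
      D ∈ unitary (Ell2 J L →L[ℂ] Ell2 J L) ∧
      (zipU S Ub Vb J = D * zipU (cut S Ub Vb n) Ub Vb J ∨
        zipU S Ub Vb J = zipU (cut S Ub Vb n) Ub Vb J * D) := by
  by_cases h : Even n
  · exact ⟨_, isLocal_bondOp hn hn' (by simpa using h) _, bondOp_mem_unitary _ _ _,
      Or.inl (zipU_of_even S Ub Vb h)⟩
  · exact ⟨_, isLocal_bondOp hn hn' (by rw [Int.even_sub_one]; exact h) _,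
      bondOp_mem_unitary _ _ _, Or.inr (zipU_of_odd S Ub Vb h)⟩

/-- The block `(k, l)` of the resolvent of a zipper. -/
noncomputable def gblk (S : ℤ → U2 L) (Ub Vb : UL L) (J : Set ℤ) (z : ℂ) (k l : J) :
    EuclideanSpace ℂ (Fin L) →L[ℂ] EuclideanSpace ℂ (Fin L) :=
  (site k)† ∘L res (zipU S Ub Vb J) z ∘L site l

/-- The family of scattering matrices with the phase of the lower row of `S n` rotated. -/
def rotS (S : ℤ → U2 L) (n : ℤ) (w : Circle) : ℤ → U2 L :=
  Function.update S n (diagU 1 (scalarU L w) * S n)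

theorem cut_rotS (S : ℤ → U2 L) (Ub Vb : UL L) (n : ℤ) (w : Circle) :
    cut (rotS S n w) Ub Vb n = cut S Ub Vb n := by
  simp [cut, rotS]

theorem diagU_mul (A B A' B' : UL L) : diagU A B * diagU A' B' = diagU (A * A') (B * B') := by
  apply Subtype.ext
  change fromBlocks _ _ _ _ * fromBlocks _ _ _ _ = fromBlocks _ _ _ _
  rw [fromBlocks_multiply]
  simp

theorem diagU_inv (A B : UL L) : (diagU A B)⁻¹ = diagU A⁻¹ B⁻¹ := by
  rw [inv_eq_iff_mul_eq_one, diagU_mul, mul_inv_cancel, mul_inv_cancel]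
  apply Subtype.ext
  change fromBlocks _ _ _ _ = _
  simp

theorem scalarU_mul_comm (w : Circle) (A : UL L) : scalarU L w * A = A * scalarU L w := by
  apply Subtype.ext
  change ((w : ℂ) • (1 : Matrix (Fin L) (Fin L) ℂ)) * A.1 = A.1 * ((w : ℂ) • 1)
  simp

theorem specNorm_mul_unitary_le (A : Matrix (Fin L) (Fin L) ℂ) (U : UL L) :
    specNorm (A * U.1) ≤ specNorm A ∧ specNorm (U.1 * A) ≤ specNorm A := by
  have h0 : 0 ≤ specNorm A := norm_nonneg _
  exact ⟨(specNorm_mul_le A U.1).trans (mul_le_of_le_one_right h0 (specNorm_unitary_le U)),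
    (specNorm_mul_le U.1 A).trans (mul_le_of_le_one_left h0 (specNorm_unitary_le U))⟩

theorem lintegral_pairSum_zipU_le (S : ℤ → U2 L) (Ub Vb : UL L) {n : ℤ} (hn : n ∈ J)
    (hn' : n + 1 ∈ J) {c : ℝ} (hc1 : c < 1) (hc : specNorm (S n).1.toBlocks₁₁ ≤ c) {z : ℂ}
    (hz : ‖z‖ ≠ 1) {s : ℝ} (hs0 : 0 < s) (hs1 : s < 1) :
    ∫⁻ η in Set.Ioc 0 (2 * Real.pi), ENNReal.ofReal (1 + 2 *
      pairSum (zipU (rotS S n (Circle.exp η)) Ub Vb J) z (site ⟨n, hn⟩) (site ⟨n + 1, hn'⟩)) ^ s ≤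
      avgConst L s c := by
  have hne : (⟨n, hn⟩ : J) ≠ ⟨n + 1, hn'⟩ := fun h => by simp at h
  have hc0 : 0 ≤ c := (norm_nonneg _).trans hc
  have hw : ∀ η, (Circle.exp η : ℂ) = circleMap 0 1 η := fun η => by simp [circleMap]
  set J₀ : Set ℤ := {i | i ∈ J ∧ i ≤ n}
  set J₁ : Set ℤ := {i | i ∈ J ∧ n + 1 ≤ i}
  have hJ₀ : J₀ ⊆ J := fun i hi => hi.1
  have hJ₁ : J₁ ⊆ J := fun i hi => hi.1
  have q₀ := isSideEnergy_cut hJ₀ S Ub Vb (n := n)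
    (fun i hi hi' h => ⟨fun h1 => ⟨hi', by have := h1.2; omega⟩,
      fun h1 => ⟨hi, by have := h1.2; omega⟩⟩) (Or.inr fun h => by have := h.2; omega)
    ⟨n, hn, le_rfl⟩ (j := ⟨n + 1, hn'⟩) (fun h => by have := h.2; simp at this)
  have q₁ := isSideEnergy_cut hJ₁ S Ub Vb (n := n)
    (fun i hi hi' h => ⟨fun h1 => ⟨hi', by have := h1.2; omega⟩,
      fun h1 => ⟨hi, by have := h1.2; omega⟩⟩) (Or.inl fun h => by have := h.2; omega)
    ⟨n + 1, hn', le_rfl⟩ (j := ⟨n, hn⟩) (fun h => by have := h.2; simp at this)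
  -- The correction by the inverse of the cut matrix multiplies the upper left block of S n by the
  -- unitary Vb⁻¹ only, so the bound c survives.
  have hd1 : (diagU Vb Ub)⁻¹.1.toBlocks₁₂ = 0 ∧ (diagU Vb Ub)⁻¹.1.toBlocks₂₁ = 0 ∧
      (diagU Vb Ub)⁻¹.1.toBlocks₁₁ = (Vb⁻¹).1 := by
    rw [diagU_inv]; simp [diagU]
  by_cases h : Even n
  · refine lintegral_pairSum_le (isPair_site hne)
      (isLocal_bondOp hn hn' (e := 0) (by simpa using h) (S n * (diagU Vb Ub)⁻¹))
      (bondOp_mem_unitary _ _ _) (zipU_mem_unitary (cut S Ub Vb n) Ub Vb J) q₀ q₁ hc0 hc1 ?_ hz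
      hs0 hs1 (Or.inl fun η => ?_)
    · rw [bondOp_block hn hn' (by simpa using h)]
      obtain ⟨h1, -⟩ := toBlocks_mul (S n).1 (diagU Vb Ub)⁻¹.1
      refine le_trans ?_ hc
      change specNorm ((S n).1 * (diagU Vb Ub)⁻¹.1).toBlocks₁₁ ≤ _
      rw [h1, hd1.2.1, hd1.2.2, mul_zero, add_zero]
      exact (specNorm_mul_unitary_le _ _).1
    · rw [zipU_of_even _ _ _ h, cut_rotS, ← hw, ← bondOp_diagU_scalarU hn hn' (e := 0)
        (by simpa using h), bondOp_mul, rotS, Function.update_self, mul_assoc]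
  · have he : Even (n - 1) := by rw [Int.even_sub_one]; exact h
    refine lintegral_pairSum_le (isPair_site hne)
      (isLocal_bondOp hn hn' (e := 1) he ((diagU Vb Ub)⁻¹ * S n))
      (bondOp_mem_unitary _ _ _) (zipU_mem_unitary (cut S Ub Vb n) Ub Vb J) q₀ q₁ hc0 hc1 ?_ hz
      hs0 hs1 (Or.inr fun η => ?_)
    · rw [bondOp_block hn hn' he]
      obtain ⟨h1, -⟩ := toBlocks_mul (diagU Vb Ub)⁻¹.1 (S n).1
      refine le_trans ?_ hc
      change specNorm ((diagU Vb Ub)⁻¹.1 * (S n).1).toBlocks₁₁ ≤ _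
      rw [h1, hd1.1, hd1.2.2, zero_mul, add_zero]
      exact (specNorm_mul_unitary_le _ _).2
    -- The scalar phase has to be moved past the inverse of the cut matrix to become the leftmost
    -- factor of the bond operator.
    · rw [zipU_of_odd _ _ _ h, cut_rotS, ← hw, ← bondOp_diagU_scalarU hn hn' (e := 1) he,
        bondOp_mul, rotS, Function.update_self, ← mul_assoc, ← mul_assoc, diagU_inv, diagU_mul,
        diagU_mul, scalarU_mul_comm, one_mul, mul_one]

/-- The two sides `J'`, `J''` of the bond `(n, n + 1)` in `J`. -/
structure IsSplit (J J' J'' : Set ℤ) (n : ℤ) : Prop where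
  left_subset : J' ⊆ J
  right_subset : J'' ⊆ J
  disj : ∀ i ∈ J', i ∉ J''
  left_bond : ∀ i ∈ J, i + 1 ∈ J → i ≠ n → (i ∈ J' ↔ i + 1 ∈ J')
  right_bond : ∀ i ∈ J, i + 1 ∈ J → i ≠ n → (i ∈ J'' ↔ i + 1 ∈ J'')
  left_ne : n ∉ J' ∨ n + 1 ∉ J'
  right_ne : n ∉ J'' ∨ n + 1 ∉ J''

theorem IsSplit.res_cut_apply {n : ℤ} (h : IsSplit J J' J'' n) (S : ℤ → U2 L) (Ub Vb : UL L)
    {z : ℂ} (hz : ‖z‖ ≠ 1) (i x : J') (a : 𝔼) :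
    res (zipU (cut S Ub Vb n) Ub Vb J) z (site (Set.inclusion h.left_subset x) a)
      (Set.inclusion h.left_subset i) = gblk S Ub Vb J' z i x a := by
  rw [← restr_apply, restr_res_cut h.left_subset S Ub Vb h.left_bond h.left_ne hz, restr_site]
  simp [gblk, adjoint_site_apply]

theorem IsSplit.res_cut_apply_zero {n : ℤ} (h : IsSplit J J' J'' n) (S : ℤ → U2 L) (Ub Vb : UL L)
    {z : ℂ} (hz : ‖z‖ ≠ 1) (j : J'') {x : J} (hx : (x : ℤ) ∉ J'') (a : 𝔼) :
    res (zipU (cut S Ub Vb n) Ub Vb J) z (site x a) (Set.inclusion h.right_subset j) = 0 := by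
  rw [← restr_apply, restr_res_cut h.right_subset S Ub Vb h.right_bond h.right_ne hz,
    restr_site_of_notMem _ hx, map_zero]
  rfl

theorem zipU_congr {S S' : ℤ → U2 L} (Ub Vb : UL L)
    (h : ∀ i, i ∈ J → i + 1 ∈ J → S i = S' i) : zipU S Ub Vb J = zipU S' Ub Vb J := by
  rw [zipU, zipU, layerU_congr Ub Vb fun i _ => h i, layerU_congr Ub Vb fun i _ => h i]

/-- J' does not contain both ends of the bond n, so S n never enters the zipper on J'. -/
theorem IsSplit.gblk_rotS {n : ℤ} (h : IsSplit J J' J'' n) (S : ℤ → U2 L) (Ub Vb : UL L) (z : ℂ)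
    (w : Circle) (k l : J') : gblk (rotS S n w) Ub Vb J' z k l = gblk S Ub Vb J' z k l := by
  rw [gblk, gblk, zipU_congr (S' := S) Ub Vb fun i hi hi' => ?_]
  have : i ≠ n := by rintro rfl; have := h.left_ne; tauto
  simp [rotS, this]

/-- Factorization of an off-diagonal block when the system is cut next to one of its two sites:
first for the rows, then for the columns. -/
theorem IsSplit.norm_gblk_le {n : ℤ} (h : IsSplit J J' J'' n) (hn : n ∈ J) (hn' : n + 1 ∈ J)
    (S : ℤ → U2 L) (Ub Vb : UL L) {z : ℂ} (hz : ‖z‖ ≠ 1) {i x : J'} (hx : x ≠ i) {j : J''}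
    (hij : ((i : ℤ) = n ∧ (j : ℤ) = n + 1) ∨ ((i : ℤ) = n + 1 ∧ (j : ℤ) = n)) :
    ‖gblk S Ub Vb J z (Set.inclusion h.left_subset i) (Set.inclusion h.left_subset x)‖ ≤
      (1 + 2 * pairSum (zipU S Ub Vb J) z (site ⟨n, hn⟩) (site ⟨n + 1, hn'⟩)) *
        ‖gblk S Ub Vb J' z i x‖ ∧
    ‖gblk S Ub Vb J z (Set.inclusion h.left_subset x) (Set.inclusion h.left_subset i)‖ ≤
      (1 + 2 * pairSum (zipU S Ub Vb J) z (site ⟨n, hn⟩) (site ⟨n + 1, hn'⟩)) *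
        ‖gblk S Ub Vb J' z x i‖ := by
  obtain ⟨D, hD, hDu, hDT⟩ := zipU_eq_or S Ub Vb hn hn'
  set i' : J := Set.inclusion h.left_subset i with hi'
  set x' : J := Set.inclusion h.left_subset x with hx'
  set j' : J := Set.inclusion h.right_subset j with hj'
  have hiJ : (i' : ℤ) = i := rfl
  have hjJ : (j' : ℤ) = j := rfl
  set N := pairSum (zipU S Ub Vb J) z (site ⟨n, hn⟩) (site ⟨n + 1, hn'⟩) with hN
  have hN0 : 0 ≤ N := pairSum_nonneg _ _ _ _
  obtain ⟨hloc, hsum⟩ : IsLocal (site i') (site j') D ∧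
      pairSum (zipU S Ub Vb J) z (site i') (site j') = N := by
    rcases hij with ⟨h1, h2⟩ | ⟨h1, h2⟩
    · obtain rfl' : i' = ⟨n, hn⟩ := Subtype.ext h1
      obtain rfl'' : j' = ⟨n + 1, hn'⟩ := Subtype.ext h2
      rw [rfl', rfl'']; exact ⟨hD, rfl⟩
    · obtain rfl' : i' = ⟨n + 1, hn'⟩ := Subtype.ext h1
      obtain rfl'' : j' = ⟨n, hn⟩ := Subtype.ext h2
      rw [rfl', rfl'']; exact ⟨hD.symm, pairSum_comm _ _ _ _⟩
  have hTu := zipU_mem_unitary (cut S Ub Vb n) Ub Vb J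
  have hxi : x' ≠ i' := fun h' => hx (Set.inclusion_injective h.left_subset h')
  have hxj : x' ≠ j' := fun h' => h.disj x x.2 (by
    have h2 : (x : ℤ) = j := congrArg Subtype.val h'
    rw [h2]; exact j.2)
  have hij' : i' ≠ j' := fun h' => h.disj i i.2 (by
    have h2 : (i : ℤ) = j := congrArg Subtype.val h'
    rw [h2]; exact j.2)
  have hp := isPair_site (L := L) hij'
  constructor
  · refine ContinuousLinearMap.opNorm_le_bound _ (by positivity) fun a => ?_
    have h1 : ‖((site i')†) (res (zipU S Ub Vb J) z (site x' a))‖ ≤ (1 + 2 * N) *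
        ‖((site i')†) (res (zipU (cut S Ub Vb n) Ub Vb J) z (site x' a))‖ := by
      have h2 : ((site j')†) (res (zipU (cut S Ub Vb n) Ub Vb J) z (site x' a)) = 0 := by
        rw [adjoint_site_apply]
        exact h.res_cut_apply_zero S Ub Vb hz j (h.disj x x.2) a
      rw [← hsum]
      rcases hDT with hDT | hDT
      · rw [hDT]
        refine norm_row_mul_left_le hp hloc hDu hTu hz ?_ ?_ h2
        · rw [adjoint_site_apply, site_apply_ne hxi.symm]
        · rw [adjoint_site_apply, site_apply_ne hxj.symm]
      · rw [hDT]
        exact norm_row_mul_right_le hp hloc hDu hTu hz h2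
    rw [adjoint_site_apply, adjoint_site_apply, h.res_cut_apply S Ub Vb hz i x a] at h1
    rw [mul_assoc]
    simp only [gblk, ContinuousLinearMap.comp_apply, adjoint_site_apply]
    refine h1.trans ?_
    gcongr
    exact ContinuousLinearMap.le_opNorm _ _
  · refine ContinuousLinearMap.opNorm_le_bound _ (by positivity) fun a => ?_
    have h3 : (site x')† ∘L res (zipU (cut S Ub Vb n) Ub Vb J) z ∘L site i' =
        gblk S Ub Vb J' z x i := by
      ext1 b
      rw [ContinuousLinearMap.comp_apply, ContinuousLinearMap.comp_apply, adjoint_site_apply]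
      exact h.res_cut_apply S Ub Vb hz x i b
    have h2 : ∀ b, ((site x')†) (res (zipU (cut S Ub Vb n) Ub Vb J) z (site j' b)) = 0 :=
        fun b => by
      rw [adjoint_site_apply]
      -- The vanishing statement with the two sides interchanged: a source on the side of j has no
      -- effect on the side of x.
      refine IsSplit.res_cut_apply_zero (J' := J'') (J'' := J') ⟨h.right_subset, h.left_subset,
        fun i hi hi' => h.disj i hi' hi, h.right_bond, h.left_bond, h.right_ne, h.left_ne⟩
        S Ub Vb hz x (fun h' => h.disj _ h' j.2) b
    have h1 : ‖((site x')†) (res (zipU S Ub Vb J) z (site i' a))‖ ≤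
        ‖gblk S Ub Vb J' z x i‖ * ((1 + 2 * N) * ‖a‖) := by
      rw [← hsum, ← h3]
      rcases hDT with hDT | hDT
      · rw [hDT]
        exact norm_col_mul_left_le hp hloc hDu hTu hz h2 a
      · rw [hDT]
        refine norm_col_mul_right_le hp hloc hDu hTu hz (fun b => ?_) (fun b => ?_) h2 a
        · rw [adjoint_site_apply, site_apply_ne hxi]
        · rw [adjoint_site_apply, site_apply_ne hxj]
    simp only [gblk, ContinuousLinearMap.comp_apply] at h1 ⊢
    refine h1.trans (le_of_eq ?_)
    ring

/-- The averaged decoupling inequality. -/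
theorem IsSplit.lintegral_gblk_le {n : ℤ} (h : IsSplit J J' J'' n) (hn : n ∈ J) (hn' : n + 1 ∈ J)
    (S : ℤ → U2 L) (Ub Vb : UL L) {z : ℂ} (hz : ‖z‖ ≠ 1) {i x : J'} (hx : x ≠ i) {j : J''}
    (hij : ((i : ℤ) = n ∧ (j : ℤ) = n + 1) ∨ ((i : ℤ) = n + 1 ∧ (j : ℤ) = n))
    {c : ℝ} (hc1 : c < 1) (hc : specNorm (S n).1.toBlocks₁₁ ≤ c) {s : ℝ} (hs0 : 0 < s)
    (hs1 : s < 1) :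
    ∫⁻ η in Set.Ioc 0 (2 * Real.pi), ‖gblk (rotS S n (Circle.exp η)) Ub Vb J z
      (Set.inclusion h.left_subset i) (Set.inclusion h.left_subset x)‖ₑ ^ s ≤
      avgConst L s c * ‖gblk S Ub Vb J' z i x‖ₑ ^ s ∧
    ∫⁻ η in Set.Ioc 0 (2 * Real.pi), ‖gblk (rotS S n (Circle.exp η)) Ub Vb J z
      (Set.inclusion h.left_subset x) (Set.inclusion h.left_subset i)‖ₑ ^ s ≤
      avgConst L s c * ‖gblk S Ub Vb J' z x i‖ₑ ^ s := by
  have hpow : ∀ {A B : 𝔼 →L[ℂ] 𝔼} {t : ℝ}, 0 ≤ t → ‖A‖ ≤ t * ‖B‖ →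
      ‖A‖ₑ ^ s ≤ ENNReal.ofReal t ^ s * ‖B‖ₑ ^ s := fun {A B t} ht hAB => by
    rw [← ENNReal.mul_rpow_of_nonneg _ _ hs0.le]
    refine ENNReal.rpow_le_rpow ?_ hs0.le
    rw [← ofReal_norm, ← ofReal_norm, ← ENNReal.ofReal_mul ht]
    exact ENNReal.ofReal_le_ofReal hAB
  have hfin : ∀ B : 𝔼 →L[ℂ] 𝔼, ‖B‖ₑ ^ s ≠ ∞ := fun B =>
    ENNReal.rpow_ne_top_of_nonneg hs0.le (by rw [← ofReal_norm]; exact ENNReal.ofReal_ne_top)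
  have hN := lintegral_pairSum_zipU_le S Ub Vb hn hn' hc1 hc hz hs0 hs1
  have h1 := fun η : ℝ => h.norm_gblk_le hn hn' (rotS S n (Circle.exp η)) Ub Vb hz hx hij
  -- The block of the cut system is now independent of η, so the η-integral falls on the factor 1 +
  -- 2P alone.
  simp only [h.gblk_rotS] at h1
  have hpos : ∀ η : ℝ, 0 ≤ 1 + 2 * pairSum (zipU (rotS S n (Circle.exp η)) Ub Vb J) z
      (site ⟨n, hn⟩) (site ⟨n + 1, hn'⟩) := fun η => by
    have := pairSum_nonneg (zipU (rotS S n (Circle.exp η)) Ub Vb J) z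
      (site ⟨n, hn⟩) (site ⟨n + 1, hn'⟩)
    positivity
  constructor
  · refine (lintegral_mono fun η => hpow (hpos η) (h1 η).1).trans ?_
    rw [lintegral_mul_const' _ _ (hfin _)]
    gcongr
  · refine (lintegral_mono fun η => hpow (hpos η) (h1 η).2).trans ?_
    rw [lintegral_mul_const' _ _ (hfin _)]
    gcongr

end Bond

/-! ### Unitarity of the scattering matrices -/

section Scattering

open scoped ComplexOrder

variable {L : ℕ}

theorem specNorm_conjTranspose (α : Matrix (Fin L) (Fin L) ℂ) : specNorm αᴴ = specNorm α := by
  unfold specNorm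
  rw [← star_eq_conjTranspose, map_star, norm_star]

theorem one_sub_conjTranspose_mul_self_nonneg {α : Matrix (Fin L) (Fin L) ℂ}
    (hα : specNorm α < 1) : 0 ≤ 1 - αᴴ * α := by
  rw [Matrix.nonneg_iff_posSemidef]
  refine PosSemidef.of_dotProduct_mulVec_nonneg ?_ fun x => ?_
  · simp [IsHermitian, conjTranspose_mul]
  · have h1 := toEuclideanCLM_le hα.le (WithLp.toLp 2 x)
    rw [one_mul, toEuclideanCLM_toLp] at h1
    have h2 : ‖WithLp.toLp 2 (α *ᵥ x)‖ ^ 2 ≤ ‖WithLp.toLp 2 x‖ ^ 2 := by gcongr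
    have h3 : ∀ y : Fin L → ℂ, star y ⬝ᵥ y = ((‖WithLp.toLp 2 y‖ ^ 2 : ℝ) : ℂ) := fun y => by
      rw [EuclideanSpace.norm_sq_eq]
      simp [dotProduct, Complex.conj_mul', ← Complex.ofReal_pow]
    rw [sub_mulVec, one_mulVec, dotProduct_sub, ← mulVec_mulVec, dotProduct_mulVec,
      ← star_mulVec, h3, h3, ← Complex.ofReal_sub]
    exact_mod_cast sub_nonneg.mpr h2

/-- For the intertwining ρα = αρ̃, let X be the off-diagonal block matrix with entries α and α*.
Then diag(ρ, ρ̃) is the positive square root of 1 - X² and so commutes with X; the upper right block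
of this commutation is the claim. -/
theorem rho_facts {α : Matrix (Fin L) (Fin L) ℂ} (hα : specNorm α < 1) :
    rho α * rho α = 1 - α * αᴴ ∧ rhoTilde α * rhoTilde α = 1 - αᴴ * α ∧
    (rho α)ᴴ = rho α ∧ (rhoTilde α)ᴴ = rhoTilde α ∧ rho α * α = α * rhoTilde α := by
  have h1 := one_sub_conjTranspose_mul_self_nonneg hα
  have h2 : 0 ≤ 1 - α * αᴴ := by
    have := one_sub_conjTranspose_mul_self_nonneg (α := αᴴ) (by rwa [specNorm_conjTranspose])
    rwa [conjTranspose_conjTranspose] at this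
  have hr : rho α * rho α = 1 - α * αᴴ := CFC.sqrt_mul_sqrt_self _ h2
  have hr' : rhoTilde α * rhoTilde α = 1 - αᴴ * α := CFC.sqrt_mul_sqrt_self _ h1
  have p1 : 0 ≤ rho α := CFC.sqrt_nonneg _
  have p2 : 0 ≤ rhoTilde α := CFC.sqrt_nonneg _
  have hsa : ∀ A : Matrix (Fin L) (Fin L) ℂ, 0 ≤ A → Aᴴ = A := fun A hA =>
    (Matrix.nonneg_iff_posSemidef.mp hA).1
  refine ⟨hr, hr', hsa _ p1, hsa _ p2, ?_⟩
  set X := fromBlocks 0 α αᴴ 0 with hX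
  set R := fromBlocks (rho α) 0 0 (rhoTilde α) with hR
  have hR0 : 0 ≤ R := by
    set B := fromBlocks (CFC.sqrt (rho α)) 0 0 (CFC.sqrt (rhoTilde α))
    have hB : R = Bᴴ * B := by
      rw [fromBlocks_conjTranspose, fromBlocks_multiply, hsa _ (CFC.sqrt_nonneg _),
        hsa _ (CFC.sqrt_nonneg _)]
      simp [CFC.sqrt_mul_sqrt_self _ p1, CFC.sqrt_mul_sqrt_self _ p2, hR]
    rw [hB, Matrix.nonneg_iff_posSemidef]
    exact posSemidef_conjTranspose_mul_self B
  have hRR : R * R = 1 - X * X := by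
    rw [hR, hX, fromBlocks_multiply, fromBlocks_multiply, ← fromBlocks_one,
      sub_eq_add_neg, fromBlocks_neg, fromBlocks_add]
    simp [hr, hr', sub_eq_add_neg]
  have hsq : CFC.sqrt (1 - X * X) = R := CFC.sqrt_unique hRR hR0
  have hcomm : Commute (1 - X * X) X := by
    refine Commute.sub_left (Commute.one_left X) ?_
    exact (Commute.refl X).mul_left (Commute.refl X)
  have hc2 : Commute R X := by
    rw [← hsq]
    exact hcomm.cfcₙ_nnreal _
  have h3 : R * X = X * R := hc2
  rw [hR, hX, fromBlocks_multiply, fromBlocks_multiply] at h3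
  have h4 := congrArg toBlocks₁₂ h3
  simpa using h4

theorem scat_mem_unitary {α : Matrix (Fin L) (Fin L) ℂ} (hα : specNorm α < 1) (U V : UL L) :
    scat α U V ∈ Matrix.unitaryGroup (Fin L ⊕ Fin L) ℂ := by
  obtain ⟨h1, h2, h3, h4, h5⟩ := rho_facts hα
  have h6 : αᴴ * rho α = rhoTilde α * αᴴ := by
    have := congrArg conjTranspose h5
    rwa [conjTranspose_mul, conjTranspose_mul, h3, h4] at this
  have hS0 : fromBlocks α (rho α) (rhoTilde α) (-αᴴ) ∈
      Matrix.unitaryGroup (Fin L ⊕ Fin L) ℂ := by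
    rw [mem_unitaryGroup_iff, star_eq_conjTranspose, fromBlocks_conjTranspose,
      fromBlocks_multiply, ← fromBlocks_one]
    congr 1
    · rw [h3, h1]; abel
    · rw [h4, conjTranspose_neg, conjTranspose_conjTranspose, mul_neg, h5]; abel
    · rw [h3, neg_mul, h6]; abel
    · rw [h4, h2]; simp
  -- The phases are pulled out on both sides, leaving the phase-free matrix, whose unitarity uses
  -- only the relations for ρ and ρ̃.
  have h7 : scat α U V = (diagU 1 V).1 * fromBlocks α (rho α) (rhoTilde α) (-αᴴ) *
      (diagU 1 U).1 := by
    simp [scat, diagU, fromBlocks_multiply]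
  rw [h7]
  exact mul_mem (mul_mem (diagU 1 V).2 hS0) (diagU 1 U).2

/-- The random scattering matrices as unitary matrices. -/
noncomputable def randomScatU {α : Matrix (Fin L) (Fin L) ℂ} (hα : specNorm α < 1) (ω : Sample L) (n : ℤ) :
    U2 L := ⟨randomScat α ω n, scat_mem_unitary hα _ _⟩

theorem green_eq_gblk {α : Matrix (Fin L) (Fin L) ℂ} (hα : specNorm α < 1) (Ub Vb : UL L)
    (ω : Sample L) (J : Set ℤ) (z : ℂ) (k l : J) :
    toEuclideanCLM (n := Fin L) (𝕜 := ℂ) (green α Ub Vb ω J z k l) =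
      gblk (randomScatU hα ω) Ub Vb J z k l := by
  have hz : zipper α Ub Vb ω J = zipU (randomScatU hα ω) Ub Vb J := rfl
  set A := gblk (randomScatU hα ω) Ub Vb J z k l with hA
  obtain ⟨M, hM⟩ : ∃ M, toEuclideanCLM (n := Fin L) (𝕜 := ℂ) M = A :=
    (toEuclideanCLM (n := Fin L) (𝕜 := ℂ)).surjective A
  rw [← hM]
  refine congrArg _ (Matrix.ext fun p q => ?_)
  have h1 : A (EuclideanSpace.single q 1) p = M p q := by
    rw [← hM]
    rw [ofLp_toEuclideanCLM]
    simp
  rw [← h1, hA, gblk, ContinuousLinearMap.comp_apply, ContinuousLinearMap.comp_apply,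
    adjoint_site_apply]
  rfl

end Scattering

/-! ### Continuity of the Green function in the disorder, hence measurability -/

section Continuity

variable {L : ℕ} {X : Type*} [TopologicalSpace X]

open Filter Topology

theorem continuous_toEuclideanCLM_apply {M : X → Matrix (Fin L) (Fin L) ℂ} (hM : Continuous M)
    (v : EuclideanSpace ℂ (Fin L)) :
    Continuous fun x => toEuclideanCLM (n := Fin L) (𝕜 := ℂ) (M x) v :=
  (PiLp.continuous_toLp 2 _).comp (hM.matrix_mulVec continuous_const)

theorem continuous_layerU_apply_apply {S : X → ℤ → U2 L} (hS : ∀ n, Continuous fun x => S x n)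
    (Ub Vb : UL L) {J : Set ℤ} (e : ℤ) (v : Ell2 J L) (i : J) :
    Continuous fun x => layerU (S x) Ub Vb J e v i := by
  have hc : ∀ n, Continuous fun x => (S x n).1 := fun n => continuous_subtype_val.comp (hS n)
  have h11 : ∀ n, Continuous fun x => (S x n).1.toBlocks₁₁ := fun n => (hc n).matrix_submatrix _ _
  have h12 : ∀ n, Continuous fun x => (S x n).1.toBlocks₁₂ := fun n => (hc n).matrix_submatrix _ _
  have h21 : ∀ n, Continuous fun x => (S x n).1.toBlocks₂₁ := fun n => (hc n).matrix_submatrix _ _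
  have h22 : ∀ n, Continuous fun x => (S x n).1.toBlocks₂₂ := fun n => (hc n).matrix_submatrix _ _
  simp only [layerU_apply, layerFun]
  split_ifs
  · exact (continuous_toEuclideanCLM_apply (h11 _) _).add (continuous_toEuclideanCLM_apply (h12 _) _)
  · exact continuous_const
  · exact (continuous_toEuclideanCLM_apply (h21 _) _).add (continuous_toEuclideanCLM_apply (h22 _) _)
  · exact continuous_const

/-- Only strong continuity can hold: in the product topology infinitely many matrices vary without
uniform control. Energy conservation on each pair supplies the dominating function 4(‖v_i‖² +
‖v_{σi}‖²), with σi the partner of i. -/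
theorem continuous_layerU_apply {S : X → ℤ → U2 L} (hS : ∀ n, Continuous fun x => S x n)
    (Ub Vb : UL L) {J : Set ℤ} (e : ℤ) (v : Ell2 J L) :
    Continuous fun x => layerU (S x) Ub Vb J e v := by
  refine continuous_iff_continuousAt.mpr fun x₀ => ?_
  rw [ContinuousAt, tendsto_iff_norm_sub_tendsto_zero]
  have hsq : Tendsto (fun x => ‖layerU (S x) Ub Vb J e v - layerU (S x₀) Ub Vb J e v‖ ^ 2)
      (𝓝 x₀) (𝓝 0) := by
    have hv := (norm_sq_ell2 v).2
    have hv' : Summable fun i => ‖v (partner J e i)‖ ^ 2 :=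
      ((partner_involutive J e).toPerm.summable_iff (f := fun i => ‖v i‖ ^ 2)).mpr hv
    have h0 : (0 : ℝ) = ∑' _i : J, (0 : ℝ) := by simp
    simp_rw [(norm_sq_ell2 _).1]
    rw [h0]
    refine tendsto_tsum_of_dominated_convergence
      (bound := fun i => 4 * (‖v i‖ ^ 2 + ‖v (partner J e i)‖ ^ 2)) ((hv.add hv').mul_left 4)
      (fun i => ?_) (Eventually.of_forall fun x i => ?_)
    · have h1 := (continuous_layerU_apply_apply hS Ub Vb e v i).tendsto x₀
      have h2 := ((h1.sub_const (layerU (S x₀) Ub Vb J e v i)).norm).pow 2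
      simpa using h2
    · rw [lp.coeFn_sub, Pi.sub_apply, Real.norm_of_nonneg (by positivity)]
      have h1 := norm_sq_layerU_add_partner (S x) Ub Vb J e v i
      have h2 := norm_sq_layerU_add_partner (S x₀) Ub Vb J e v i
      have h3 := norm_sub_le (layerU (S x) Ub Vb J e v i) (layerU (S x₀) Ub Vb J e v i)
      have h4 : ‖layerU (S x) Ub Vb J e v i - layerU (S x₀) Ub Vb J e v i‖ ^ 2 ≤
          (‖layerU (S x) Ub Vb J e v i‖ + ‖layerU (S x₀) Ub Vb J e v i‖) ^ 2 := by gcongr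
      nlinarith [sq_nonneg (‖layerU (S x) Ub Vb J e v i‖ - ‖layerU (S x₀) Ub Vb J e v i‖),
        sq_nonneg ‖layerU (S x) Ub Vb J e v (partner J e i)‖,
        sq_nonneg ‖layerU (S x₀) Ub Vb J e v (partner J e i)‖]
  have := hsq.sqrt
  simpa using this

theorem continuous_zipU_apply {S : X → ℤ → U2 L} (hS : ∀ n, Continuous fun x => S x n)
    (Ub Vb : UL L) {J : Set ℤ} (v : Ell2 J L) : Continuous fun x => zipU (S x) Ub Vb J v := by
  refine continuous_iff_continuousAt.mpr fun x₀ => ?_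
  set u := fun x => layerU (S x) Ub Vb J 1 v
  have h1 := (continuous_layerU_apply hS Ub Vb 1 v).tendsto x₀
  have h2 := (continuous_layerU_apply hS Ub Vb 0 (u x₀)).tendsto x₀
  rw [tendsto_iff_norm_sub_tendsto_zero] at h1 h2
  rw [ContinuousAt, tendsto_iff_norm_sub_tendsto_zero]
  refine squeeze_zero (fun _ => norm_nonneg _) (fun x => ?_) (by simpa using h1.add h2)
  have h3 : zipU (S x) Ub Vb J v - zipU (S x₀) Ub Vb J v =
      layerU (S x) Ub Vb J 0 (u x - u x₀) +
      (layerU (S x) Ub Vb J 0 (u x₀) - layerU (S x₀) Ub Vb J 0 (u x₀)) := by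
    simp only [zipU, mul_apply_eq_comp, map_sub, u]; abel
  rw [h3]
  refine (norm_add_le _ _).trans ?_
  rw [norm_layerU_apply]

/-- Second resolvent identity applied to a fixed vector, with `norm_res_apply_le` uniform in x. -/
theorem continuous_res_zipU_apply {S : X → ℤ → U2 L} (hS : ∀ n, Continuous fun x => S x n)
    (Ub Vb : UL L) {J : Set ℤ} {z : ℂ} (hz : ‖z‖ ≠ 1) (v : Ell2 J L) :
    Continuous fun x => res (zipU (S x) Ub Vb J) z v := by
  refine continuous_iff_continuousAt.mpr fun x₀ => ?_
  set u := res (zipU (S x₀) Ub Vb J) z v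
  have h1 := (continuous_zipU_apply hS Ub Vb u).tendsto x₀
  rw [tendsto_iff_norm_sub_tendsto_zero] at h1
  rw [ContinuousAt, tendsto_iff_norm_sub_tendsto_zero]
  refine squeeze_zero (fun _ => norm_nonneg _) (fun x => ?_)
    (by simpa using h1.const_mul (|‖z‖ - 1|⁻¹))
  have hx := zipU_mem_unitary (S x) Ub Vb J
  have h2 := map_res_apply (zipU_mem_unitary (S x₀) Ub Vb J) hz v
  have h3 := res_map_apply hx hz u
  have h4 : u - res (zipU (S x) Ub Vb J) z v =
      res (zipU (S x) Ub Vb J) z (zipU (S x) Ub Vb J u - zipU (S x₀) Ub Vb J u) := by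
    rw [map_sub, h3, h2, map_add, map_smul]; abel
  rw [norm_sub_rev, h4]
  exact norm_res_apply_le hx hz _

theorem continuous_gblk {S : X → ℤ → U2 L} (hS : ∀ n, Continuous fun x => S x n)
    (Ub Vb : UL L) {J : Set ℤ} {z : ℂ} (hz : ‖z‖ ≠ 1) (k l : J) :
    Continuous fun x => gblk (S x) Ub Vb J z k l := by
  refine continuous_clm_apply.mpr fun a => ?_
  exact ((site k)†).continuous.comp (continuous_res_zipU_apply hS Ub Vb hz (site l a))

theorem norm_gblk_le (S : ℤ → U2 L) (Ub Vb : UL L) {J : Set ℤ} {z : ℂ} (hz : ‖z‖ ≠ 1) (k l : J) :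
    ‖gblk S Ub Vb J z k l‖ ≤ |‖z‖ - 1|⁻¹ := by
  refine ContinuousLinearMap.opNorm_le_bound _ (by positivity) fun a => ?_
  simp only [gblk, ContinuousLinearMap.comp_apply, adjoint_site_apply]
  refine (lp.norm_apply_le_norm (p := 2) (by norm_num) _ k).trans ?_
  refine (norm_res_apply_le (zipU_mem_unitary S Ub Vb J) hz _).trans (le_of_eq ?_)
  rw [site_apply, lp.norm_single (by norm_num)]

theorem continuous_expDiag : Continuous (expDiag (L := L)) := by
  refine Continuous.subtype_mk ?_ _
  refine Continuous.matrix_diagonal ?_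
  fun_prop

theorem continuous_signDiag : Continuous (signDiag (L := L)) := by
  refine Continuous.subtype_mk ?_ _
  refine Continuous.matrix_diagonal (continuous_pi fun j => ?_)
  exact (continuous_of_discreteTopology (f := fun t : ℤ => (t : ℂ))).comp
    (Units.continuous_val.comp (continuous_apply j))

theorem continuous_phaseV : Continuous (phaseV (L := L)) := by
  unfold phaseV
  have h1 := continuous_expDiag (L := L)
  have h2 := continuous_signDiag (L := L)
  fun_prop

theorem continuous_phaseU : Continuous (phaseU (L := L)) := by
  unfold phaseU
  have h1 := continuous_expDiag (L := L)
  have h2 := continuous_signDiag (L := L)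
  fun_prop

theorem continuous_randomScatU {α : Matrix (Fin L) (Fin L) ℂ} (hα : specNorm α < 1) (n : ℤ) :
    Continuous fun ω => randomScatU hα ω n := by
  refine Continuous.subtype_mk ?_ _
  unfold randomScat scat
  have h1 : Continuous fun ω : Sample L => (phaseV (ω n)).1 :=
    continuous_subtype_val.comp (continuous_phaseV.comp (continuous_apply n))
  have h2 : Continuous fun ω : Sample L => (phaseU (ω n)).1 :=
    continuous_subtype_val.comp (continuous_phaseU.comp (continuous_apply n))
  refine Continuous.matrix_fromBlocks continuous_const ?_ ?_ ?_
  · exact continuous_const.matrix_mul h2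
  · exact h1.matrix_mul continuous_const
  · exact ((h1.matrix_mul continuous_const).matrix_mul h2).neg

theorem continuous_rotS {S : X → ℤ → U2 L} (hS : ∀ n, Continuous fun x => S x n) (n m : ℤ) :
    Continuous fun y : ℝ × X => rotS (S y.2) n (Circle.exp y.1) m := by
  unfold rotS
  by_cases h : m = n
  · subst h
    simp only [Function.update_self]
    have h1 : Continuous fun y : ℝ × X => diagU 1 (scalarU L (Circle.exp y.1)) := by
      refine Continuous.subtype_mk ?_ _
      refine Continuous.matrix_fromBlocks continuous_const continuous_const continuous_const ?_
      simp only [scalarU]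
      fun_prop
    exact h1.mul ((hS m).comp continuous_snd)
  · simp only [Function.update_of_ne h]
    exact (hS m).comp continuous_snd

/-- With this and second countability of all factors, the product σ-algebra on the sample space is
the Borel one, so continuous functions of ω are measurable. -/
instance : BorelSpace ℤˣ := by
  have : MeasurableSingletonClass ℤˣ := ⟨fun u => by
    refine ⟨{(u : ℤ)}, measurableSet_singleton _, ?_⟩
    ext t
    simp [Units.ext_iff]⟩
  have : DiscreteMeasurableSpace ℤˣ := inferInstance
  infer_instance

instance : SecondCountableTopology ℤˣ := inferInstance

instance : SecondCountableTopology (Matrix (Fin L) (Fin L) ℂ) :=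
  inferInstanceAs (SecondCountableTopology (Fin L → Fin L → ℂ))

instance : SecondCountableTopology (UL L) := TopologicalSpace.Subtype.secondCountableTopology _

instance : BorelSpace (PhaseData L) := inferInstance

instance : BorelSpace (SiteData L) := inferInstance

instance : BorelSpace (Sample L) := inferInstance

end Continuity

/-! ### Invariance of the law under a phase shift at one site -/

section Rotation

instance : Fact (0 < 2 * Real.pi) := ⟨Real.two_pi_pos⟩

/-- The angle in `(0, 2π]` congruent to `θ + η` modulo `2π`. -/
noncomputable def rotAngle (η : ℝ) (θ : Angle) : Angle :=
  ⟨AddCircle.equivIoc (2 * Real.pi) 0 (((θ : ℝ) : AddCircle (2 * Real.pi)) + (η : ℝ)), by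
    have h := (AddCircle.equivIoc (2 * Real.pi) 0
      (((θ : ℝ) : AddCircle (2 * Real.pi)) + (η : ℝ))).2
    exact ⟨h.1.le, by simpa using h.2⟩⟩

theorem circle_exp_rotAngle (η : ℝ) (θ : Angle) :
    Circle.exp (rotAngle η θ : ℝ) = Circle.exp η * Circle.exp (θ : ℝ) := by
  have h : ((rotAngle η θ : ℝ) : AddCircle (2 * Real.pi)) =
      ((θ : ℝ) : AddCircle (2 * Real.pi)) + ((η : ℝ) : AddCircle (2 * Real.pi)) :=
    (AddCircle.equivIoc (2 * Real.pi) 0).symm_apply_apply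
      (((θ : ℝ) : AddCircle (2 * Real.pi)) + ((η : ℝ) : AddCircle (2 * Real.pi)))
  rw [← Real.Angle.toCircle_coe]
  change Real.Angle.toCircle ((rotAngle η θ : ℝ) : AddCircle (2 * Real.pi)) = _
  rw [h]
  change Real.Angle.toCircle (((θ : ℝ) : Real.Angle) + (η : Real.Angle)) = _
  rw [Real.Angle.toCircle_add, Real.Angle.toCircle_coe, Real.Angle.toCircle_coe, mul_comm]

/-- The uniform law is carried to the circle ℝ/2πℤ, translated there, read back on (0, 2π], and
included in [0, 2π]; the endpoint 0 is a null set. -/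
theorem measurePreserving_rotAngle (η : ℝ) :
    MeasurePreserving (rotAngle η) uniformAngle uniformAngle := by
  have hv : MeasurableEmbedding (Subtype.val : Angle → ℝ) :=
    MeasurableEmbedding.subtype_coe measurableSet_Icc
  have hI : volume.restrict (Set.Ioc (0 : ℝ) (0 + 2 * Real.pi)) =
      volume.restrict (Set.Icc (0 : ℝ) (2 * Real.pi)) := by
    rw [zero_add]; exact restrict_Ioc_eq_restrict_Icc
  have h1 : MeasurePreserving (Subtype.val : Angle → ℝ) (Measure.comap Subtype.val volume)
      (volume.restrict (Set.Ioc (0 : ℝ) (0 + 2 * Real.pi))) := by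
    refine ⟨hv.measurable, ?_⟩
    rw [hv.map_comap, Subtype.range_coe, hI]
  have h2 := (AddCircle.measurePreserving_mk (2 * Real.pi) 0).comp h1
  have h3 := (measurePreserving_add_right (volume : Measure (AddCircle (2 * Real.pi)))
    ((η : ℝ) : AddCircle (2 * Real.pi))).comp h2
  have h4 := (AddCircle.measurePreserving_equivIoc (2 * Real.pi) (a := 0)).comp h3
  have hsub : ∀ x ∈ Set.Ioc (0 : ℝ) (0 + 2 * Real.pi), x ∈ Set.Icc (0 : ℝ) (2 * Real.pi) :=
    fun x hx => ⟨hx.1.le, by simpa using hx.2⟩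
  have hw : MeasurableEmbedding (Subtype.val : Set.Ioc (0 : ℝ) (0 + 2 * Real.pi) → ℝ) :=
    MeasurableEmbedding.subtype_coe measurableSet_Ioc
  have hm : Measurable fun x : Set.Ioc (0 : ℝ) (0 + 2 * Real.pi) => (⟨x, hsub x x.2⟩ : Angle) :=
    hw.measurable.subtype_mk
  have h5 : MeasurePreserving
      (fun x : Set.Ioc (0 : ℝ) (0 + 2 * Real.pi) => (⟨x, hsub x x.2⟩ : Angle))
      (Measure.comap Subtype.val volume) (Measure.comap Subtype.val volume) := by
    refine ⟨hm, ?_⟩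
    rw [← hv.comap_map (Measure.map _ _), Measure.map_map hv.measurable hm]
    change Measure.comap _ (Measure.map Subtype.val _) = _
    rw [hw.map_comap, Subtype.range_coe, hI, ← hv.comap_map (Measure.comap Subtype.val volume),
      hv.map_comap, Subtype.range_coe]
  exact (h5.comp h4).smul_measure _

variable {L : ℕ}

/-- Rotation of the angles `θ` of one site. -/
noncomputable def rotSite (η : ℝ) (x : SiteData L) : SiteData L :=
  ((x.1.1, x.1.2.1, fun j => rotAngle η (x.1.2.2 j)), x.2)

theorem measurePreserving_rotSite (η : ℝ) (p : unitInterval) :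
    MeasurePreserving (rotSite (L := L) η) (siteLaw L p) (siteLaw L p) := by
  have h1 := measurePreserving_pi (fun _ : Fin L => uniformAngle) (fun _ => uniformAngle)
    (fun _ => measurePreserving_rotAngle η)
  exact (((MeasurePreserving.id _).prod ((MeasurePreserving.id _).prod h1)).prod
    (MeasurePreserving.id _))

/-- Rotation of the angles `θ` at the site `n`. -/
noncomputable def rotSample (n : ℤ) (η : ℝ) (ω : Sample L) : Sample L :=
  fun m => if m = n then rotSite η (ω m) else ω m

theorem measurePreserving_rotSample (n : ℤ) (η : ℝ) (p : unitInterval) :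
    MeasurePreserving (rotSample (L := L) n η) (law L p) (law L p) := by
  set f : ℤ → SiteData L → SiteData L := fun m x => if m = n then rotSite η x else x
  have hf : ∀ m, MeasurePreserving (f m) (siteLaw L p) (siteLaw L p) := fun m => by
    by_cases h : m = n
    · simpa only [f, h, if_true] using measurePreserving_rotSite η p
    · simp only [f, h, if_false]
      exact MeasurePreserving.id _
  refine ⟨measurable_pi_lambda _ fun m => (hf m).measurable.comp (measurable_pi_apply m), ?_⟩
  refine (Measure.infinitePi_map_pi (fun _ : ℤ => siteLaw L p) fun m => (hf m).measurable).trans ?_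
  simp only [(hf _).map_eq]
  rfl

theorem expDiag_rotAngle (η : ℝ) (θ : Fin L → Angle) :
    expDiag (fun j => rotAngle η (θ j)) = scalarU L (Circle.exp η) * expDiag θ := by
  apply Subtype.ext
  change diagonal _ = ((Circle.exp η : ℂ) • (1 : Matrix (Fin L) (Fin L) ℂ)) * diagonal _
  rw [smul_mul_assoc, one_mul, ← diagonal_smul]
  congr 1
  funext j
  have h := congrArg (fun w : Circle => (w : ℂ)) (circle_exp_rotAngle η (θ j))
  simpa [Circle.coe_exp, mul_comm] using h

/-- A common shift of all L angles multiplies e^{iθ} by a scalar, which commutes past Ṽ d Ṽ* and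
appears on the left of V, that is, on the whole lower row of S. -/
theorem randomScatU_rotSample {α : Matrix (Fin L) (Fin L) ℂ} (hα : specNorm α < 1) (n : ℤ) (η : ℝ)
    (ω : Sample L) :
    randomScatU hα (rotSample n η ω) = rotS (randomScatU hα ω) n (Circle.exp η) := by
  funext m
  by_cases h : m = n
  · subst h
    have hU : phaseU (rotSample m η ω m) = phaseU (ω m) := by simp [rotSample, rotSite, phaseU]
    have hV : phaseV (rotSample m η ω m) = scalarU L (Circle.exp η) * phaseV (ω m) := by
      simp only [rotSample, rotSite, phaseV, if_true, expDiag_rotAngle]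
      rw [← mul_assoc, ← scalarU_mul_comm, mul_assoc]
    apply Subtype.ext
    simp only [rotS, Function.update_self]
    change scat α _ _ = fromBlocks _ _ _ _ * scat α _ _
    rw [hU, hV, scat, scat, fromBlocks_multiply]
    simp [mul_assoc]
  · apply Subtype.ext
    simp [rotS, h, randomScatU, randomScat, rotSample]

theorem continuous_gblk_randomScatU {α : Matrix (Fin L) (Fin L) ℂ} (hα : specNorm α < 1)
    (Ub Vb : UL L) {J : Set ℤ} {z : ℂ} (hz : ‖z‖ ≠ 1) (k l : J) :
    Continuous fun ω => gblk (randomScatU hα ω) Ub Vb J z k l :=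
  continuous_gblk (continuous_randomScatU hα) Ub Vb hz k l

/-- Averaging over the phase at one site. -/
theorem lintegral_gblk_eq_average {α : Matrix (Fin L) (Fin L) ℂ} (hα : specNorm α < 1)
    (p : unitInterval) (Ub Vb : UL L) {J : Set ℤ} {z : ℂ} (hz : ‖z‖ ≠ 1) (k l : J) (n : ℤ)
    (s : ℝ) :
    ENNReal.ofReal (2 * Real.pi) *
        ∫⁻ ω, ‖gblk (randomScatU hα ω) Ub Vb J z k l‖ₑ ^ s ∂(law L p) =
      ∫⁻ ω, (∫⁻ η in Set.Ioc 0 (2 * Real.pi),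
        ‖gblk (rotS (randomScatU hα ω) n (Circle.exp η)) Ub Vb J z k l‖ₑ ^ s) ∂(law L p) := by
  have hm : Measurable fun ω => ‖gblk (randomScatU hα ω) Ub Vb J z k l‖ₑ ^ s :=
    ((continuous_gblk_randomScatU hα Ub Vb hz k l).enorm.measurable).pow_const s
  have hc : Continuous fun y : ℝ × Sample L =>
      gblk (rotS (randomScatU hα y.2) n (Circle.exp y.1)) Ub Vb J z k l :=
    continuous_gblk (S := fun y : ℝ × Sample L => rotS (randomScatU hα y.2) n (Circle.exp y.1))
      (continuous_rotS (continuous_randomScatU hα) n) Ub Vb hz k l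
  -- By Tonelli the ω-integral comes first; invariance of the law makes it independent of η, and the
  -- η-integral contributes the length 2π.
  rw [← lintegral_lintegral_swap (hc.enorm.measurable.pow_const s).aemeasurable]
  have h1 : ∀ η : ℝ, ∫⁻ ω, ‖gblk (rotS (randomScatU hα ω) n (Circle.exp η)) Ub Vb J z k l‖ₑ ^ s
      ∂(law L p) = ∫⁻ ω, ‖gblk (randomScatU hα ω) Ub Vb J z k l‖ₑ ^ s ∂(law L p) := fun η => by
    rw [← (measurePreserving_rotSample n η p).lintegral_comp hm]
    simp only [randomScatU_rotSample]
  simp only [h1, setLIntegral_const, Real.volume_Ioc, sub_zero]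
  rw [mul_comm]

variable {J J' J'' : Set ℤ}

/-- One cut costs a constant in the mean: the phase average at site n is inserted and estimated for
each fixed ω. The constant depends on the disorder only through ‖α‖, the norm of the upper left
block of every S^{(n)}. -/
theorem IsSplit.lintegral_law_gblk_le {n : ℤ} (h : IsSplit J J' J'' n) (hn : n ∈ J)
    (hn' : n + 1 ∈ J) {α : Matrix (Fin L) (Fin L) ℂ} (hα : specNorm α < 1) (p : unitInterval)
    (Ub Vb : UL L) {z : ℂ} (hz : ‖z‖ ≠ 1) {i x : J'} (hx : x ≠ i) {j : J''}
    (hij : ((i : ℤ) = n ∧ (j : ℤ) = n + 1) ∨ ((i : ℤ) = n + 1 ∧ (j : ℤ) = n))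
    {s : ℝ} (hs0 : 0 < s) (hs1 : s < 1) :
    ENNReal.ofReal (2 * Real.pi) * ∫⁻ ω, ‖gblk (randomScatU hα ω) Ub Vb J z
        (Set.inclusion h.left_subset i) (Set.inclusion h.left_subset x)‖ₑ ^ s ∂(law L p) ≤
      avgConst L s (specNorm α) *
        ∫⁻ ω, ‖gblk (randomScatU hα ω) Ub Vb J' z i x‖ₑ ^ s ∂(law L p) ∧
    ENNReal.ofReal (2 * Real.pi) * ∫⁻ ω, ‖gblk (randomScatU hα ω) Ub Vb J z
        (Set.inclusion h.left_subset x) (Set.inclusion h.left_subset i)‖ₑ ^ s ∂(law L p) ≤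
      avgConst L s (specNorm α) *
        ∫⁻ ω, ‖gblk (randomScatU hα ω) Ub Vb J' z x i‖ₑ ^ s ∂(law L p) := by
  have key := fun ω : Sample L => h.lintegral_gblk_le hn hn' (randomScatU hα ω) Ub Vb hz hx hij hα
    (le_of_eq (by simp [randomScatU, randomScat, scat])) hs0 hs1
  have hc : avgConst L s (specNorm α) ≠ ∞ := avgConst_ne_top L hs0 _
  constructor
  · rw [lintegral_gblk_eq_average hα p Ub Vb hz _ _ n, ← lintegral_const_mul' _ _ hc]
    exact lintegral_mono fun ω => (key ω).1
  · rw [lintegral_gblk_eq_average hα p Ub Vb hz _ _ n, ← lintegral_const_mul' _ _ hc]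
    exact lintegral_mono fun ω => (key ω).2

end Rotation

/-! ### From the interval to the box by two successive cuts -/

section Decoupling

variable {L : ℕ}

theorem isSplit_right {J : Set ℤ} (n : ℤ) :
    IsSplit J {i | i ∈ J ∧ n + 1 ≤ i} {i | i ∈ J ∧ i ≤ n} n where
  left_subset := fun _ h => h.1
  right_subset := fun _ h => h.1
  disj := fun i h h' => by have := h.2; have := h'.2; omega
  left_bond := fun i hi hi' hn =>
    ⟨fun h => ⟨hi', by have := h.2; omega⟩, fun h => ⟨hi, by have := h.2; omega⟩⟩
  right_bond := fun i hi hi' hn =>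
    ⟨fun h => ⟨hi', by have := h.2; omega⟩, fun h => ⟨hi, by have := h.2; omega⟩⟩
  left_ne := Or.inl fun h => by have := h.2; omega
  right_ne := Or.inr fun h => by have := h.2; omega

theorem isSplit_left {J : Set ℤ} (n : ℤ) :
    IsSplit J {i | i ∈ J ∧ i ≤ n} {i | i ∈ J ∧ n + 1 ≤ i} n where
  left_subset := fun _ h => h.1
  right_subset := fun _ h => h.1
  disj := fun i h h' => by have := h.2; have := h'.2; omega
  left_bond := fun i hi hi' hn =>
    ⟨fun h => ⟨hi', by have := h.2; omega⟩, fun h => ⟨hi, by have := h.2; omega⟩⟩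
  right_bond := fun i hi hi' hn =>
    ⟨fun h => ⟨hi', by have := h.2; omega⟩, fun h => ⟨hi, by have := h.2; omega⟩⟩
  left_ne := Or.inr fun h => by have := h.2; omega
  right_ne := Or.inl fun h => by have := h.2; omega

/-- The strict inequalities ensure that the neighbours of k lie in the interval, so the bonds to be
cut exist. -/
theorem mem_interval_of_lt {a : WithBot ℤ} {b : WithTop ℤ} {k : ℤ} (hak : a < (k : WithBot ℤ))
    (hkb : (k : WithTop ℤ) < b) :
    k - 1 ∈ interval a b ∧ k ∈ interval a b ∧ k + 1 ∈ interval a b := by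
  have h0 : k ∈ interval a b := ⟨hak.le, hkb.le⟩
  have h1 : a ≤ ((k - 1 : ℤ) : WithBot ℤ) := by
    induction a with
    | bot => exact bot_le
    | coe a => have := WithBot.coe_lt_coe.mp hak; exact WithBot.coe_le_coe.mpr (by omega)
  have h2 : ((k + 1 : ℤ) : WithTop ℤ) ≤ b := by
    induction b with
    | top => exact le_top
    | coe b => have := WithTop.coe_lt_coe.mp hkb; exact WithTop.coe_le_coe.mpr (by omega)
  refine ⟨⟨h1, (WithTop.coe_le_coe.mpr (by omega)).trans hkb.le⟩, h0,
    ⟨hak.le.trans (WithBot.coe_le_coe.mpr (by omega)), h2⟩⟩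

theorem mem_interval_of_mem {a : WithBot ℤ} {b : WithTop ℤ} {k l i : ℤ} (hk : k ∈ interval a b)
    (hl : l ∈ interval a b) (h1 : k ≤ i) (h2 : i ≤ l) : i ∈ interval a b :=
  ⟨hk.1.trans (WithBot.coe_le_coe.mpr h1), (WithTop.coe_le_coe.mpr h2).trans hl.2⟩

/-- Comparison of the Green functions on an interval and on the box spanned by `k` and `l`. -/
theorem lintegral_gblk_interval_le {α : Matrix (Fin L) (Fin L) ℂ} (hα : specNorm α < 1)
    (p : unitInterval) (Ub Vb : UL L) {z : ℂ} (hz : ‖z‖ ≠ 1) {a : WithBot ℤ} {b : WithTop ℤ}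
    {k l : ℤ} (hak : a < (k : WithBot ℤ)) (hkb : (k : WithTop ℤ) < b)
    (hal : a < (l : WithBot ℤ)) (hlb : (l : WithTop ℤ) < b) (hkl : k ≠ l)
    {s : ℝ} (hs0 : 0 < s) (hs1 : s < 1) :
    ENNReal.ofReal (2 * Real.pi) * (ENNReal.ofReal (2 * Real.pi) *
      ∫⁻ ω, ‖gblk (randomScatU hα ω) Ub Vb (interval a b) z
        ⟨k, hak.le, hkb.le⟩ ⟨l, hal.le, hlb.le⟩‖ₑ ^ s ∂(law L p)) ≤
      avgConst L s (specNorm α) * (avgConst L s (specNorm α) *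
        ∫⁻ ω, ‖gblk (randomScatU hα ω) Ub Vb (Set.uIcc k l) z
          ⟨k, Set.left_mem_uIcc⟩ ⟨l, Set.right_mem_uIcc⟩‖ₑ ^ s ∂(law L p)) := by
  obtain ⟨hk1, hk0, hk2⟩ := mem_interval_of_lt hak hkb
  obtain ⟨hl1, hl0, hl2⟩ := mem_interval_of_lt hal hlb
  set J := interval a b
  -- The final set is kept as a variable equal to the box, because the sites k and l are elements of
  -- types that depend on it; the equation is eliminated by substitution.
  suffices H : ∃ (J₁ J₂ : Set ℤ) (h1k : k ∈ J₁) (h1l : l ∈ J₁) (h2k : k ∈ J₂) (h2l : l ∈ J₂),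
      J₂ = Set.uIcc k l ∧
      ENNReal.ofReal (2 * Real.pi) * ∫⁻ ω, ‖gblk (randomScatU hα ω) Ub Vb J z
        ⟨k, hak.le, hkb.le⟩ ⟨l, hal.le, hlb.le⟩‖ₑ ^ s ∂(law L p) ≤
      avgConst L s (specNorm α) *
        ∫⁻ ω, ‖gblk (randomScatU hα ω) Ub Vb J₁ z ⟨k, h1k⟩ ⟨l, h1l⟩‖ₑ ^ s ∂(law L p) ∧
      ENNReal.ofReal (2 * Real.pi) *
        ∫⁻ ω, ‖gblk (randomScatU hα ω) Ub Vb J₁ z ⟨k, h1k⟩ ⟨l, h1l⟩‖ₑ ^ s ∂(law L p) ≤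
      avgConst L s (specNorm α) *
        ∫⁻ ω, ‖gblk (randomScatU hα ω) Ub Vb J₂ z ⟨k, h2k⟩ ⟨l, h2l⟩‖ₑ ^ s ∂(law L p) by
    obtain ⟨J₁, J₂, h1k, h1l, h2k, h2l, rfl, e1, e2⟩ := H
    refine (mul_le_mul_right e1 _).trans ?_
    rw [mul_left_comm]
    exact mul_le_mul_right e2 _
  rcases lt_or_gt_of_ne hkl with h | h
  -- For k < l the bond (k - 1, k) is cut first, a row estimate, and then (l, l + 1), a column
  -- estimate.
  · have s1 := isSplit_right (J := J) (k - 1)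
    have s2 := isSplit_left (J := {i | i ∈ J ∧ k - 1 + 1 ≤ i}) l
    refine ⟨{i | i ∈ J ∧ k - 1 + 1 ≤ i}, {i | i ∈ {i | i ∈ J ∧ k - 1 + 1 ≤ i} ∧ i ≤ l},
      ⟨hk0, by omega⟩, ⟨hl0, by omega⟩, ⟨⟨hk0, by omega⟩, by omega⟩,
      ⟨⟨hl0, by omega⟩, by omega⟩, ?_,
      (s1.lintegral_law_gblk_le hk1 (by simpa using hk0) hα p Ub Vb hz
        (i := ⟨k, hk0, by omega⟩) (x := ⟨l, hl0, by omega⟩) (by simpa using hkl.symm)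
        (j := ⟨k - 1, hk1, le_rfl⟩) (Or.inr ⟨by simp, rfl⟩) hs0 hs1).1,
      (s2.lintegral_law_gblk_le ⟨hl0, by omega⟩ ⟨hl2, by omega⟩ hα p Ub Vb hz
        (i := ⟨l, ⟨hl0, by omega⟩, by omega⟩) (x := ⟨k, ⟨hk0, by omega⟩, by omega⟩)
        (by simpa using hkl)
        (j := ⟨l + 1, ⟨hl2, by omega⟩, le_rfl⟩) (Or.inl ⟨rfl, rfl⟩) hs0 hs1).2⟩
    rw [Set.uIcc_of_le h.le]
    ext i
    exact ⟨fun hi => ⟨by have := hi.1.2; omega, hi.2⟩,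
      fun hi => ⟨⟨mem_interval_of_mem hk0 hl0 hi.1 hi.2, by have := hi.1; omega⟩, hi.2⟩⟩
  -- For l < k the picture is mirrored: the bond (k, k + 1) is cut first, then (l - 1, l).
  · have s1 := isSplit_left (J := J) k
    have s2 := isSplit_right (J := {i | i ∈ J ∧ i ≤ k}) (l - 1)
    refine ⟨{i | i ∈ J ∧ i ≤ k}, {i | i ∈ {i | i ∈ J ∧ i ≤ k} ∧ l - 1 + 1 ≤ i},
      ⟨hk0, by omega⟩, ⟨hl0, by omega⟩, ⟨⟨hk0, by omega⟩, by omega⟩,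
      ⟨⟨hl0, by omega⟩, by omega⟩, ?_,
      (s1.lintegral_law_gblk_le hk0 hk2 hα p Ub Vb hz
        (i := ⟨k, hk0, by omega⟩) (x := ⟨l, hl0, by omega⟩) (by simpa using hkl.symm)
        (j := ⟨k + 1, hk2, le_rfl⟩) (Or.inl ⟨rfl, rfl⟩) hs0 hs1).1,
      (s2.lintegral_law_gblk_le ⟨hl1, by omega⟩ ⟨by simpa using hl0, by omega⟩ hα p Ub Vb hz
        (i := ⟨l, ⟨hl0, by omega⟩, by omega⟩) (x := ⟨k, ⟨hk0, by omega⟩, by omega⟩)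
        (by simpa using hkl)
        (j := ⟨l - 1, ⟨hl1, by omega⟩, le_rfl⟩) (Or.inr ⟨by simp, rfl⟩) hs0 hs1).2⟩
    rw [Set.uIcc_of_ge h.le]
    ext i
    exact ⟨fun hi => ⟨by have := hi.2; omega, hi.1.2⟩,
      fun hi => ⟨⟨mem_interval_of_mem hl0 hk0 hi.1 hi.2, hi.2⟩, by have := hi.1; omega⟩⟩

end Decoupling

/-! ### Comparison of the subordinate norm with the spectral norm -/

section SubordinateNorm

variable {L : ℕ} {N : Seminorm ℂ (Fin L → ℂ)}

theorem exists_seminorm_le_norm (N : Seminorm ℂ (Fin L → ℂ)) :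
    ∃ C : ℝ, 0 < C ∧ ∀ v, N v ≤ C * ‖WithLp.toLp 2 v‖ := by
  refine ⟨∑ i, N (Pi.single i 1) + 1, ?_, fun v => ?_⟩
  · have : 0 ≤ ∑ i, N (Pi.single i 1) := Finset.sum_nonneg fun i _ => apply_nonneg N _
    linarith
  · have hv : v = ∑ i, v i • (Pi.single i 1 : Fin L → ℂ) := by
      conv_lhs => rw [pi_eq_sum_univ' v]
    have h1 : N v ≤ ∑ i, ‖v i‖ * N (Pi.single i 1) := by
      conv_lhs => rw [hv]
      refine (Finset.le_sum_of_subadditive N (map_zero N).le (map_add_le_add N) _ _).trans (Finset.sum_le_sum fun i _ => ?_)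
      rw [map_smul_eq_mul]
    refine h1.trans ?_
    rw [add_mul, one_mul, Finset.sum_mul]
    refine (Finset.sum_le_sum fun i _ => ?_).trans (le_add_of_nonneg_right (norm_nonneg _))
    rw [mul_comm]
    exact mul_le_mul_of_nonneg_left (PiLp.norm_apply_le (WithLp.toLp 2 v) i) (apply_nonneg N _)

theorem continuous_seminorm (N : Seminorm ℂ (Fin L → ℂ)) : Continuous N := by
  obtain ⟨C, hC, h⟩ := exists_seminorm_le_norm N
  refine Seminorm.continuous_of_continuousAt_zero ?_
  rw [ContinuousAt, map_zero]
  refine squeeze_zero (fun v => apply_nonneg N v) h ?_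
  have h1 : Continuous fun v : Fin L → ℂ => C * ‖WithLp.toLp 2 v‖ := by fun_prop
  have h2 := h1.tendsto 0
  simpa using h2

theorem exists_norm_le_seminorm (hN : ∀ v, N v = 0 → v = 0) :
    ∃ C : ℝ, 0 < C ∧ ∀ v, ‖WithLp.toLp 2 v‖ ≤ C * N v := by
  have hc : Continuous fun x : EuclideanSpace ℂ (Fin L) => N x.ofLp :=
    (continuous_seminorm N).comp (by fun_prop)
  by_cases hne : (Metric.sphere (0 : EuclideanSpace ℂ (Fin L)) 1).Nonempty
  · obtain ⟨x, hx, hmin⟩ := (isCompact_sphere _ _).exists_isMinOn hne hc.continuousOn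
    have hx0 : 0 < N x.ofLp := by
      refine lt_of_le_of_ne (apply_nonneg N _) fun h => ?_
      have h0 : x = 0 := by
        have := hN _ h.symm
        exact WithLp.ofLp_injective 2 (by simpa using this)
      simp [h0] at hx
    refine ⟨(N x.ofLp)⁻¹, inv_pos.mpr hx0, fun v => ?_⟩
    rcases eq_or_ne v 0 with rfl | hv
    · simp
    have hv' : 0 < ‖WithLp.toLp 2 v‖ := by
      rw [norm_pos_iff]
      exact fun h => hv (by simpa using h)
    have h1 := hmin (show ((‖WithLp.toLp 2 v‖⁻¹ : ℝ) : ℂ) • WithLp.toLp 2 v ∈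
      Metric.sphere (0 : EuclideanSpace ℂ (Fin L)) 1 by
        rw [mem_sphere_zero_iff_norm, norm_smul, Complex.norm_real, norm_inv, norm_norm]
        exact inv_mul_cancel₀ hv'.ne')
    have h2 : N x.ofLp ≤ ‖WithLp.toLp 2 v‖⁻¹ * N v := by
      simpa [map_smul_eq_mul] using h1
    rw [inv_mul_eq_div, le_div_iff₀ hx0, mul_comm]
    rwa [inv_mul_eq_div, le_div_iff₀ hv'] at h2
  -- The unit sphere is empty, so the space is trivial and any constant works.
  · refine ⟨1, one_pos, fun v => ?_⟩
    have h0 : WithLp.toLp 2 v = 0 := by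
      by_contra h
      refine hne ⟨((‖WithLp.toLp 2 v‖⁻¹ : ℝ) : ℂ) • WithLp.toLp 2 v, ?_⟩
      rw [mem_sphere_zero_iff_norm, norm_smul, Complex.norm_real, norm_inv, norm_norm]
      exact inv_mul_cancel₀ (norm_ne_zero_iff.mpr h)
    rw [h0, norm_zero, one_mul]
    exact apply_nonneg N v

theorem subordinateNorm_nonneg (N : Seminorm ℂ (Fin L → ℂ)) (A : Matrix (Fin L) (Fin L) ℂ) :
    0 ≤ subordinateNorm N A := by
  refine Real.sSup_nonneg ?_
  rintro t ⟨v, -, rfl⟩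
  exact apply_nonneg N _

theorem specNorm_sub_comm (A B : Matrix (Fin L) (Fin L) ℂ) :
    specNorm (A - B) = specNorm (B - A) := by
  unfold specNorm
  rw [map_sub, map_sub, norm_sub_rev]

/-- A norm on `ℂ^L` is equivalent to the Euclidean one, and so are the subordinate norms. -/
theorem exists_subordinateNorm_bounds (hN : ∀ v, N v = 0 → v = 0) :
    ∃ C : ℝ, 0 < C ∧ (∀ A, specNorm A ≤ C * subordinateNorm N A) ∧
      (∀ A, subordinateNorm N A ≤ C * specNorm A) ∧
      ∀ A B, subordinateNorm N A ≤ subordinateNorm N B + C * specNorm (A - B) := by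
  obtain ⟨c₁, h1, H1⟩ := exists_seminorm_le_norm N
  obtain ⟨c₂, h2, H2⟩ := exists_norm_le_seminorm hN
  have hb : ∀ (A : Matrix (Fin L) (Fin L) ℂ) v, N (A *ᵥ v) ≤ c₁ * c₂ * specNorm A * N v := by
    intro A v
    refine (H1 _).trans ?_
    have h3 := toEuclideanCLM_le le_rfl (WithLp.toLp 2 v) (A := A)
    rw [toEuclideanCLM_toLp] at h3
    have h4 : specNorm A * ‖WithLp.toLp 2 v‖ ≤ specNorm A * (c₂ * N v) :=
      mul_le_mul_of_nonneg_left (H2 v) (norm_nonneg _)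
    nlinarith [h3.trans h4]
  have hb1 : ∀ (A : Matrix (Fin L) (Fin L) ℂ) v, N v ≤ 1 → N (A *ᵥ v) ≤ c₁ * c₂ * specNorm A :=
    fun A v hv => (hb A v).trans
      (mul_le_of_le_one_right (mul_nonneg (by positivity) (norm_nonneg _)) hv)
  have hbdd : ∀ A : Matrix (Fin L) (Fin L) ℂ,
      BddAbove {t : ℝ | ∃ v : Fin L → ℂ, N v ≤ 1 ∧ t = N (A *ᵥ v)} := fun A =>
    ⟨c₁ * c₂ * specNorm A, by rintro t ⟨v, hv, rfl⟩; exact hb1 A v hv⟩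
  have hnon : ∀ A : Matrix (Fin L) (Fin L) ℂ,
      {t : ℝ | ∃ v : Fin L → ℂ, N v ≤ 1 ∧ t = N (A *ᵥ v)}.Nonempty := fun A =>
    ⟨_, 0, by simp, rfl⟩
  have hle : ∀ (A : Matrix (Fin L) (Fin L) ℂ) v, N v ≤ 1 → N (A *ᵥ v) ≤ subordinateNorm N A :=
    fun A v hv => le_csSup (hbdd A) ⟨v, hv, rfl⟩
  refine ⟨c₁ * c₂, by positivity, fun A => ?_, fun A => ?_, fun A B => ?_⟩
  · refine ContinuousLinearMap.opNorm_le_bound _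
      (mul_nonneg (by positivity) (subordinateNorm_nonneg N A)) fun x => ?_
    rcases eq_or_ne x 0 with rfl | hx
    · simp
    obtain ⟨v, rfl⟩ : ∃ v, WithLp.toLp 2 v = x := ⟨x.ofLp, rfl⟩
    have hv : 0 < N v := by
      refine lt_of_le_of_ne (apply_nonneg N _) fun h => hx ?_
      rw [hN v h.symm]; rfl
    rw [toEuclideanCLM_toLp]
    have h3 : N (A *ᵥ v) ≤ subordinateNorm N A * N v := by
      have h4 := hle A (((N v)⁻¹ : ℝ) • v : Fin L → ℂ) (by
        rw [← Complex.coe_smul, map_smul_eq_mul, Complex.norm_real, norm_inv,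
          Real.norm_of_nonneg hv.le, inv_mul_cancel₀ hv.ne'])
      rw [mulVec_smul, ← Complex.coe_smul, map_smul_eq_mul, Complex.norm_real, norm_inv,
        Real.norm_of_nonneg hv.le, inv_mul_eq_div, div_le_iff₀ hv] at h4
      exact h4
    have h5 := subordinateNorm_nonneg N A
    calc ‖WithLp.toLp 2 (A *ᵥ v)‖ ≤ c₂ * N (A *ᵥ v) := H2 _
      _ ≤ c₂ * (subordinateNorm N A * (c₁ * ‖WithLp.toLp 2 v‖)) := by
        gcongr
        exact h3.trans (mul_le_mul_of_nonneg_left (H1 v) h5)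
      _ = _ := by ring
  · exact csSup_le (hnon A) (by rintro t ⟨v, hv, rfl⟩; exact hb1 A v hv)
  · refine csSup_le (hnon A) ?_
    rintro t ⟨v, hv, rfl⟩
    have h3 : A *ᵥ v = B *ᵥ v + (A - B) *ᵥ v := by rw [sub_mulVec]; abel
    rw [h3]
    exact (map_add_le_add N _ _).trans (add_le_add (hle B v hv) (hb1 _ v hv))

/-- The last bound of `exists_subordinateNorm_bounds`, used in both directions, is a Lipschitz
estimate with respect to the spectral norm. -/
theorem continuous_subordinateNorm {X : Type*} [TopologicalSpace X] (hN : ∀ v, N v = 0 → v = 0)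
    {A : X → Matrix (Fin L) (Fin L) ℂ}
    (hA : Continuous fun x => toEuclideanCLM (n := Fin L) (𝕜 := ℂ) (A x)) :
    Continuous fun x => subordinateNorm N (A x) := by
  obtain ⟨C, -, -, -, h⟩ := exists_subordinateNorm_bounds hN
  refine continuous_iff_continuousAt.mpr fun x₀ => ?_
  have h1 := hA.tendsto x₀
  rw [tendsto_iff_norm_sub_tendsto_zero] at h1
  rw [ContinuousAt, tendsto_iff_norm_sub_tendsto_zero]
  refine squeeze_zero (fun _ => norm_nonneg _) (fun x => ?_) (by simpa using h1.const_mul C)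
  have h2 := h (A x) (A x₀)
  have h3 := h (A x₀) (A x)
  rw [specNorm_sub_comm (A x₀)] at h3
  have h4 : specNorm (A x - A x₀) = ‖toEuclideanCLM (n := Fin L) (𝕜 := ℂ) (A x) -
      toEuclideanCLM (n := Fin L) (𝕜 := ℂ) (A x₀)‖ := by rw [specNorm, map_sub]
  rw [h4] at h2 h3
  rw [Real.norm_eq_abs, abs_le]
  constructor <;> linarith

end SubordinateNorm

/-! ### Fractional moments of the Green function -/

section FractionalMoments

variable {L : ℕ} {N : Seminorm ℂ (Fin L → ℂ)}

theorem specNorm_green {α : Matrix (Fin L) (Fin L) ℂ} (hα : specNorm α < 1) (Ub Vb : UL L)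
    (ω : Sample L) (J : Set ℤ) (z : ℂ) (k l : J) :
    specNorm (green α Ub Vb ω J z k l) = ‖gblk (randomScatU hα ω) Ub Vb J z k l‖ := by
  rw [specNorm, green_eq_gblk hα]

theorem continuous_green {α : Matrix (Fin L) (Fin L) ℂ} (hα : specNorm α < 1) (Ub Vb : UL L)
    {J : Set ℤ} {z : ℂ} (hz : ‖z‖ ≠ 1) (k l : J) :
    Continuous fun ω => toEuclideanCLM (n := Fin L) (𝕜 := ℂ) (green α Ub Vb ω J z k l) := by
  simp only [green_eq_gblk hα]
  exact continuous_gblk_randomScatU hα Ub Vb hz k l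

theorem integrable_subordinateNorm_green {α : Matrix (Fin L) (Fin L) ℂ} (hα : specNorm α < 1)
    (hN : ∀ v, N v = 0 → v = 0) (p : unitInterval) (Ub Vb : UL L) {J : Set ℤ} {z : ℂ}
    (hz : ‖z‖ ≠ 1) (k l : J) {s : ℝ} (hs : 0 < s) :
    Integrable (fun ω => subordinateNorm N (green α Ub Vb ω J z k l) ^ s) (law L p) := by
  obtain ⟨C, hC, -, hle, -⟩ := exists_subordinateNorm_bounds hN
  have hc := (continuous_subordinateNorm hN (continuous_green hα Ub Vb hz k l)).rpow_const
    fun _ => Or.inr hs.le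
  refine Integrable.of_bound hc.measurable.aestronglyMeasurable ((C * |‖z‖ - 1|⁻¹) ^ s)
    (Filter.Eventually.of_forall fun ω => ?_)
  have h0 := subordinateNorm_nonneg N (green α Ub Vb ω J z k l)
  rw [Real.norm_of_nonneg (Real.rpow_nonneg h0 s)]
  refine Real.rpow_le_rpow h0 ((hle _).trans ?_) hs.le
  rw [specNorm_green hα]
  exact mul_le_mul_of_nonneg_left (norm_gblk_le _ Ub Vb hz k l) hC.le

theorem sq_integral_le_integral_sq {Ω : Type*} [MeasurableSpace Ω] {μ : Measure Ω}
    [IsProbabilityMeasure μ] {f : Ω → ℝ} (hf : Integrable f μ)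
    (hf2 : Integrable (fun x => f x ^ 2) μ) : (∫ x, f x ∂μ) ^ 2 ≤ ∫ x, f x ^ 2 ∂μ :=
  even_two.convexOn_pow.map_integral_le (by fun_prop) isClosed_univ (by simp) hf hf2

/-- Equivalence of norms carries the two-cut estimate over from the operator norm, at the price of a
factor C^s in each direction. -/
theorem integral_subordinateNorm_green_le {α : Matrix (Fin L) (Fin L) ℂ} (hα : specNorm α < 1)
    (hN : ∀ v, N v = 0 → v = 0) {s : ℝ} (hs0 : 0 < s) (hs1 : s < 1) :
    ∃ C : ℝ, 0 < C ∧ ∀ (p : unitInterval) (Ub Vb : UL L) (z : ℂ), ‖z‖ ≠ 1 →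
      ∀ (a : WithBot ℤ) (b : WithTop ℤ) (k l : ℤ)
        (hak : a < (k : WithBot ℤ)) (hkb : (k : WithTop ℤ) < b)
        (hal : a < (l : WithBot ℤ)) (hlb : (l : WithTop ℤ) < b), k ≠ l →
      ∫ ω, subordinateNorm N (green α Ub Vb ω (interval a b) z
          ⟨k, hak.le, hkb.le⟩ ⟨l, hal.le, hlb.le⟩) ^ s ∂(law L p) ≤
        C * ∫ ω, subordinateNorm N (green α Ub Vb ω (Set.uIcc k l) z
          ⟨k, Set.left_mem_uIcc⟩ ⟨l, Set.right_mem_uIcc⟩) ^ s ∂(law L p) := by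
  obtain ⟨C, hC, hlow, hup, -⟩ := exists_subordinateNorm_bounds hN
  set K := (avgConst L s (specNorm α)).toReal with hK
  have hKtop : avgConst L s (specNorm α) ≠ ∞ := avgConst_ne_top L hs0 _
  have hK0 : 0 ≤ K := ENNReal.toReal_nonneg
  have hCs : 0 < C ^ s := Real.rpow_pos_of_pos hC s
  have hpi : (0 : ℝ) < 2 * Real.pi := Real.two_pi_pos
  -- One factor K/2π for each cut; the added 1 makes the constant visibly positive, as only K ≥ 0 is
  -- at hand.
  refine ⟨C ^ s * (K * K / (2 * Real.pi * (2 * Real.pi)) * C ^ s) + 1, by positivity, ?_⟩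
  intro p Ub Vb z hz a b k l hak hkb hal hlb hkl
  have h0 := fun (J : Set ℤ) (k l : J) (ω : Sample L) =>
    subordinateNorm_nonneg N (green α Ub Vb ω J z k l)
  have hint : ∀ (J : Set ℤ) (k l : J),
      Integrable (fun ω => ‖gblk (randomScatU hα ω) Ub Vb J z k l‖ ^ s) (law L p) := by
    intro J k l
    have hc := (continuous_gblk_randomScatU hα Ub Vb hz k l).norm.rpow_const
      (p := s) fun _ => Or.inr hs0.le
    refine Integrable.of_bound hc.measurable.aestronglyMeasurable ((|‖z‖ - 1|⁻¹) ^ s)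
      (Filter.Eventually.of_forall fun ω => ?_)
    rw [Real.norm_of_nonneg (by positivity)]
    exact Real.rpow_le_rpow (norm_nonneg _) (norm_gblk_le _ Ub Vb hz k l) hs0.le
  have hli : ∀ (J : Set ℤ) (k l : J),
      ∫⁻ ω, ‖gblk (randomScatU hα ω) Ub Vb J z k l‖ₑ ^ s ∂(law L p) =
        ENNReal.ofReal (∫ ω, ‖gblk (randomScatU hα ω) Ub Vb J z k l‖ ^ s ∂(law L p)) := by
    intro J k l
    rw [ofReal_integral_eq_lintegral_ofReal (hint J k l)
      (Filter.Eventually.of_forall fun ω => by positivity)]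
    refine lintegral_congr fun ω => ?_
    rw [← ENNReal.ofReal_rpow_of_nonneg (norm_nonneg _) hs0.le, ofReal_norm]
  have hmain := lintegral_gblk_interval_le hα p Ub Vb hz hak hkb hal hlb hkl hs0 hs1
  rw [hli, hli, ← ENNReal.ofReal_toReal hKtop, ← hK] at hmain
  rw [← ENNReal.ofReal_mul hpi.le, ← ENNReal.ofReal_mul hpi.le, ← ENNReal.ofReal_mul hK0,
    ← ENNReal.ofReal_mul hK0, ENNReal.ofReal_le_ofReal_iff (mul_nonneg hK0 (mul_nonneg hK0
      (integral_nonneg fun ω => by positivity)))] at hmain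
  have e1 : ∫ ω, subordinateNorm N (green α Ub Vb ω (interval a b) z
      ⟨k, hak.le, hkb.le⟩ ⟨l, hal.le, hlb.le⟩) ^ s ∂(law L p) ≤
      C ^ s * ∫ ω, ‖gblk (randomScatU hα ω) Ub Vb (interval a b) z
        ⟨k, hak.le, hkb.le⟩ ⟨l, hal.le, hlb.le⟩‖ ^ s ∂(law L p) := by
    rw [← integral_const_mul]
    refine integral_mono (integrable_subordinateNorm_green hα hN p Ub Vb hz _ _ hs0)
      ((hint _ _ _).const_mul _) fun ω => ?_
    rw [← Real.mul_rpow hC.le (norm_nonneg _), ← specNorm_green hα]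
    exact Real.rpow_le_rpow (h0 _ _ _ ω) (hup _) hs0.le
  have e2 : ∫ ω, ‖gblk (randomScatU hα ω) Ub Vb (Set.uIcc k l) z
      ⟨k, Set.left_mem_uIcc⟩ ⟨l, Set.right_mem_uIcc⟩‖ ^ s ∂(law L p) ≤
      C ^ s * ∫ ω, subordinateNorm N (green α Ub Vb ω (Set.uIcc k l) z
        ⟨k, Set.left_mem_uIcc⟩ ⟨l, Set.right_mem_uIcc⟩) ^ s ∂(law L p) := by
    rw [← integral_const_mul]
    refine integral_mono (hint _ _ _)
      ((integrable_subordinateNorm_green hα hN p Ub Vb hz _ _ hs0).const_mul _) fun ω => ?_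
    rw [← Real.mul_rpow hC.le (h0 _ _ _ ω), ← specNorm_green hα]
    exact Real.rpow_le_rpow (norm_nonneg _) (hlow _) hs0.le
  have e3 : 0 ≤ ∫ ω, subordinateNorm N (green α Ub Vb ω (Set.uIcc k l) z
      ⟨k, Set.left_mem_uIcc⟩ ⟨l, Set.right_mem_uIcc⟩) ^ s ∂(law L p) :=
    integral_nonneg fun ω => Real.rpow_nonneg (h0 _ _ _ ω) s
  set X := ∫ ω, ‖gblk (randomScatU hα ω) Ub Vb (interval a b) z
        ⟨k, hak.le, hkb.le⟩ ⟨l, hal.le, hlb.le⟩‖ ^ s ∂(law L p)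
  set Y := ∫ ω, ‖gblk (randomScatU hα ω) Ub Vb (Set.uIcc k l) z
      ⟨k, Set.left_mem_uIcc⟩ ⟨l, Set.right_mem_uIcc⟩‖ ^ s ∂(law L p)
  have e4 : X ≤ K * K / (2 * Real.pi * (2 * Real.pi)) * Y := by
    rw [div_mul_eq_mul_div, le_div_iff₀ (by positivity)]
    linarith
  refine e1.trans ((mul_le_mul_of_nonneg_left
    (e4.trans (mul_le_mul_of_nonneg_left e2 (by positivity))) hCs.le).trans ?_)
  nlinarith

end FractionalMoments

end ScatteringZipper

/-! ### Conclusion by Jensen's inequality -/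

open MeasureTheory ScatteringZipper in
theorem mainTheorem9 (L : ℕ) (hL : 1 ≤ L) (p : unitInterval) (hp0 : 0 < p) (hp1 : p < 1)
    (α : Matrix (Fin L) (Fin L) ℂ) (hα : specNorm α < 1)
    (N : Seminorm ℂ (Fin L → ℂ)) (hN : ∀ v, N v = 0 → v = 0)
    (s : ℝ) (hs0 : 0 < s) (hs1 : s < 1 / 2) :
    ∃ C : ℝ, 0 < C ∧ ∀ ε : ℝ, 0 < ε → ∀ z ∈ annulus ε, ‖z‖ ≠ 1 →
      ∀ (Ub Vb : UL L) (a : WithBot ℤ) (b : WithTop ℤ) (k l : ℤ)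
        (hak : a < (k : WithBot ℤ)) (hkb : (k : WithTop ℤ) < b)
        (hal : a < (l : WithBot ℤ)) (hlb : (l : WithTop ℤ) < b), 4 < |k - l| →
      Integrable (fun ω => subordinateNorm N
        (green α Ub Vb ω (interval a b) z
          ⟨k, hak.le, hkb.le⟩ ⟨l, hal.le, hlb.le⟩) ^ s) (law L p) ∧
      Integrable (fun ω => subordinateNorm N
        (green α Ub Vb ω (Set.uIcc k l) z
          ⟨k, Set.left_mem_uIcc⟩ ⟨l, Set.right_mem_uIcc⟩) ^ (2 * s)) (law L p) ∧
      (∫ ω, subordinateNorm N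
        (green α Ub Vb ω (interval a b) z
          ⟨k, hak.le, hkb.le⟩ ⟨l, hal.le, hlb.le⟩) ^ s ∂(law L p)) ^ 2 ≤
        C * ∫ ω, subordinateNorm N
          (green α Ub Vb ω (Set.uIcc k l) z
            ⟨k, Set.left_mem_uIcc⟩ ⟨l, Set.right_mem_uIcc⟩) ^ (2 * s) ∂(law L p) := by
  obtain ⟨C, hC, h⟩ := integral_subordinateNorm_green_le hα hN hs0 (hs1.trans (by norm_num))
  refine ⟨C ^ 2, by positivity, fun ε _ z _ hz Ub Vb a b k l hak hkb hal hlb hkl => ?_⟩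
  have hne : k ≠ l := by
    rintro rfl
    simp at hkl
  have i1 := integrable_subordinateNorm_green hα hN p Ub Vb hz
    (⟨k, Set.left_mem_uIcc⟩ : Set.uIcc k l) ⟨l, Set.right_mem_uIcc⟩ hs0
  have i2 := integrable_subordinateNorm_green hα hN p Ub Vb hz
    (⟨k, Set.left_mem_uIcc⟩ : Set.uIcc k l) ⟨l, Set.right_mem_uIcc⟩ (s := 2 * s) (by positivity)
  refine ⟨integrable_subordinateNorm_green hα hN p Ub Vb hz _ _ hs0, i2, ?_⟩
  -- With X^{2s} = (X^s)², Jensen applied to the box alone turns the square of the first-power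
  -- estimate into the claim.
  have hsq : ∀ ω, subordinateNorm N (green α Ub Vb ω (Set.uIcc k l) z
      ⟨k, Set.left_mem_uIcc⟩ ⟨l, Set.right_mem_uIcc⟩) ^ (2 * s) =
      (subordinateNorm N (green α Ub Vb ω (Set.uIcc k l) z
        ⟨k, Set.left_mem_uIcc⟩ ⟨l, Set.right_mem_uIcc⟩) ^ s) ^ 2 := fun ω => by
    rw [← Real.rpow_mul_natCast (subordinateNorm_nonneg _ _), mul_comm]
    norm_num
  simp only [hsq] at i2 ⊢
  have h1 := h p Ub Vb z hz a b k l hak hkb hal hlb hne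
  have h2 := pow_le_pow_left₀ (integral_nonneg fun ω =>
    Real.rpow_nonneg (subordinateNorm_nonneg N _) s) h1 2
  rw [mul_pow] at h2
  exact h2.trans (mul_le_mul_of_nonneg_left (sq_integral_le_integral_sq i1 i2) (by positivity))
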